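/- **Definitions.** A *prop* is a symmetric strict monoidal category whose objects are the natural numbers and whose tensor product on objects is addition; a *morphism of props* is an identity-on-objects symmetric strict monoidal functor. A *corelation* $X\to Y$ between sets is a partition of the disjoint union $X+Y$; the composite of $\alpha\colon X\to Y$ and $\beta\colon Y\to Z$ is the restriction to $X+Z$ of the finest partition of $X+Y+Z$ whose restrictions to $X+Y$ and $Y+Z$ are coarser than $\alpha$ and $\beta$ respectively. Finite sets and corelations form a symmetric monoidal category under disjoint union. Let $\mathbf{Corel}$ be the prop whose morphisms $n\to m$ are the corelations from $\{0,\dots,n-1\}$ to $\{0,\dots,m-1\}$, with disjoint union transported along the bijections $\{0,\dots,n-1\}+\{0,\dots,m-1\}\cong\{0,\dots,n+m-1\}$. An *extraspecial commutative Frobenius monoid* in a symmetric monoidal category $(\mathcal C,\otimes,I)$ is an object $X$ with a commutative monoid structure $(\mu\colon X\otimes X\to X,\ \eta\colon I\to X)$ and a cocommutative comonoid structure $(\delta\colon X\to X\otimes X,\ \epsilon\colon X\to I)$ such that (suppressing associators) $(1\otimes\mu)(\delta\otimes 1)=\delta\mu=(\mu\otimes1)(1\otimes\delta)$ (Frobenius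 law), $\mu\delta=1_X$ (special law) and $\epsilon\eta=1_I$ (extra law); a morphism of these is a morphism of $\mathcal C$ commuting with $\mu,\eta,\delta,\epsilon$. Let $\mathbf{Th(ESCFM)}$ be the prop presented by generators $\mu\colon2\to1$, $\eta\colon0\to1$, $\delta\colon1\to2$, $\epsilon\colon1\to0$ and these equations: its morphisms are the terms built from the generators, identities and braidings by composition and tensor product, modulo the least congruence containing the laws of props and the equations. **Theorem.** 1. $\mathbf{Corel}$ is a skeleton of the category of finite sets and corelations, by a symmetric monoidal functor. 2. There is an isomorphism of props $\mathbf{Th(ESCFM)}\cong\mathbf{Corel}$, and it can be chosen to send each of $\mu,\eta,\delta,\epsilon$ to the corelation with exactly one block. 3. The category of finite sets and corelations is equivalent, as a symmetric monoidal category, to $\mathbf{Th(ESCFM)}$. 4. $\mathbf{Corel}$ is the prop for extraspecial commutative Frobenius monoids: for every symmetric monoidal category $\mathcal C$, the category of (strong) symmetric monoidal functors $\mathbf{Corel}\to\mathcal C$ and monoidal natural transformations is equivalent to the category of extraspecial commutative Frobenius monoids in $\mathcal C$, by an equivalence which, up to natural isomorphism, takes a functor to a monoid whose underlying object is its value at $1$.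 -/

import Mathlib

open CategoryTheory MonoidalCategory

universe w v u

/-! ### Corelations -/

/-- A corelation from `X` to `Y` is a partition of the disjoint union `X + Y`, encoded by the
corresponding equivalence relation. In the lattice of equivalence relations `r ≤ s` means that
`r` is finer than `s`. -/
abbrev Corelation (X Y : Type*) := Setoid (X ⊕ Y)

namespace Corelation

section

variable {X Y Z W X' Y' Z' : Type*}

/-- The inclusion of `X + Y` into `X + Y + Z`. -/
def inXY (X Y Z : Type*) : X ⊕ Y → X ⊕ Y ⊕ Z := Sum.map id Sum.inl

/-- The inclusion of `Y + Z` into `X + Y + Z`. -/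
def inYZ (X Y Z : Type*) : Y ⊕ Z → X ⊕ Y ⊕ Z := Sum.inr

/-- The inclusion of `X + Z` into `X + Y + Z`. -/
def inXZ (X Y Z : Type*) : X ⊕ Z → X ⊕ Y ⊕ Z := Sum.map id Sum.inr

/-- The finest partition of `X + Y + Z` whose restrictions to `X + Y` and to `Y + Z` are coarser
than `α` and `β` respectively. -/
def glue (α : Corelation X Y) (β : Corelation Y Z) : Setoid (X ⊕ Y ⊕ Z) :=
  sInf {s | α ≤ s.comap (inXY X Y Z) ∧ β ≤ s.comap (inYZ X Y Z)}

/-- Composition of corelations, in diagrammatic order. -/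
def comp (α : Corelation X Y) (β : Corelation Y Z) : Corelation X Z :=
  (glue α β).comap (inXZ X Y Z)

/-- The corelation of a bijection `e`, with blocks `{x, e x}`. -/
def ofEquiv (e : X ≃ Y) : Corelation X Y := Setoid.ker (Sum.elim e id)

/-- The identity corelation, whose blocks consist of the two copies of an element of `X`. -/
def id (X : Type*) : Corelation X X := Setoid.ker (Sum.elim _root_.id _root_.id)

/-- The disjoint union of corelations: its blocks are the blocks of `α` and the blocks of `β`. -/
def tensor (α : Corelation X Y) (β : Corelation X' Y') : Corelation (X ⊕ X') (Y ⊕ Y') where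
  r a b := Sum.LiftRel α β (Equiv.sumSumSumComm X X' Y Y' a) (Equiv.sumSumSumComm X X' Y Y' b)
  iseqv :=
    { refl := fun a => by
        cases Equiv.sumSumSumComm X X' Y Y' a
        · exact Sum.LiftRel.inl (α.refl _)
        · exact Sum.LiftRel.inr (β.refl _)
      symm := fun {a b} h => by
        revert h
        generalize Equiv.sumSumSumComm X X' Y Y' a = a'
        generalize Equiv.sumSumSumComm X X' Y Y' b = b'
        rintro (h | h)
        · exact Sum.LiftRel.inl (α.symm h)
        · exact Sum.LiftRel.inr (β.symm h)
      trans := fun {a b c} h h' => by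
        revert h h'
        generalize Equiv.sumSumSumComm X X' Y Y' a = a'
        generalize Equiv.sumSumSumComm X X' Y Y' b = b'
        generalize Equiv.sumSumSumComm X X' Y Y' c = c'
        rintro (h | h) h'
        · obtain ⟨h'⟩ := h'
          exact Sum.LiftRel.inl (α.trans h ‹_›)
        · obtain _ | ⟨h'⟩ := h'
          exact Sum.LiftRel.inr (β.trans h ‹_›) }

/-- Auxiliary: a two-colouring of `X + Y` is constant on the blocks of `α`. -/
def Colors (α : Corelation X Y) (u : X → Prop) (v : Y → Prop) : Prop :=
  ∀ a b, α a b → (Sum.elim u v a ↔ Sum.elim u v b)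

theorem ext_colors {α β : Corelation X Y} (h : ∀ u v, α.Colors u v ↔ β.Colors u v) : α = β := by
  have key : ∀ {α β : Corelation X Y}, (∀ u v, β.Colors u v → α.Colors u v) → α ≤ β := by
    intro α β h a b hab
    have hc := h (fun x => β a (Sum.inl x)) (fun y => β a (Sum.inr y)) (fun c d hcd => by
      have : ∀ c, Sum.elim (fun x => β a (Sum.inl x)) (fun y => β a (Sum.inr y)) c = β a c := by
        rintro (c | c) <;> rfl
      rw [this, this]
      exact ⟨fun h => β.trans h hcd, fun h => β.trans h (β.symm hcd)⟩) a b hab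
    have : ∀ c, Sum.elim (fun x => β a (Sum.inl x)) (fun y => β a (Sum.inr y)) c = β a c := by
      rintro (c | c) <;> rfl
    rw [this, this] at hc
    exact hc.1 (β.refl a)
  exact le_antisymm (key fun u v => (h u v).2) (key fun u v => (h u v).1)

theorem colors_comp (α : Corelation X Y) (β : Corelation Y Z) (u : X → Prop) (w : Z → Prop) :
    (comp α β).Colors u w ↔ ∃ v, α.Colors u v ∧ β.Colors v w := by
  constructor
  · intro h
    let c : X ⊕ Y ⊕ Z → Prop := fun q => ∃ p, glue α β q (inXZ X Y Z p) ∧ Sum.elim u w p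
    have hinv : ∀ q q', glue α β q q' → (c q ↔ c q') := fun q q' hq =>
      ⟨fun ⟨p, hp, hc⟩ => ⟨p, (glue α β).trans ((glue α β).symm hq) hp, hc⟩,
        fun ⟨p, hp, hc⟩ => ⟨p, (glue α β).trans hq hp, hc⟩⟩
    have hXZ : ∀ p, c (inXZ X Y Z p) ↔ Sum.elim u w p := fun p =>
      ⟨fun ⟨p', hp, hc⟩ => (h p p' hp).2 hc, fun hc => ⟨p, (glue α β).refl _, hc⟩⟩
    have hα : ∀ a b, α a b → glue α β (inXY X Y Z a) (inXY X Y Z b) :=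
      fun a b hab s hs => hs.1 hab
    have hβ : ∀ a b, β a b → glue α β (inYZ X Y Z a) (inYZ X Y Z b) :=
      fun a b hab s hs => hs.2 hab
    refine ⟨fun y => c (Sum.inr (Sum.inl y)), fun a b hab => ?_, fun a b hab => ?_⟩
    · have e : ∀ a, Sum.elim u (fun y => c (Sum.inr (Sum.inl y))) a ↔ c (inXY X Y Z a) := by
        rintro (x | y)
        · exact (hXZ (Sum.inl x)).symm
        · exact Iff.rfl
      rw [e, e]
      exact hinv _ _ (hα a b hab)
    · have e : ∀ a, Sum.elim (fun y => c (Sum.inr (Sum.inl y))) w a ↔ c (inYZ X Y Z a) := by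
        rintro (y | z)
        · exact Iff.rfl
        · exact (hXZ (Sum.inr z)).symm
      rw [e, e]
      exact hinv _ _ (hβ a b hab)
  · rintro ⟨v, hα, hβ⟩ a b hab
    have := hab (Setoid.ker (Sum.elim u (Sum.elim v w))) ⟨fun a b h => by
      have := hα a b h
      rcases a with a | a <;> rcases b with b | b <;> exact propext this, fun a b h => by
      have := hβ a b h
      rcases a with a | a <;> rcases b with b | b <;> exact propext this⟩
    rcases a with a | a <;> rcases b with b | b <;> exact iff_of_eq this

theorem colors_ofEquiv (e : X ≃ Y) (u : X → Prop) (v : Y → Prop) :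
    (ofEquiv e).Colors u v ↔ u = v ∘ e := by
  constructor
  · intro h
    funext x
    exact propext (h (Sum.inl x) (Sum.inr (e x)) rfl)
  · rintro rfl a b hab
    have e' : ∀ a, Sum.elim (v ∘ e) v a = v (Sum.elim e _root_.id a) := by
      rintro (a | a) <;> rfl
    have : Sum.elim e _root_.id a = Sum.elim e _root_.id b := hab
    rw [e', e', this]

theorem id_eq (X : Type*) : id X = ofEquiv (Equiv.refl X) := rfl

theorem colors_id (u v : X → Prop) : (id X).Colors u v ↔ u = v := colors_ofEquiv (Equiv.refl X) u v

theorem colors_tensor (α : Corelation X Y) (β : Corelation X' Y') (u : X ⊕ X' → Prop)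
    (v : Y ⊕ Y' → Prop) : (tensor α β).Colors u v ↔
      α.Colors (u ∘ Sum.inl) (v ∘ Sum.inl) ∧ β.Colors (u ∘ Sum.inr) (v ∘ Sum.inr) := by
  constructor
  · intro h
    refine ⟨fun a b hab => ?_, fun a b hab => ?_⟩
    · have := h (Sum.map Sum.inl Sum.inl a) (Sum.map Sum.inl Sum.inl b) (by
        rcases a with a | a <;> rcases b with b | b <;> exact Sum.LiftRel.inl hab)
      rcases a with a | a <;> rcases b with b | b <;> exact this
    · have := h (Sum.map Sum.inr Sum.inr a) (Sum.map Sum.inr Sum.inr b) (by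
        rcases a with a | a <;> rcases b with b | b <;> exact Sum.LiftRel.inr hab)
      rcases a with a | a <;> rcases b with b | b <;> exact this
  · rintro ⟨hα, hβ⟩ a b hab
    change Sum.LiftRel α β (Equiv.sumSumSumComm X X' Y Y' a) (Equiv.sumSumSumComm X X' Y Y' b)
      at hab
    rcases a with (a | a) | (a | a) <;> rcases b with (b | b) | (b | b) <;>
      simp at hab <;> first | exact hα _ _ hab | exact hβ _ _ hab

theorem id_comp (α : Corelation X Y) : comp (id X) α = α :=
  ext_colors fun u v => by simp [colors_comp, colors_id]

theorem comp_id (α : Corelation X Y) : comp α (id Y) = α :=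
  ext_colors fun u v => by simp [colors_comp, colors_id]

theorem comp_assoc (α : Corelation X Y) (β : Corelation Y Z) (γ : Corelation Z W) :
    comp (comp α β) γ = comp α (comp β γ) :=
  ext_colors fun u v => by
    simp only [colors_comp]
    exact ⟨fun ⟨b, ⟨a, h1, h2⟩, h3⟩ => ⟨a, h1, b, h2, h3⟩,
      fun ⟨a, h1, b, h2, h3⟩ => ⟨b, ⟨a, h1, h2⟩, h3⟩⟩

theorem tensor_comp (α : Corelation X Y) (β : Corelation Y Z) (α' : Corelation X' Y')
    (β' : Corelation Y' Z') :
    comp (tensor α α') (tensor β β') = tensor (comp α β) (comp α' β') :=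
  ext_colors fun u v => by
    simp only [colors_comp, colors_tensor]
    exact ⟨fun ⟨w, ⟨h1, h2⟩, h3, h4⟩ => ⟨⟨_, h1, h3⟩, _, h2, h4⟩,
      fun ⟨⟨w, h1, h3⟩, w', h2, h4⟩ => ⟨Sum.elim w w', ⟨h1, h2⟩, h3, h4⟩⟩

theorem ofEquiv_comp (e : X ≃ Y) (f : Y ≃ Z) : comp (ofEquiv e) (ofEquiv f) = ofEquiv (e.trans f) :=
  ext_colors fun u v => by
    simp only [colors_comp, colors_ofEquiv, exists_eq_right]
    rfl

theorem ofEquiv_tensor (e : X ≃ Y) (f : X' ≃ Y') :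
    tensor (ofEquiv e) (ofEquiv f) = ofEquiv (Equiv.sumCongr e f) :=
  ext_colors fun u v => by
    simp only [colors_tensor, colors_ofEquiv]
    constructor
    · rintro ⟨h1, h2⟩
      funext x
      rcases x with x | x
      · exact congrFun h1 x
      · exact congrFun h2 x
    · rintro rfl
      exact ⟨rfl, rfl⟩

theorem colors_ofEquiv_comp (e : X ≃ Y) (α : Corelation Y Z) (u : X → Prop) (v : Z → Prop) :
    (comp (ofEquiv e) α).Colors u v ↔ α.Colors (u ∘ e.symm) v := by
  rw [colors_comp]
  simp only [colors_ofEquiv]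
  constructor
  · rintro ⟨w, rfl, h⟩
    simpa [Function.comp_assoc] using h
  · intro h
    exact ⟨_, by simp [Function.comp_assoc], h⟩

theorem colors_comp_ofEquiv (e : Y ≃ Z) (α : Corelation X Y) (u : X → Prop) (v : Z → Prop) :
    (comp α (ofEquiv e)).Colors u v ↔ α.Colors u (v ∘ e) := by
  rw [colors_comp]
  simp only [colors_ofEquiv]
  exact ⟨fun ⟨w, h, hw⟩ => hw ▸ h, fun h => ⟨_, h, rfl⟩⟩

end

end Corelation

/-! ### The symmetric monoidal category of finite sets and corelations -/

/-- Objects of the category of corelations: finite sets. -/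
structure FinCorel : Type (w + 1) where
  /-- The underlying set. -/
  carrier : Type w
  [finite : Finite carrier]

namespace FinCorel

attribute [instance] FinCorel.finite

instance : Category FinCorel.{w} where
  Hom X Y := Corelation X.carrier Y.carrier
  id X := Corelation.id X.carrier
  comp α β := Corelation.comp α β
  id_comp := Corelation.id_comp
  comp_id := Corelation.comp_id
  assoc := Corelation.comp_assoc

/-- The isomorphism of corelations given by a bijection. -/
def isoOfEquiv {X Y : FinCorel.{w}} (e : X.carrier ≃ Y.carrier) : X ≅ Y where
  hom := Corelation.ofEquiv e
  inv := Corelation.ofEquiv e.symm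
  hom_inv_id := by
    refine (Corelation.ofEquiv_comp _ _).trans ?_
    rw [Equiv.self_trans_symm]; rfl
  inv_hom_id := by
    refine (Corelation.ofEquiv_comp _ _).trans ?_
    rw [Equiv.symm_trans_self]; rfl

instance : MonoidalCategoryStruct FinCorel.{w} where
  tensorObj X Y := ⟨X.carrier ⊕ Y.carrier⟩
  tensorUnit := ⟨PEmpty⟩
  tensorHom α β := Corelation.tensor α β
  whiskerLeft X _ _ α := Corelation.tensor (Corelation.id X.carrier) α
  whiskerRight α X := Corelation.tensor α (Corelation.id X.carrier)
  associator X Y Z := isoOfEquiv (Equiv.sumAssoc X.carrier Y.carrier Z.carrier)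
  leftUnitor X := isoOfEquiv (Equiv.emptySum PEmpty X.carrier)
  rightUnitor X := isoOfEquiv (Equiv.sumEmpty X.carrier PEmpty)

instance : MonoidalCategory FinCorel.{w} :=
  MonoidalCategory.ofTensorHom
    (id_tensorHom_id := fun X Y => by
      refine (Corelation.ofEquiv_tensor (Equiv.refl _) (Equiv.refl _)).trans ?_
      rw [Equiv.sumCongr_refl]; rfl)
    (id_tensorHom := fun _ _ _ _ => rfl)
    (tensorHom_id := fun _ _ => rfl)
    (tensorHom_comp_tensorHom := fun f g f' g' => Corelation.tensor_comp f f' g g')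
    (associator_naturality := fun f g h => Corelation.ext_colors fun u v => by
      refine (Corelation.colors_comp_ofEquiv _ _ _ _).trans
        (Iff.trans ?_ (Corelation.colors_ofEquiv_comp _ _ _ _).symm)
      refine (Corelation.colors_tensor _ _ _ _).trans
        (Iff.trans ?_ (Corelation.colors_tensor _ _ _ _).symm)
      refine (and_congr_left' (Corelation.colors_tensor _ _ _ _)).trans
        (Iff.trans ?_ (and_congr_right' (Corelation.colors_tensor _ _ _ _)).symm)
      exact and_assoc)
    (leftUnitor_naturality := fun f => Corelation.ext_colors fun u v => by
      refine (Corelation.colors_comp_ofEquiv _ _ _ _).trans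
        (Iff.trans ?_ (Corelation.colors_ofEquiv_comp _ _ _ _).symm)
      refine (Corelation.colors_tensor _ _ _ _).trans ?_
      refine (and_congr_left' (Corelation.colors_id _ _)).trans ?_
      exact and_iff_right (funext fun x => x.elim))
    (rightUnitor_naturality := fun f => Corelation.ext_colors fun u v => by
      refine (Corelation.colors_comp_ofEquiv _ _ _ _).trans
        (Iff.trans ?_ (Corelation.colors_ofEquiv_comp _ _ _ _).symm)
      refine (Corelation.colors_tensor _ _ _ _).trans ?_
      refine (and_congr_right' (Corelation.colors_id _ _)).trans ?_
      exact and_iff_left (funext fun x => x.elim))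
    (pentagon := fun W X Y Z => by
      change Corelation.comp (Corelation.tensor (Corelation.ofEquiv _)
        (Corelation.ofEquiv (Equiv.refl _))) (Corelation.comp (Corelation.ofEquiv _)
        (Corelation.tensor (Corelation.ofEquiv (Equiv.refl _)) (Corelation.ofEquiv _))) =
        Corelation.comp (Corelation.ofEquiv _) (Corelation.ofEquiv _)
      simp only [Corelation.ofEquiv_tensor, Corelation.ofEquiv_comp]
      congr 1
      ext x
      rcases x with ((x | x) | x) | x <;> rfl)
    (triangle := fun X Y => by
      change Corelation.comp (Corelation.ofEquiv _)
        (Corelation.tensor (Corelation.ofEquiv (Equiv.refl _)) (Corelation.ofEquiv _)) =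
        Corelation.tensor (Corelation.ofEquiv _) (Corelation.ofEquiv (Equiv.refl _))
      simp only [Corelation.ofEquiv_tensor, Corelation.ofEquiv_comp]
      congr 1
      ext x
      rcases x with (x | x) | x
      · rfl
      · exact x.elim
      · rfl)

theorem braiding_naturality {X Y X' Y' : FinCorel.{w}} (f : X ⟶ Y) (g : X' ⟶ Y') :
    Corelation.comp (Corelation.tensor f g)
        (Corelation.ofEquiv (Equiv.sumComm Y.carrier Y'.carrier)) =
      Corelation.comp (Corelation.ofEquiv (Equiv.sumComm X.carrier X'.carrier))
        (Corelation.tensor g f) :=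
  Corelation.ext_colors fun u v => by
    rw [Corelation.colors_comp_ofEquiv, Corelation.colors_ofEquiv_comp, Corelation.colors_tensor,
      Corelation.colors_tensor]
    exact and_comm

instance : SymmetricCategory FinCorel.{w} where
  braiding X Y := isoOfEquiv (Equiv.sumComm X.carrier Y.carrier)
  braiding_naturality_right X Y Z f := braiding_naturality (𝟙 X) f
  braiding_naturality_left f Z := braiding_naturality f (𝟙 Z)
  hexagon_forward X Y Z := by
    change Corelation.comp (Corelation.ofEquiv _) (Corelation.comp (Corelation.ofEquiv _)
      (Corelation.ofEquiv _)) = Corelation.comp (Corelation.tensor (Corelation.ofEquiv _)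
      (Corelation.ofEquiv (Equiv.refl _))) (Corelation.comp (Corelation.ofEquiv _)
      (Corelation.tensor (Corelation.ofEquiv (Equiv.refl _)) (Corelation.ofEquiv _)))
    simp only [Corelation.ofEquiv_tensor, Corelation.ofEquiv_comp]
    congr 1
    ext x
    rcases x with (x | x) | x <;> rfl
  hexagon_reverse X Y Z := by
    change Corelation.comp (Corelation.ofEquiv _) (Corelation.comp (Corelation.ofEquiv _)
      (Corelation.ofEquiv _)) = Corelation.comp (Corelation.tensor
      (Corelation.ofEquiv (Equiv.refl _)) (Corelation.ofEquiv _))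
      (Corelation.comp (Corelation.ofEquiv _)
      (Corelation.tensor (Corelation.ofEquiv _) (Corelation.ofEquiv (Equiv.refl _))))
    simp only [Corelation.ofEquiv_tensor, Corelation.ofEquiv_comp]
    congr 1
    ext x
    rcases x with x | (x | x) <;> rfl
  symmetry X Y := by
    change Corelation.comp (Corelation.ofEquiv _) (Corelation.ofEquiv _) =
      Corelation.ofEquiv (Equiv.refl _)
    rw [Corelation.ofEquiv_comp]
    congr 1
    ext x
    rcases x with x | x <;> rfl

end FinCorel

/-! ### Props -/

/-- The operations of a prop: a symmetric strict monoidal category with objects the natural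
numbers and tensor product of objects given by addition. Composition is in diagrammatic order. -/
structure PROPData : Type (w + 1) where
  /-- The morphisms `n → m`. -/
  Hom : ℕ → ℕ → Type w
  /-- Identities. -/
  id : ∀ n, Hom n n
  /-- Composition. -/
  comp : ∀ {n m p}, Hom n m → Hom m p → Hom n p
  /-- The monoidal product of morphisms. -/
  tensor : ∀ {n m p q}, Hom n m → Hom p q → Hom (n + p) (m + q)
  /-- The braiding. -/
  braid : ∀ n m, Hom (n + m) (m + n)

/-- The identity, regarded as a morphism between equal objects. -/
def PROPData.eqHom (P : PROPData.{w}) {n m : ℕ} (h : n = m) : P.Hom n m := h ▸ P.id n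

/-- A prop. Strictness says that the identities `eqHom` serve as associators and unitors. -/
structure PROP : Type (w + 1) extends PROPData.{w} where
  id_comp : ∀ {n m} (f : Hom n m), comp (id n) f = f
  comp_id : ∀ {n m} (f : Hom n m), comp f (id m) = f
  assoc : ∀ {n m p q} (f : Hom n m) (g : Hom m p) (h : Hom p q),
    comp (comp f g) h = comp f (comp g h)
  tensor_id : ∀ n m, tensor (id n) (id m) = id (n + m)
  tensor_comp : ∀ {n m p n' m' p'} (f : Hom n m) (g : Hom m p) (f' : Hom n' m') (g' : Hom m' p'),
    comp (tensor f f') (tensor g g') = tensor (comp f g) (comp f' g')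
  tensor_assoc : ∀ {n m n' m' n'' m''} (f : Hom n m) (g : Hom n' m') (h : Hom n'' m''),
    comp (tensor (tensor f g) h) (toPROPData.eqHom (Nat.add_assoc m m' m'')) =
      comp (toPROPData.eqHom (Nat.add_assoc n n' n'')) (tensor f (tensor g h))
  unit_tensor : ∀ {n m} (f : Hom n m),
    comp (tensor (id 0) f) (toPROPData.eqHom (Nat.zero_add m)) =
      comp (toPROPData.eqHom (Nat.zero_add n)) f
  tensor_unit : ∀ {n m} (f : Hom n m),
    comp (tensor f (id 0)) (toPROPData.eqHom (Nat.add_zero m)) =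
      comp (toPROPData.eqHom (Nat.add_zero n)) f
  braid_naturality : ∀ {n m n' m'} (f : Hom n m) (g : Hom n' m'),
    comp (tensor f g) (braid m m') = comp (braid n n') (tensor g f)
  braid_braid : ∀ n m, comp (braid n m) (braid m n) = id (n + m)
  hexagon : ∀ n m p,
    comp (toPROPData.eqHom (Nat.add_assoc n m p))
        (comp (braid n (m + p)) (toPROPData.eqHom (Nat.add_assoc m p n))) =
      comp (tensor (braid n m) (id p))
        (comp (toPROPData.eqHom (Nat.add_assoc m n p)) (tensor (id m) (braid n p)))

namespace PROP

/-- A morphism of props: an identity-on-objects symmetric strict monoidal functor. -/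
@[ext]
structure Morphism (P Q : PROP.{w}) where
  /-- The action on morphisms. -/
  map : ∀ {n m}, P.Hom n m → Q.Hom n m
  map_id : ∀ n, map (P.id n) = Q.id n
  map_comp : ∀ {n m p} (f : P.Hom n m) (g : P.Hom m p),
    map (P.comp f g) = Q.comp (map f) (map g)
  map_tensor : ∀ {n m p q} (f : P.Hom n m) (g : P.Hom p q),
    map (P.tensor f g) = Q.tensor (map f) (map g)
  map_braid : ∀ n m, map (P.braid n m) = Q.braid n m

/-- The category of props. -/
instance : Category PROP.{w} where
  Hom P Q := Morphism P Q
  id P := ⟨fun f => f, fun _ => rfl, fun _ _ => rfl, fun _ _ => rfl, fun _ _ => rfl⟩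
  comp F G :=
    { map := fun f => G.map (F.map f)
      map_id := fun n => by rw [F.map_id, G.map_id]
      map_comp := fun f g => by rw [F.map_comp, G.map_comp]
      map_tensor := fun f g => by rw [F.map_tensor, G.map_tensor]
      map_braid := fun n m => by rw [F.map_braid, G.map_braid] }

variable (P : PROP.{w})

/-- The objects of a prop, seen as a symmetric monoidal category: natural numbers. -/
@[ext]
structure Obj (P : PROP.{w}) : Type where
  /-- The underlying natural number. -/
  val : ℕ

instance : Category P.Obj where
  Hom n m := P.Hom n.val m.val
  id n := P.id n.val
  comp f g := P.comp f g
  id_comp := P.id_comp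
  comp_id := P.comp_id
  assoc := P.assoc

theorem eqHom_comp {n m p : ℕ} (h : n = m) (h' : m = p) :
    P.comp (P.eqHom h) (P.eqHom h') = P.eqHom (h.trans h') := by
  subst h h'; exact P.id_comp _

theorem eqHom_tensor {n m n' m' : ℕ} (h : n = m) (h' : n' = m') :
    P.tensor (P.eqHom h) (P.eqHom h') = P.eqHom (congrArg₂ (· + ·) h h') := by
  subst h h'; exact P.tensor_id _ _

/-- The identity between equal objects as an isomorphism. -/
def eqIso {n m : P.Obj} (h : n.val = m.val) : n ≅ m where
  hom := P.eqHom h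
  inv := P.eqHom h.symm
  hom_inv_id := P.eqHom_comp h h.symm
  inv_hom_id := P.eqHom_comp h.symm h

theorem pentagon (n m p q : ℕ) :
    P.comp (P.tensor (P.eqHom (Nat.add_assoc n m p)) (P.id q))
        (P.comp (P.eqHom (Nat.add_assoc n (m + p) q))
          (P.tensor (P.id n) (P.eqHom (Nat.add_assoc m p q)))) =
      P.comp (P.eqHom (Nat.add_assoc (n + m) p q)) (P.eqHom (Nat.add_assoc n m (p + q))) := by
  change P.comp (P.tensor _ (P.eqHom rfl)) (P.comp _ (P.tensor (P.eqHom rfl) _)) = _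
  simp only [eqHom_tensor, eqHom_comp]

theorem triangle (n m : ℕ) :
    P.comp (P.eqHom (Nat.add_assoc n 0 m)) (P.tensor (P.id n) (P.eqHom (Nat.zero_add m))) =
      P.tensor (P.eqHom (Nat.add_zero n)) (P.id m) := by
  change P.comp _ (P.tensor (P.eqHom rfl) _) = P.tensor _ (P.eqHom rfl)
  simp only [eqHom_tensor, eqHom_comp]

instance : MonoidalCategoryStruct P.Obj where
  tensorObj n m := ⟨n.val + m.val⟩
  tensorUnit := ⟨0⟩
  tensorHom f g := P.tensor f g
  whiskerLeft n _ _ f := P.tensor (P.id n.val) f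
  whiskerRight f n := P.tensor f (P.id n.val)
  associator n m p := P.eqIso (Nat.add_assoc n.val m.val p.val)
  leftUnitor n := P.eqIso (Nat.zero_add n.val)
  rightUnitor n := P.eqIso (Nat.add_zero n.val)

instance : MonoidalCategory P.Obj :=
  MonoidalCategory.ofTensorHom
    (id_tensorHom_id := fun n m => P.tensor_id n.val m.val)
    (id_tensorHom := fun _ _ _ _ => rfl)
    (tensorHom_id := fun _ _ => rfl)
    (tensorHom_comp_tensorHom := fun f g f' g' => P.tensor_comp f f' g g')
    (associator_naturality := fun f g h => P.tensor_assoc f g h)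
    (leftUnitor_naturality := fun f => P.unit_tensor f)
    (rightUnitor_naturality := fun f => P.tensor_unit f)
    (pentagon := fun n m p q => P.pentagon n.val m.val p.val q.val)
    (triangle := fun n m => P.triangle n.val m.val)

/-- The braiding as an isomorphism. -/
def braidIso (n m : P.Obj) : n ⊗ m ≅ m ⊗ n where
  hom := P.braid n.val m.val
  inv := P.braid m.val n.val
  hom_inv_id := P.braid_braid n.val m.val
  inv_hom_id := P.braid_braid m.val n.val

theorem hexagon_forward (n m p : P.Obj) :
    (α_ n m p).hom ≫ (P.braidIso n (m ⊗ p)).hom ≫ (α_ m p n).hom =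
      (P.braidIso n m).hom ▷ p ≫ (α_ m n p).hom ≫ m ◁ (P.braidIso n p).hom :=
  P.hexagon n.val m.val p.val

instance : SymmetricCategory P.Obj where
  braiding n m := P.braidIso n m
  braiding_naturality_right n _ _ f := P.braid_naturality (P.id n.val) f
  braiding_naturality_left f n := P.braid_naturality f (P.id n.val)
  hexagon_forward n m p := P.hexagon_forward n m p
  hexagon_reverse n m p := by
    have h' : (α_ p n m ≪≫ P.braidIso p (n ⊗ m) ≪≫ α_ n m p) =
        whiskerRightIso (P.braidIso p n) m ≪≫ α_ n p m ≪≫ whiskerLeftIso n (P.braidIso p m) :=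
      Iso.ext (P.hexagon_forward p n m)
    have h'' := congrArg Iso.inv h'
    simp only [Iso.trans_inv, whiskerRightIso_inv, whiskerLeftIso_inv, Category.assoc] at h''
    exact h''
  symmetry n m := P.braid_braid n.val m.val

end PROP

/-! ### The prop of corelations -/

namespace Corelation

/-- The disjoint union of corelations between the sets `{0, …, n - 1}`, transported along
`Fin n + Fin m ≃ Fin (n + m)`. -/
def finTensor {n m p q : ℕ} (α : Corelation (Fin n) (Fin m)) (β : Corelation (Fin p) (Fin q)) :
    Corelation (Fin (n + p)) (Fin (m + q)) :=
  (tensor α β).comap (Sum.map finSumFinEquiv.symm finSumFinEquiv.symm)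

/-- The swap of disjoint unions, transported along `Fin n + Fin m ≃ Fin (n + m)`. -/
def finBraid (n m : ℕ) : Corelation (Fin (n + m)) (Fin (m + n)) :=
  ofEquiv (finSumFinEquiv.symm.trans ((Equiv.sumComm (Fin n) (Fin m)).trans finSumFinEquiv))

theorem comap_eq {X Y X' Y' : Type*} (e : X ≃ X') (f : Y ≃ Y') (α : Corelation X Y) :
    α.comap (Sum.map e.symm f.symm) = comp (ofEquiv e.symm) (comp α (ofEquiv f)) :=
  ext_colors fun u v => by
    rw [colors_ofEquiv_comp, colors_comp_ofEquiv]
    have key : ∀ a, Sum.elim (u ∘ e.symm.symm) (v ∘ f) (Sum.map e.symm f.symm a) =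
        Sum.elim u v a := by
      rintro (a | a) <;> simp
    constructor
    · intro h a b hab
      obtain ⟨a, rfl⟩ := (Equiv.sumCongr e.symm f.symm).surjective a
      obtain ⟨b, rfl⟩ := (Equiv.sumCongr e.symm f.symm).surjective b
      have := h a b hab
      rw [← key, ← key] at this
      exact this
    · intro h a b hab
      have := h _ _ hab
      rwa [key, key] at this

theorem finTensor_eq {n m p q : ℕ} (α : Corelation (Fin n) (Fin m))
    (β : Corelation (Fin p) (Fin q)) :
    finTensor α β = comp (ofEquiv finSumFinEquiv.symm)
      (comp (tensor α β) (ofEquiv finSumFinEquiv)) := comap_eq _ _ _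

theorem colors_finTensor {n m p q : ℕ} (α : Corelation (Fin n) (Fin m))
    (β : Corelation (Fin p) (Fin q)) (u : Fin (n + p) → Prop) (v : Fin (m + q) → Prop) :
    Colors (finTensor α β) u v ↔
      α.Colors (fun i => u (Fin.castAdd p i)) (fun i => v (Fin.castAdd q i)) ∧
        β.Colors (fun i => u (Fin.natAdd n i)) (fun i => v (Fin.natAdd m i)) := by
  rw [finTensor_eq, colors_ofEquiv_comp, colors_comp_ofEquiv, colors_tensor]
  rfl

theorem ofEquiv_finTensor {n m p q : ℕ} (e : Fin n ≃ Fin m) (f : Fin p ≃ Fin q) :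
    finTensor (ofEquiv e) (ofEquiv f) = ofEquiv (finSumFinEquiv.symm.trans
      ((Equiv.sumCongr e f).trans finSumFinEquiv)) := by
  rw [finTensor_eq, ofEquiv_tensor, ofEquiv_comp, ofEquiv_comp]

theorem finTensor_id (n m : ℕ) : finTensor (id (Fin n)) (id (Fin m)) = id (Fin (n + m)) := by
  rw [id_eq, id_eq, id_eq, ofEquiv_finTensor]
  congr 1
  ext x
  simp

theorem finTensor_comp {n m p n' m' p' : ℕ} (f : Corelation (Fin n) (Fin m))
    (g : Corelation (Fin m) (Fin p)) (f' : Corelation (Fin n') (Fin m'))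
    (g' : Corelation (Fin m') (Fin p')) :
    comp (finTensor f f') (finTensor g g') = finTensor (comp f g) (comp f' g') :=
  ext_colors fun u v => by
    simp only [colors_comp, colors_finTensor]
    refine ⟨fun ⟨w, ⟨h1, h2⟩, h3, h4⟩ => ⟨⟨_, h1, h3⟩, _, h2, h4⟩,
      fun ⟨⟨w, h1, h3⟩, w', h2, h4⟩ => ⟨Fin.append w w', ⟨?_, ?_⟩, ?_, ?_⟩⟩
    all_goals
      simp only [Fin.append_left, Fin.append_right]
      assumption

theorem finTensor_assoc {n m n' m' n'' m'' : ℕ} (f : Corelation (Fin n) (Fin m))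
    (g : Corelation (Fin n') (Fin m')) (h : Corelation (Fin n'') (Fin m'')) :
    comp (finTensor (finTensor f g) h) (ofEquiv (finCongr (Nat.add_assoc m m' m''))) =
      comp (ofEquiv (finCongr (Nat.add_assoc n n' n''))) (finTensor f (finTensor g h)) :=
  ext_colors fun u v => by
    simp only [colors_comp_ofEquiv, colors_ofEquiv_comp, colors_finTensor, and_assoc]
    refine and_congr ?_ (and_congr ?_ ?_) <;> apply iff_of_eq <;> congr 1 <;> funext x <;>
      simp only [Function.comp_apply] <;> congr 1 <;> ext <;> simp [Nat.add_assoc]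

theorem unit_finTensor {n m : ℕ} (f : Corelation (Fin n) (Fin m)) :
    comp (finTensor (id (Fin 0)) f) (ofEquiv (finCongr (Nat.zero_add m))) =
      comp (ofEquiv (finCongr (Nat.zero_add n))) f :=
  ext_colors fun u v => by
    simp only [colors_comp_ofEquiv, colors_ofEquiv_comp, colors_finTensor, colors_id]
    rw [and_iff_right (funext fun x => x.elim0)]
    apply iff_of_eq
    congr 1 <;> funext x <;> simp only [Function.comp_apply] <;> congr 1 <;> ext <;> simp

theorem finTensor_unit {n m : ℕ} (f : Corelation (Fin n) (Fin m)) :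
    comp (finTensor f (id (Fin 0))) (ofEquiv (finCongr (Nat.add_zero m))) =
      comp (ofEquiv (finCongr (Nat.add_zero n))) f :=
  ext_colors fun u v => by
    simp only [colors_comp_ofEquiv, colors_ofEquiv_comp, colors_finTensor, colors_id]
    exact and_iff_left (funext fun x => x.elim0)

theorem finBraid_naturality {n m n' m' : ℕ} (f : Corelation (Fin n) (Fin m))
    (g : Corelation (Fin n') (Fin m')) :
    comp (finTensor f g) (finBraid m m') = comp (finBraid n n') (finTensor g f) :=
  ext_colors fun u v => by
    rw [finBraid, finBraid, colors_comp_ofEquiv, colors_ofEquiv_comp, colors_finTensor,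
      colors_finTensor, and_comm]
    refine and_congr ?_ ?_ <;> apply iff_of_eq <;> congr 1 <;> funext x <;> simp

theorem finBraid_finBraid (n m : ℕ) : comp (finBraid n m) (finBraid m n) = id (Fin (n + m)) := by
  rw [finBraid, finBraid, ofEquiv_comp, id_eq]
  congr 1
  ext x
  simp

theorem finBraid_hexagon (n m p : ℕ) :
    comp (ofEquiv (finCongr (Nat.add_assoc n m p)))
        (comp (finBraid n (m + p)) (ofEquiv (finCongr (Nat.add_assoc m p n)))) =
      comp (finTensor (finBraid n m) (id (Fin p)))
        (comp (ofEquiv (finCongr (Nat.add_assoc m n p)))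
          (finTensor (id (Fin m)) (finBraid n p))) := by
  simp only [finBraid, id_eq, ofEquiv_finTensor, ofEquiv_comp]
  congr 1
  apply Equiv.ext
  intro x
  have h1 : ∀ x : Fin p, finCongr (Nat.add_assoc n m p) (Fin.natAdd (n + m) x) =
      Fin.natAdd n (Fin.natAdd m x) := fun x => by ext; simp [Nat.add_assoc]
  have h2 : ∀ x : Fin m, finCongr (Nat.add_assoc n m p) (Fin.castAdd p (Fin.natAdd n x)) =
      Fin.natAdd n (Fin.castAdd p x) := fun x => by ext; simp
  have h3 : ∀ x : Fin n, finCongr (Nat.add_assoc n m p) (Fin.castAdd p (Fin.castAdd m x)) =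
      Fin.castAdd (m + p) x := fun x => by ext; simp
  have h4 : ∀ x : Fin p, finCongr (Nat.add_assoc m n p) (Fin.natAdd (m + n) x) =
      Fin.natAdd m (Fin.natAdd n x) := fun x => by ext; simp [Nat.add_assoc]
  have h5 : ∀ x : Fin n, finCongr (Nat.add_assoc m n p) (Fin.castAdd p (Fin.natAdd m x)) =
      Fin.natAdd m (Fin.castAdd p x) := fun x => by ext; simp
  have h6 : ∀ x : Fin m, finCongr (Nat.add_assoc m n p) (Fin.castAdd p (Fin.castAdd n x)) =
      Fin.castAdd (n + p) x := fun x => by ext; simp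
  induction x using Fin.addCases with
  | left x =>
    induction x using Fin.addCases with
    | left x => simp [Equiv.trans_apply, h3, h5, -finCongr_apply]; ext; simp [Nat.add_assoc]
    | right x => simp [Equiv.trans_apply, h2, h6, -finCongr_apply]; ext; simp
  | right x => simp [Equiv.trans_apply, h1, h4, -finCongr_apply]; ext; simp

end Corelation

/-- The operations of the prop of corelations: morphisms `n → m` are the corelations from
`{0, …, n - 1}` to `{0, …, m - 1}`. -/
def corelData : PROPData.{0} where
  Hom n m := Corelation (Fin n) (Fin m)
  id n := Corelation.id (Fin n)
  comp α β := Corelation.comp α β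
  tensor α β := Corelation.finTensor α β
  braid n m := Corelation.finBraid n m

theorem corelData_eqHom {n m : ℕ} (h : n = m) :
    corelData.eqHom h = Corelation.ofEquiv (finCongr h) := by
  subst h; rfl

/-- The prop of corelations. -/
def corelPROP : PROP.{0} where
  toPROPData := corelData
  id_comp := Corelation.id_comp
  comp_id := Corelation.comp_id
  assoc := Corelation.comp_assoc
  tensor_id := Corelation.finTensor_id
  tensor_comp f g f' g' := Corelation.finTensor_comp f g f' g'
  tensor_assoc f g h := by
    rw [corelData_eqHom, corelData_eqHom]
    exact Corelation.finTensor_assoc f g h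
  unit_tensor f := by
    rw [corelData_eqHom, corelData_eqHom]
    exact Corelation.unit_finTensor f
  tensor_unit f := by
    rw [corelData_eqHom, corelData_eqHom]
    exact Corelation.finTensor_unit f
  braid_naturality f g := Corelation.finBraid_naturality f g
  braid_braid := Corelation.finBraid_finBraid
  hexagon n m p := by
    rw [corelData_eqHom, corelData_eqHom, corelData_eqHom]
    exact Corelation.finBraid_hexagon n m p

/-! ### Symmetric monoidal theories and the props they present -/

/-- A signature: a set of generators `n → m` for all `n` and `m`. -/
abbrev Signature := ℕ → ℕ → Type w

/-- The terms over a signature, built from generators by composition and monoidal product. All the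
identities `n → n` and braidings `n + m → m + n` are taken as primitive terms; the laws of props
express them through the empty term `id 0`, the term `id 1` and the term `braid 1 1`. -/
inductive Term (S : Signature.{w}) : ℕ → ℕ → Type w
  | id (n : ℕ) : Term S n n
  | braid (n m : ℕ) : Term S (n + m) (m + n)
  | gen {n m : ℕ} (σ : S n m) : Term S n m
  | comp {n m p : ℕ} (s : Term S n m) (t : Term S m p) : Term S n p
  | tensor {n m p q : ℕ} (s : Term S n m) (t : Term S p q) : Term S (n + p) (m + q)

/-- The operations on terms; they do not yet satisfy the laws of a prop. -/
def Term.data (S : Signature.{w}) : PROPData.{w} where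
  Hom := Term S
  id := Term.id
  comp := Term.comp
  tensor := Term.tensor
  braid := Term.braid

/-- A symmetric monoidal theory: a signature and a set of equations between terms of the same
type. -/
structure SMTheory : Type (w + 1) where
  /-- The signature. -/
  sig : Signature.{w}
  /-- The equations. -/
  eqn : ∀ {n m : ℕ}, Term sig n m → Term sig n m → Prop

namespace SMTheory

/-- Provable equality of terms: the least congruence for composition and monoidal product that
contains the laws of props and the equations of the theory. -/
inductive Provable (T : SMTheory.{w}) : ∀ {n m : ℕ}, Term T.sig n m → Term T.sig n m → Prop
  | eqn {n m : ℕ} {s t : Term T.sig n m} (h : T.eqn s t) : Provable T s t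
  | refl {n m : ℕ} (s : Term T.sig n m) : Provable T s s
  | symm {n m : ℕ} {s t : Term T.sig n m} (h : Provable T s t) : Provable T t s
  | trans {n m : ℕ} {s t r : Term T.sig n m} (h : Provable T s t) (h' : Provable T t r) :
      Provable T s r
  | comp_congr {n m p : ℕ} {s s' : Term T.sig n m} {t t' : Term T.sig m p}
      (h : Provable T s s') (h' : Provable T t t') : Provable T (s.comp t) (s'.comp t')
  | tensor_congr {n m p q : ℕ} {s s' : Term T.sig n m} {t t' : Term T.sig p q}
      (h : Provable T s s') (h' : Provable T t t') : Provable T (s.tensor t) (s'.tensor t')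
  | id_comp {n m : ℕ} (f : Term T.sig n m) : Provable T ((Term.id n).comp f) f
  | comp_id {n m : ℕ} (f : Term T.sig n m) : Provable T (f.comp (Term.id m)) f
  | assoc {n m p q : ℕ} (f : Term T.sig n m) (g : Term T.sig m p) (h : Term T.sig p q) :
      Provable T ((f.comp g).comp h) (f.comp (g.comp h))
  | tensor_id (n m : ℕ) : Provable T ((Term.id n).tensor (Term.id m)) (Term.id (n + m))
  | tensor_comp {n m p n' m' p' : ℕ} (f : Term T.sig n m) (g : Term T.sig m p)
      (f' : Term T.sig n' m') (g' : Term T.sig m' p') :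
      Provable T ((f.tensor f').comp (g.tensor g')) ((f.comp g).tensor (f'.comp g'))
  | tensor_assoc {n m n' m' n'' m'' : ℕ} (f : Term T.sig n m) (g : Term T.sig n' m')
      (h : Term T.sig n'' m'') :
      Provable T
        (Term.comp ((f.tensor g).tensor h) ((Term.data T.sig).eqHom (Nat.add_assoc m m' m'')))
        (Term.comp ((Term.data T.sig).eqHom (Nat.add_assoc n n' n'')) (f.tensor (g.tensor h)))
  | unit_tensor {n m : ℕ} (f : Term T.sig n m) :
      Provable T
        (Term.comp ((Term.id 0).tensor f) ((Term.data T.sig).eqHom (Nat.zero_add m)))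
        (Term.comp ((Term.data T.sig).eqHom (Nat.zero_add n)) f)
  | tensor_unit {n m : ℕ} (f : Term T.sig n m) :
      Provable T
        (Term.comp (f.tensor (Term.id 0)) ((Term.data T.sig).eqHom (Nat.add_zero m)))
        (Term.comp ((Term.data T.sig).eqHom (Nat.add_zero n)) f)
  | braid_naturality {n m n' m' : ℕ} (f : Term T.sig n m) (g : Term T.sig n' m') :
      Provable T ((f.tensor g).comp (Term.braid m m')) ((Term.braid n n').comp (g.tensor f))
  | braid_braid (n m : ℕ) :
      Provable T ((Term.braid n m).comp (Term.braid m n)) (Term.id (n + m))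
  | hexagon (n m p : ℕ) :
      Provable T
        (Term.comp ((Term.data T.sig).eqHom (Nat.add_assoc n m p))
          (Term.comp (Term.braid n (m + p)) ((Term.data T.sig).eqHom (Nat.add_assoc m p n))))
        (Term.comp ((Term.braid n m).tensor (Term.id p))
          (Term.comp ((Term.data T.sig).eqHom (Nat.add_assoc m n p))
            ((Term.id m).tensor (Term.braid n p))))

/-- Provable equality as an equivalence relation. -/
def setoid (T : SMTheory.{w}) (n m : ℕ) : Setoid (Term T.sig n m) where
  r := T.Provable
  iseqv := ⟨Provable.refl, Provable.symm, Provable.trans⟩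

/-- The operations on terms modulo provable equality. -/
def propData (T : SMTheory.{w}) : PROPData.{w} where
  Hom n m := Quotient (T.setoid n m)
  id n := Quotient.mk _ (Term.id n)
  comp := Quotient.map₂ Term.comp fun _ _ h _ _ h' => Provable.comp_congr h h'
  tensor := Quotient.map₂ Term.tensor fun _ _ h _ _ h' => Provable.tensor_congr h h'
  braid n m := Quotient.mk _ (Term.braid n m)

theorem propData_eqHom (T : SMTheory.{w}) {n m : ℕ} (h : n = m) :
    T.propData.eqHom h = Quotient.mk (T.setoid n m) ((Term.data T.sig).eqHom h) := by
  subst h; rfl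

/-- The prop presented by a symmetric monoidal theory: terms modulo provable equality. -/
def prop (T : SMTheory.{w}) : PROP.{w} where
  toPROPData := T.propData
  id_comp := by
    rintro n m ⟨f⟩
    exact Quotient.sound (Provable.id_comp f)
  comp_id := by
    rintro n m ⟨f⟩
    exact Quotient.sound (Provable.comp_id f)
  assoc := by
    rintro n m p q ⟨f⟩ ⟨g⟩ ⟨h⟩
    exact Quotient.sound (Provable.assoc f g h)
  tensor_id n m := Quotient.sound (Provable.tensor_id n m)
  tensor_comp := by
    rintro n m p n' m' p' ⟨f⟩ ⟨g⟩ ⟨f'⟩ ⟨g'⟩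
    exact Quotient.sound (Provable.tensor_comp f g f' g')
  tensor_assoc := by
    rintro n m n' m' n'' m'' ⟨f⟩ ⟨g⟩ ⟨h⟩
    rw [propData_eqHom, propData_eqHom]
    exact Quotient.sound (Provable.tensor_assoc f g h)
  unit_tensor := by
    rintro n m ⟨f⟩
    rw [propData_eqHom, propData_eqHom]
    exact Quotient.sound (Provable.unit_tensor f)
  tensor_unit := by
    rintro n m ⟨f⟩
    rw [propData_eqHom, propData_eqHom]
    exact Quotient.sound (Provable.tensor_unit f)
  braid_naturality := by
    rintro n m n' m' ⟨f⟩ ⟨g⟩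
    exact Quotient.sound (Provable.braid_naturality f g)
  braid_braid n m := Quotient.sound (Provable.braid_braid n m)
  hexagon n m p := by
    rw [propData_eqHom, propData_eqHom, propData_eqHom]
    exact Quotient.sound (Provable.hexagon n m p)

/-- The morphism of the presented prop given by a generator. -/
def gen (T : SMTheory.{w}) {n m : ℕ} (σ : T.sig n m) : T.prop.Hom n m :=
  Quotient.mk (T.setoid n m) (Term.gen σ)

end SMTheory

/-! ### Extraspecial commutative Frobenius monoids -/

/-- The generators of the theory of extraspecial commutative Frobenius monoids. -/
inductive ESCFMGen : ℕ → ℕ → Type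
  | mul : ESCFMGen 2 1
  | unit : ESCFMGen 0 1
  | comul : ESCFMGen 1 2
  | counit : ESCFMGen 1 0

namespace ESCFMGen

/-- Multiplication, as a term. -/
abbrev μ : Term ESCFMGen 2 1 := Term.gen mul

/-- Unit, as a term. -/
abbrev η : Term ESCFMGen 0 1 := Term.gen unit

/-- Comultiplication, as a term. -/
abbrev δ : Term ESCFMGen 1 2 := Term.gen comul

/-- Counit, as a term. -/
abbrev ε : Term ESCFMGen 1 0 := Term.gen counit

/-- The identity term on the generating object. -/
abbrev ι : Term ESCFMGen 1 1 := Term.id 1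

/-- The equations of the theory of extraspecial commutative Frobenius monoids. -/
inductive Eqn : ∀ {n m : ℕ}, Term ESCFMGen n m → Term ESCFMGen n m → Prop
  | mul_assoc : Eqn (n := 3) (m := 1) (Term.comp (Term.tensor μ ι) μ) (Term.comp (Term.tensor ι μ) μ)
  | unit_mul : Eqn (n := 1) (m := 1) (Term.comp (Term.tensor η ι) μ) ι
  | mul_comm : Eqn (n := 2) (m := 1) (Term.comp (Term.braid 1 1) μ) μ
  | comul_assoc :
      Eqn (n := 1) (m := 3) (Term.comp δ (Term.tensor δ ι)) (Term.comp δ (Term.tensor ι δ))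
  | counit_comul : Eqn (n := 1) (m := 1) (Term.comp δ (Term.tensor ε ι)) ι
  | comul_comm : Eqn (n := 1) (m := 2) (Term.comp δ (Term.braid 1 1)) δ
  | frobenius_left :
      Eqn (n := 2) (m := 2) (Term.comp (Term.tensor δ ι) (Term.tensor ι μ)) (Term.comp μ δ)
  | frobenius_right :
      Eqn (n := 2) (m := 2) (Term.comp (Term.tensor ι δ) (Term.tensor μ ι)) (Term.comp μ δ)
  | special : Eqn (n := 1) (m := 1) (Term.comp δ μ) ι
  | extra : Eqn (n := 0) (m := 0) (Term.comp η ε) (Term.id 0)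

end ESCFMGen

/-- The symmetric monoidal theory of extraspecial commutative Frobenius monoids. -/
def theoryESCFM : SMTheory.{0} where
  sig := ESCFMGen
  eqn := ESCFMGen.Eqn

/-- The prop presented by the theory of extraspecial commutative Frobenius monoids. -/
def ThESCFM : PROP.{0} := theoryESCFM.prop

section

variable (C : Type u) [Category.{v} C] [MonoidalCategory C] [SymmetricCategory C]

open scoped MonObj ComonObj in
/-- An extraspecial commutative Frobenius monoid in a symmetric monoidal category. -/
structure ESCFM where
  /-- The underlying object. -/
  X : C
  [mon : MonObj X]
  [comon : ComonObj X]
  [comm : IsCommMonObj X]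
  [cocomm : IsCommComonObj X]
  frobenius_left : Δ[X] ▷ X ≫ (α_ X X X).hom ≫ X ◁ μ[X] = μ[X] ≫ Δ[X]
  frobenius_right : X ◁ Δ[X] ≫ (α_ X X X).inv ≫ μ[X] ▷ X = μ[X] ≫ Δ[X]
  special : Δ[X] ≫ μ[X] = 𝟙 X
  extra : η[X] ≫ ε[X] = 𝟙 (𝟙_ C)

attribute [instance] ESCFM.mon ESCFM.comon ESCFM.comm ESCFM.cocomm

variable {C} in
/-- A morphism of extraspecial commutative Frobenius monoids: a morphism that commutes with the
multiplications, units, comultiplications and counits. -/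
@[ext]
structure ESCFM.Hom (A B : ESCFM C) where
  /-- The underlying morphism. -/
  hom : A.X ⟶ B.X
  isMonHom : IsMonHom hom
  isComonHom : IsComonHom hom

/-- The category of extraspecial commutative Frobenius monoids in `C`. -/
instance : Category (ESCFM C) where
  Hom A B := ESCFM.Hom A B
  id A := ⟨𝟙 A.X, inferInstance, inferInstance⟩
  comp f g :=
    { hom := f.hom ≫ g.hom
      isMonHom := by have := f.isMonHom; have := g.isMonHom; infer_instance
      isComonHom := by have := f.isComonHom; have := g.isComonHom; infer_instance }
  id_comp f := ESCFM.Hom.ext (Category.id_comp f.hom)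
  comp_id f := ESCFM.Hom.ext (Category.comp_id f.hom)
  assoc f g h := ESCFM.Hom.ext (Category.assoc f.hom g.hom h.hom)

/-- The underlying object of an extraspecial commutative Frobenius monoid. -/
def ESCFM.forget : ESCFM C ⥤ C where
  obj A := A.X
  map f := f.hom

end

/-! ### Symmetric monoidal functors -/

section

variable (D : Type*) [Category* D] [MonoidalCategory D] [SymmetricCategory D]
  (C : Type*) [Category* C] [MonoidalCategory C] [SymmetricCategory C]

/-- A (strong) symmetric monoidal functor. -/
structure SymMonFunctor where
  /-- The underlying functor. -/
  functor : D ⥤ C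
  [braided : functor.Braided]

attribute [instance] SymMonFunctor.braided

variable {D C} in
/-- A monoidal natural transformation between symmetric monoidal functors. -/
@[ext]
structure SymMonFunctor.Hom (F G : SymMonFunctor D C) where
  /-- The underlying natural transformation. -/
  hom : F.functor ⟶ G.functor
  isMonoidal : NatTrans.IsMonoidal hom

/-- The category of symmetric monoidal functors and monoidal natural transformations. -/
instance : Category (SymMonFunctor D C) where
  Hom F G := SymMonFunctor.Hom F G
  id F := ⟨𝟙 F.functor, inferInstance⟩
  comp f g :=
    { hom := f.hom ≫ g.hom
      isMonoidal := by have := f.isMonoidal; have := g.isMonoidal; infer_instance }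
  id_comp f := SymMonFunctor.Hom.ext (Category.id_comp f.hom)
  comp_id f := SymMonFunctor.Hom.ext (Category.comp_id f.hom)
  assoc f g h := SymMonFunctor.Hom.ext (Category.assoc f.hom g.hom h.hom)

variable {D} in
/-- Evaluation of symmetric monoidal functors at an object. -/
def SymMonFunctor.eval (X : D) : SymMonFunctor D C ⥤ C where
  obj F := F.functor.obj X
  map f := f.hom.app X

end

set_option linter.unusedSectionVars false

/-! ### Convolution -/

section

open MonObj ComonObj

variable {C : Type u} [Category.{v} C] [MonoidalCategory C] [SymmetricCategory C]

/-! A corelation is determined by the two-colourings of its boundary that are constant on blocks,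
and in these terms composition of corelations is composition of relations (`ext_colors`,
`colors_comp`). That the one-block corelations satisfy the equations of an extraspecial commutative
Frobenius monoid thus becomes propositional logic (`eval_eq_of_eqn`), which gives a morphism of
props `evalESCFM`. It is full: any corelation is obtained by creating the outputs, merging related
pairs and discarding the inputs (`eval_surjective`).

The heart is a construction in the other direction: a monoid `A` of this kind in any symmetric
monoidal category yields a symmetric monoidal functor out of corelations. States of a tensor power
of `A` (morphisms from the unit object) form a commutative monoid under multiplication, and each
pair of wires has a linking state, a cup. By the Frobenius law a link makes multiplication by its
two wires interchangeable (`rel_link`); by the special law a state on which two wires are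
interchangeable absorbs their link (`mul_link`). Hence two states `t`, `s` that are products of
links of a partition and that both respect this partition absorb each other, `t = t * s = s`
(`eq_of_mem_links`). So a partition has exactly one such state, however it is presented, and no
normal form for terms is needed.

A corelation becomes a morphism by bending the input half of its state (`Wires.map`). In a composite
the two states are multiplied, which glues the partitions, and the middle wires are discarded, which
restricts the result (`Wires.map_comp`). Discarding a linked wire uses the counit law, discarding an
isolated one the extra law (`discardable_single`). Identities are preserved by the snake equation
(`unbend_unit_comul`).

A monoidal transformation between functors out of the presented prop is determined by its component
at 1, and any morphism of the image monoids extends to one (`hom_ext`, `extendApp_naturality`), so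
evaluation at the generic monoid is fully faithful. The construction above, applied to the generic
monoid, gives an endofunctor of the presented prop that factors through `evalESCFM` and fixes the
generic monoid up to isomorphism (`modelIso`); it is therefore isomorphic to the identity. This
makes `evalESCFM` faithful and provides the equivalence with finite sets and corelations. The
construction for arbitrary `A` gives essential surjectivity in the universal property. -/

/-- The convolution product on morphisms from a cocommutative comonoid to a commutative monoid. -/
@[reducible] def convCommMonoid (M N : C) [ComonObj M] [IsCommComonObj M] [MonObj N]
    [IsCommMonObj N] : CommMonoid (M ⟶ N) :=
  { (inferInstance : Monoid (Conv M N)) with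
    mul_comm := fun f g => by
      change Δ[M] ≫ f ▷ M ≫ N ◁ g ≫ μ[N] = Δ[M] ≫ g ▷ M ≫ N ◁ f ≫ μ[N]
      -- A braiding inserted before the multiplication slides past `f ⊗ₘ g`, swapping the factors,
      -- and is absorbed by the comultiplication.
      rw [← MonoidalCategory.tensorHom_def_assoc, ← MonoidalCategory.tensorHom_def_assoc,
        ← IsCommMonObj.mul_comm N, BraidedCategory.braiding_naturality_assoc,
        IsCommComonObj.comul_comm_assoc, IsCommMonObj.mul_comm] }

attribute [local instance] convCommMonoid ComonObj.instTensorUnit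

section

variable {M M' N N' : C} [ComonObj M] [IsCommComonObj M] [ComonObj M'] [IsCommComonObj M']
  [MonObj N] [IsCommMonObj N] [MonObj N'] [IsCommMonObj N']

theorem conv_def (f g : M ⟶ N) : f * g = Δ[M] ≫ (f ⊗ₘ g) ≫ μ[N] := by
  rw [MonoidalCategory.tensorHom_def_assoc]; rfl

theorem conv_one_def : (1 : M ⟶ N) = ε[M] ≫ η[N] := rfl

theorem conv_comp (f g : M ⟶ N) (h : N ⟶ N') [IsMonHom h] : (f * g) ≫ h = (f ≫ h) * (g ≫ h) := by
  rw [conv_def, conv_def, ← tensorHom_comp_tensorHom]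
  simp only [Category.assoc, IsMonHom.mul_hom]

theorem comp_conv (h : M' ⟶ M) [IsComonHom h] (f g : M ⟶ N) : h ≫ (f * g) = (h ≫ f) * (h ≫ g) := by
  rw [conv_def, conv_def, ← tensorHom_comp_tensorHom]
  simp only [Category.assoc, IsComonHom.hom_comul_assoc]

theorem conv_one_comp (h : N ⟶ N') [IsMonHom h] : (1 : M ⟶ N) ≫ h = 1 := by
  simp [conv_one_def]

instance : IsComonHom ε[M] where
  hom_counit := by simp
  hom_comul := by
    simp [MonoidalCategory.tensorHom_def, unitors_inv_equal]

/-- Commutativity of `N` is what makes its multiplication a homomorphism; this is how maps out of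
tensor products of monoids are assembled from maps out of the factors. -/
instance : IsMonHom μ[N] where
  one_hom := by rw [tensorObj.one_def, Category.assoc, MonoidalCategory.tensorHom_def, Category.assoc, mul_one,
      rightUnitor_naturality, ← unitors_equal, Iso.inv_hom_id_assoc]
  mul_hom := by simp [tensorObj.mul_def]

instance {N : C} [MonObj N] : IsMonHom η[N] where
  one_hom := by simp
  mul_hom := by simp [MonoidalCategory.tensorHom_def, unitors_equal]

end

/-! ### States of commutative monoids and their action by multiplication -/

section

variable {M N P Q : C} [MonObj M] [IsCommMonObj M] [MonObj N] [IsCommMonObj N]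
  [MonObj P] [IsCommMonObj P] [MonObj Q] [IsCommMonObj Q]

theorem state_one : (1 : 𝟙_ C ⟶ M) = η[M] := by
  simp [conv_one_def]

/-- The action of a state on a monoid by multiplication. -/
def act (t : 𝟙_ C ⟶ M) : M ⟶ M := (λ_ M).inv ≫ t ▷ M ≫ μ[M]

theorem act_one : act (1 : 𝟙_ C ⟶ M) = 𝟙 M := by
  simp [act, state_one]

theorem act_eq (t : 𝟙_ C ⟶ M) : act t = (ρ_ M).inv ≫ M ◁ t ≫ μ[M] := by
  rw [act, ← IsCommMonObj.mul_comm M, BraidedCategory.braiding_naturality_left_assoc]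
  simp

/-- The comultiplication of the unit object is a unitor, so convolution of states is multiplication
of points, and a product may be computed by letting one factor act on the other. -/
theorem state_mul (t u : 𝟙_ C ⟶ M) : t * u = t ≫ act u := by
  rw [conv_def, act_eq, MonoidalCategory.tensorHom_def_assoc]
  simp [unitors_inv_equal]

theorem act_mul (t u : 𝟙_ C ⟶ M) : act (t * u) = act t ≫ act u := by
  -- The state `u` has no input, so it can be created before the multiplication; associativity does
  -- the rest.
  have h : μ[M] ≫ (λ_ M).inv ≫ u ▷ M = (λ_ _).inv ≫ u ▷ (M ⊗ M) ≫ M ◁ μ[M] := by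
    rw [leftUnitor_inv_naturality_assoc, whisker_exchange]
  rw [state_mul, act, act, act]
  simp [reassoc_of% h]

theorem act_comp (t : 𝟙_ C ⟶ M) (f : M ⟶ N) [IsMonHom f] : act t ≫ f = f ≫ act (t ≫ f) := by
  simp [act, MonoidalCategory.tensorHom_def', ← whisker_exchange_assoc]

/-! ### The inclusions of the factors of a tensor product -/

variable (M N) in
/-- The left inclusion into a tensor product of monoids. -/
def inl : M ⟶ M ⊗ N := (ρ_ M).inv ≫ M ◁ η[N]

variable (M N) in
/-- The right inclusion into a tensor product of monoids. -/
def inr : N ⟶ M ⊗ N := (λ_ N).inv ≫ η[M] ▷ N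

instance : IsMonHom (inl M N) := by
  have : IsMonHom (ρ_ M).inv := inferInstance
  have : IsMonHom (M ◁ η[N]) := inferInstance
  unfold inl; infer_instance

instance : IsMonHom (inr M N) := by
  unfold inr; infer_instance

/-- The second component of the included element is the unit of `N`, so only the first factor is
really multiplied. -/
theorem inl_mul : inl M N ▷ (M ⊗ N) ≫ μ[M ⊗ N] = (α_ M M N).inv ≫ μ[M] ▷ N := by
  have : inl M N = (ρ_ M).inv ≫ (𝟙 M ⊗ₘ η[N]) := by simp [inl]
  rw [this, comp_whiskerRight, tensorObj.mul_def, Category.assoc, tensorμ_natural_left_assoc,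
    tensorHom_comp_tensorHom]
  simp [tensorμ, MonoidalCategory.tensorHom_def, -IsMonHom.mul_hom]
  monoidal

theorem mul_inr : (M ⊗ N) ◁ inr M N ≫ μ[M ⊗ N] = (α_ M N N).hom ≫ M ◁ μ[N] := by
  have : inr M N = (λ_ N).inv ≫ (η[M] ⊗ₘ 𝟙 N) := by simp [inr]
  rw [this, MonoidalCategory.whiskerLeft_comp, tensorObj.mul_def, Category.assoc, tensorμ_natural_right_assoc,
    tensorHom_comp_tensorHom]
  simp [tensorμ, MonoidalCategory.tensorHom_def, -IsMonHom.mul_hom]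
  monoidal

/-- The two factors generate the tensor product: this is the coproduct property of `M ⊗ N` among
commutative monoids, in the form needed to turn tensor products into convolution products. -/
theorem inl_inr_mul : (inl M N ⊗ₘ inr M N) ≫ μ[M ⊗ N] = 𝟙 (M ⊗ N) := by
  rw [MonoidalCategory.tensorHom_def', Category.assoc, inl_mul, inr,
    MonoidalCategory.whiskerLeft_comp, Category.assoc, associator_inv_naturality_middle_assoc,
    ← comp_whiskerRight, MonObj.mul_one]
  simp

theorem conv_inl_inr {D : C} [ComonObj D] [IsCommComonObj D] (f : D ⟶ M) (g : D ⟶ N) :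
    (f ≫ inl M N) * (g ≫ inr M N) = Δ[D] ≫ (f ⊗ₘ g) := by
  rw [conv_def, ← tensorHom_comp_tensorHom, Category.assoc, inl_inr_mul, Category.comp_id]

theorem act_inl (t : 𝟙_ C ⟶ M) : act (t ≫ inl M N) = act t ▷ N := by
  rw [act, comp_whiskerRight, Category.assoc, inl_mul, act]
  simp

theorem act_inr (t : 𝟙_ C ⟶ N) : act (t ≫ inr M N) = M ◁ act t := by
  rw [act_eq, MonoidalCategory.whiskerLeft_comp, Category.assoc, mul_inr, act_eq]
  simp

theorem act_tensor (t : 𝟙_ C ⟶ M) (s : 𝟙_ C ⟶ N) :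
    act ((t ≫ inl M N) * (s ≫ inr M N)) = act t ⊗ₘ act s := by
  rw [act_mul, act_inl, act_inr, MonoidalCategory.tensorHom_def]

/-! ### Bending states into morphisms and discarding factors -/

/-- The morphism `M ⟶ N` obtained from a state of `M ⊗ N` by multiplying with its first component
and discarding the product along `e`. -/
def unbend (e : M ⟶ 𝟙_ C) (s : 𝟙_ C ⟶ M ⊗ N) : M ⟶ N :=
  inl M N ≫ act s ≫ e ▷ N ≫ (λ_ N).hom

theorem inl_act (s : 𝟙_ C ⟶ M ⊗ N) :
    inl M N ≫ act s = (ρ_ M).inv ≫ M ◁ s ≫ (α_ M M N).inv ≫ μ[M] ▷ N := by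
  rw [act_eq, ← inl_mul, whisker_exchange_assoc, ← rightUnitor_inv_naturality_assoc]

/-- Only the multiplication of `M` survives in this form, so that in `unbend_comp` an arbitrary
morphism out of `N` can be slid through, not just a homomorphism. -/
theorem unbend_eq (e : M ⟶ 𝟙_ C) (s : 𝟙_ C ⟶ M ⊗ N) : unbend e s =
    (ρ_ M).inv ≫ M ◁ s ≫ (α_ M M N).inv ≫ (μ[M] ≫ e) ▷ N ≫ (λ_ N).hom := by
  rw [unbend, ← Category.assoc, inl_act]
  simp

theorem unbend_comp (e : M ⟶ 𝟙_ C) (s : 𝟙_ C ⟶ M ⊗ N) (f : N ⟶ P) :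
    unbend e s ≫ f = unbend e (s ≫ M ◁ f) := by
  simp only [unbend_eq, Category.assoc, MonoidalCategory.whiskerLeft_comp,
    associator_inv_naturality_right_assoc, whisker_exchange_assoc, leftUnitor_naturality]

/-- Discarding the second factor of a tensor product along `e`. -/
def discardRight (M : C) {N : C} (e : N ⟶ 𝟙_ C) : M ⊗ N ⟶ M := M ◁ e ≫ (ρ_ M).hom

theorem inl_discardRight {e : N ⟶ 𝟙_ C} (he : η[N] ≫ e = 𝟙 _) :
    inl M N ≫ discardRight M e = 𝟙 M := by
  simp [inl, discardRight, ← MonoidalCategory.whiskerLeft_comp_assoc, he]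

theorem state_mul_discardRight (t : 𝟙_ C ⟶ M) (s : 𝟙_ C ⟶ M ⊗ N) (e : N ⟶ 𝟙_ C) :
    ((t ≫ inl M N) * s) ≫ discardRight M e = t * (s ≫ discardRight M e) := by
  rw [mul_comm, state_mul, mul_comm, state_mul, act_inl, Category.assoc, Category.assoc]
  congr 1
  simp [discardRight, ← whisker_exchange_assoc]

/-- A state on the output factor acts there alone, so it commutes with discarding the input factor.
In `Wires.map_comp` this merges the states of two composable corelations into a single product. -/
theorem unbend_mul_inr (e : M ⟶ 𝟙_ C) (s : 𝟙_ C ⟶ M ⊗ N) (t : 𝟙_ C ⟶ N) :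
    unbend e (s * (t ≫ inr M N)) = unbend e s ≫ act t := by
  simp [unbend, act_mul, act_inr, whisker_exchange_assoc]

/-! ### Compatibility of the inclusions with the structure isomorphisms -/

theorem inl_tensorHom (f : M ⟶ P) (g : N ⟶ Q) [IsMonHom g] :
    inl M N ≫ (f ⊗ₘ g) = f ≫ inl P Q := by
  simp only [inl, Category.assoc, MonoidalCategory.tensorHom_def',
    ← MonoidalCategory.whiskerLeft_comp_assoc, IsMonHom.one_hom]
  rw [whisker_exchange]
  simp

theorem inr_tensorHom (f : M ⟶ P) (g : N ⟶ Q) [IsMonHom f] :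
    inr M N ≫ (f ⊗ₘ g) = g ≫ inr P Q := by
  simp only [inr, Category.assoc, MonoidalCategory.tensorHom_def, ← comp_whiskerRight_assoc,
    IsMonHom.one_hom]
  rw [← whisker_exchange]
  simp

theorem inl_braiding : inl M N ≫ (β_ M N).hom = inr N M := by
  simp [inl, inr]

theorem inr_braiding : inr M N ≫ (β_ M N).hom = inl N M := by
  simp [inl, inr]

theorem inl_inl_associator :
    inl M N ≫ inl (M ⊗ N) P ≫ (α_ M N P).hom = inl M (N ⊗ P) := by
  rw [inl, inl, inl, tensorObj.one_def, MonoidalCategory.tensorHom_def]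
  monoidal

theorem inr_inl_associator :
    inr M N ≫ inl (M ⊗ N) P ≫ (α_ M N P).hom = inl N P ≫ inr M (N ⊗ P) := by
  simp only [inl, inr, Category.assoc]
  rw [leftUnitor_inv_naturality_assoc (N ◁ η[P]), whisker_exchange]
  monoidal

theorem inr_associator :
    inr (M ⊗ N) P ≫ (α_ M N P).hom = inr N P ≫ inr M (N ⊗ P) := by
  rw [inr, inr, inr, tensorObj.one_def, MonoidalCategory.tensorHom_def',
    leftUnitor_inv_naturality_assoc]
  monoidal

theorem inr_leftUnitor : inr (𝟙_ C) M ≫ (λ_ M).hom = 𝟙 M := by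
  simp [inr]

theorem inl_rightUnitor : inl M (𝟙_ C) ≫ (ρ_ M).hom = 𝟙 M := by
  simp [inl]

theorem inl_tensorμ : inl (M ⊗ N) (P ⊗ Q) ≫ tensorμ M N P Q = (inl M P ⊗ₘ inl N Q) := by
  have h : (ρ_ (M ⊗ N)).inv ≫ (M ⊗ N) ◁ (λ_ (𝟙_ C)).inv ≫ tensorμ M N (𝟙_ C) (𝟙_ C) =
      ((ρ_ M).inv ⊗ₘ (ρ_ N).inv) := by
    rw [Iso.inv_comp_eq, tensor_right_unitality]
    simp [tensorHom_comp_tensorHom]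
  rw [inl, tensorObj.one_def, MonoidalCategory.whiskerLeft_comp, Category.assoc, Category.assoc,
    tensorμ_natural_right, reassoc_of% h, tensorHom_comp_tensorHom, inl, inl]

theorem tensorμ_discardLeft {M N P Q : C} (e : M ⟶ 𝟙_ C) (e' : N ⟶ 𝟙_ C) :
    tensorμ M N P Q ≫ ((e ▷ P ≫ (λ_ P).hom) ⊗ₘ (e' ▷ Q ≫ (λ_ Q).hom)) =
      ((e ⊗ₘ e') ≫ (λ_ (𝟙_ C)).hom) ▷ (P ⊗ Q) ≫ (λ_ (P ⊗ Q)).hom := by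
  rw [← tensorHom_comp_tensorHom, ← tensorμ_natural_left_assoc, tensor_left_unitality,
    comp_whiskerRight, Category.assoc, hom_inv_whiskerRight_assoc]

end

end

section

open scoped MonObj ComonObj

variable {C : Type u} [Category.{v} C] [MonoidalCategory C] [SymmetricCategory C]

attribute [local instance] convCommMonoid ComonObj.instTensorUnit

/-! ### Families of wires -/

/-- A commutative monoid `obj` with a family of monoid homomorphisms from an extraspecial
commutative Frobenius monoid `A` to it, and a morphism to the unit which is split by the unit of
the monoid. The motivating example is a tensor power of `A`. -/
structure Wires (A : ESCFM C) (J : Type) where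
  /-- The underlying object. -/
  obj : C
  [mon : MonObj obj]
  [comm : IsCommMonObj obj]
  /-- The family of homomorphisms. -/
  wire : J → (A.X ⟶ obj)
  [isMonHom : ∀ j, IsMonHom (wire j)]
  /-- The morphism to the unit. -/
  counit : obj ⟶ 𝟙_ C
  unit_counit : η[obj] ≫ counit = 𝟙 (𝟙_ C)

attribute [instance] Wires.mon Wires.comm Wires.isMonHom

namespace Wires

variable {A : ESCFM C} {J K L : Type}

/-! ### Links between wires and the state of a partition -/

section

variable (W : Wires A J) (V : Wires A K) (U : Wires A L)

/-- The state that links two wires. -/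
def link (i j : J) : 𝟙_ C ⟶ W.obj := η[A.X] ≫ (W.wire i * W.wire j)

/-- Two wires are related by a state if multiplications by these wires agree on that state. -/
def rel (t : 𝟙_ C ⟶ W.obj) : Setoid J := Setoid.ker fun j => W.wire j * (ε[A.X] ≫ t)

theorem rel_iff {t : 𝟙_ C ⟶ W.obj} {i j : J} :
    W.rel t i j ↔ W.wire i * (ε[A.X] ≫ t) = W.wire j * (ε[A.X] ≫ t) := Iff.rfl

/-- Composition with the counit is multiplicative, so an equality of products with `t` stays true
after multiplying both sides by `s`. -/
theorem le_rel_mul (t s : 𝟙_ C ⟶ W.obj) : W.rel t ≤ W.rel (t * s) := by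
  intro i j h
  rw [rel_iff] at h ⊢
  rw [comp_conv, ← mul_assoc, ← mul_assoc, h]

/-- By the counit law, convolving with a state that ignores its input is just acting by that state.
Computations with states can thus be done with morphisms out of `A.X` and then evaluated at the
unit. -/
theorem unit_comp_mul {M : C} [MonObj M] [IsCommMonObj M] (t : 𝟙_ C ⟶ M) (h : A.X ⟶ M) :
    η[A.X] ≫ ((ε[A.X] ≫ t) * h) = t * (η[A.X] ≫ h) := by
  have e : (ε[A.X] ≫ t) ⊗ₘ h = ε[A.X] ▷ A.X ≫ (𝟙_ C ◁ h) ≫ t ▷ M := by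
    rw [MonoidalCategory.tensorHom_def, comp_whiskerRight, Category.assoc,
      whisker_exchange]
  rw [conv_def, e, mul_comm, state_mul, act]
  simp

/-- This is the special law, `𝟙 * 𝟙 = 𝟙` under convolution, transported along the homomorphism
`W.wire i`. -/
theorem wire_mul_wire (i : J) : W.wire i * W.wire i = W.wire i := by
  have : W.wire i = 𝟙 _ ≫ W.wire i := (Category.id_comp _).symm
  rw [this, ← conv_comp, conv_def]
  simp [A.special]

/-- In the presence of `t` the wire `i` may be replaced by `j`; the link then becomes the square of
one wire, which is idempotent, and a single wire evaluated at the unit is 1. -/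
theorem mul_link {t : 𝟙_ C ⟶ W.obj} {i j : J} (h : W.rel t i j) : t * W.link i j = t := by
  rw [rel_iff] at h
  rw [link, ← unit_comp_mul, ← mul_assoc, mul_comm (_ ≫ t), h, mul_assoc, mul_comm _ (W.wire j),
    ← mul_assoc, wire_mul_wire, mul_comm, unit_comp_mul, IsMonHom.one_hom, ← state_one, mul_one]

/-- The Frobenius law applied to a comultiplied unit: multiplying one leg of the cup by an element
comultiplies that element. -/
theorem inl_mul_cup : inl A.X A.X * (ε[A.X] ≫ η[A.X] ≫ Δ[A.X]) = Δ[A.X] := by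
  rw [conv_def]
  have e : inl A.X A.X ⊗ₘ (ε[A.X] ≫ η[A.X] ≫ Δ[A.X]) =
      A.X ◁ ε[A.X] ≫ A.X ◁ (η[A.X] ≫ Δ[A.X]) ≫ inl A.X A.X ▷ (A.X ⊗ A.X) := by
    rw [MonoidalCategory.tensorHom_def', MonoidalCategory.whiskerLeft_comp, Category.assoc]
  rw [e]
  simp only [Category.assoc, inl_mul, MonoidalCategory.whiskerLeft_comp, A.frobenius_right]
  simp

theorem wire_mul_link (i j : J) :
    W.wire i * (ε[A.X] ≫ W.link i j) = W.wire i * W.wire j := by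
  -- The copairing of the two wires is a homomorphism because `W.obj` is commutative; the claim is
  -- the image under it of `inl_mul_cup`.
  let m : A.X ⊗ A.X ⟶ W.obj := (W.wire i ⊗ₘ W.wire j) ≫ μ[W.obj]
  have hi : inl A.X A.X ≫ m = W.wire i := by
    simp only [m, inl, Category.assoc, MonoidalCategory.tensorHom_def',
      ← MonoidalCategory.whiskerLeft_comp_assoc, IsMonHom.one_hom]
    rw [whisker_exchange_assoc]
    simp
  have hm : W.wire i * W.wire j = Δ[A.X] ≫ m := conv_def _ _
  have : IsMonHom m := inferInstance
  rw [link, hm]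
  calc W.wire i * (ε[A.X] ≫ η[A.X] ≫ Δ[A.X] ≫ m)
      = (inl A.X A.X * (ε[A.X] ≫ η[A.X] ≫ Δ[A.X])) ≫ m := by rw [conv_comp, hi]; simp
    _ = Δ[A.X] ≫ m := by rw [inl_mul_cup]

/-- By `wire_mul_link` either side equals the product of both wires, which is symmetric. -/
theorem rel_link (i j : J) : W.rel (W.link i j) i j := by
  have h : W.link i j = W.link j i := by rw [link, link, mul_comm]
  rw [rel_iff, wire_mul_link, h, wire_mul_link, mul_comm]

/-- The submonoid of states generated by the links between wires in the same class. -/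
def links (r : Setoid J) : Submonoid (𝟙_ C ⟶ W.obj) :=
  Submonoid.closure {t | ∃ i j, r i j ∧ W.link i j = t}

variable {W} in
theorem link_mem {r : Setoid J} {i j : J} (h : r i j) : W.link i j ∈ W.links r :=
  Submonoid.subset_closure ⟨i, j, h, rfl⟩

theorem mul_eq_of_mem_links {r : Setoid J} {t s : 𝟙_ C ⟶ W.obj} (ht : r ≤ W.rel t)
    (hs : s ∈ W.links r) : t * s = t := by
  induction hs using Submonoid.closure_induction with
  | mem s h =>
    obtain ⟨i, j, h, rfl⟩ := h
    exact W.mul_link (ht h)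
  | one => exact mul_one t
  | mul s s' _ _ h h' => rw [← mul_assoc, h, h']

/-- Each state absorbs the other, `t = t * s = s`. This uniqueness replaces any normal form
argument: a state is identified by checking that it is a product of links of `r` and that it
respects `r`. -/
theorem eq_of_mem_links {r : Setoid J} {t s : 𝟙_ C ⟶ W.obj} (ht : t ∈ W.links r)
    (ht' : r ≤ W.rel t) (hs : s ∈ W.links r) (hs' : r ≤ W.rel s) : t = s := by
  rw [← W.mul_eq_of_mem_links ht' hs, mul_comm, W.mul_eq_of_mem_links hs' ht]

/-- The state that links all wires in the same class. -/
noncomputable def state [Finite J] (r : Setoid J) : 𝟙_ C ⟶ W.obj :=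
  letI := Fintype.ofFinite {p : J × J // r p.1 p.2}
  ∏ p : {p : J × J // r p.1 p.2}, W.link p.1.1 p.1.2

variable [Finite J] [Finite K] [Finite L]

theorem state_mem (r : Setoid J) : W.state r ∈ W.links r :=
  Submonoid.prod_mem _ fun p _ => link_mem p.2

theorem le_rel_state (r : Setoid J) : r ≤ W.rel (W.state r) := by
  intro i j h
  let _ := Fintype.ofFinite {p : J × J // r p.1 p.2}
  -- The link of `i` and `j` is one of the factors of the state, so the relation it forces survives
  -- in the product.
  obtain ⟨s, hs⟩ := Finset.dvd_prod_of_mem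
    (fun p : {p : J × J // r p.1 p.2} => W.link p.1.1 p.1.2) (Finset.mem_univ ⟨(i, j), h⟩)
  have := W.le_rel_mul (W.link i j) s (W.rel_link i j)
  rw [state]
  convert this using 2

theorem eq_state {r : Setoid J} {t : 𝟙_ C ⟶ W.obj} (ht : t ∈ W.links r) (ht' : r ≤ W.rel t) :
    t = W.state r :=
  W.eq_of_mem_links ht ht' (W.state_mem r) (W.le_rel_state r)

theorem state_eq_one {r : Setoid J} (h : ∀ i j, r i j → i = j) : W.state r = 1 :=
  (W.eq_state (one_mem _) fun i j hij => by rw [h i j hij]).symm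

end

/-- A homomorphism of monoids that is compatible with a reindexing of wires. -/
structure IsMap (W : Wires A J) (V : Wires A K) (φ : J → K) (f : W.obj ⟶ V.obj) : Prop where
  isMonHom : IsMonHom f
  wire_comp : ∀ j, W.wire j ≫ f = V.wire (φ j)

/-! ### Transport of states along reindexings of wires -/

namespace IsMap

variable {W : Wires A J} {V : Wires A K} {U : Wires A L} {φ : J → K} {f : W.obj ⟶ V.obj}
  {ψ : K → L} {g : V.obj ⟶ U.obj} {χ : L → K} {k : U.obj ⟶ V.obj}

theorem comp (hf : IsMap W V φ f) (hg : IsMap V U ψ g) : IsMap W U (ψ ∘ φ) (f ≫ g) where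
  isMonHom := by have := hf.isMonHom; have := hg.isMonHom; infer_instance
  wire_comp j := by rw [← Category.assoc, hf.wire_comp, hg.wire_comp]; rfl

theorem link_comp (hf : IsMap W V φ f) (i j : J) : W.link i j ≫ f = V.link (φ i) (φ j) := by
  have := hf.isMonHom
  rw [link, Category.assoc, conv_comp, hf.wire_comp, hf.wire_comp, link]

theorem rel_comp (hf : IsMap W V φ f) {t : 𝟙_ C ⟶ W.obj} : W.rel t ≤ (V.rel (t ≫ f)).comap φ := by
  have := hf.isMonHom
  intro i j h
  rw [rel_iff] at h
  rw [Setoid.comap_rel, rel_iff, ← hf.wire_comp, ← hf.wire_comp, ← Category.assoc, ← conv_comp, h,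
    conv_comp]

theorem comp_mem_links (hf : IsMap W V φ f) {r : Setoid J} {r' : Setoid K} (h : r ≤ r'.comap φ)
    {t : 𝟙_ C ⟶ W.obj} (ht : t ∈ W.links r) : t ≫ f ∈ V.links r' := by
  have := hf.isMonHom
  induction ht using Submonoid.closure_induction with
  | mem s h' =>
    obtain ⟨i, j, h', rfl⟩ := h'
    rw [hf.link_comp]
    exact link_mem (h h')
  | one => rw [conv_one_comp]; exact one_mem _
  | mul s s' _ _ h h' => rw [conv_comp]; exact mul_mem h h'

variable [Finite J] [Finite K] [Finite L]

/-- The hypothesis is the universal property of the partition generated by the image of `r`. At `s =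
r'` it shows that links go to links of `r'`; at the relation of the pushed state it shows that this
state respects `r'`. -/
theorem state_comp (hf : IsMap W V φ f) {r : Setoid J} {r' : Setoid K}
    (h : ∀ s, r' ≤ s ↔ r ≤ s.comap φ) : W.state r ≫ f = V.state r' :=
  V.eq_state (hf.comp_mem_links ((h r').1 le_rfl) (W.state_mem r))
    ((h _).2 fun _ _ hij => hf.rel_comp (W.le_rel_state r hij))

/-- The same argument for a join: multiplying states joins the partitions. The glued partition in a
composite and the disjoint union of corelations are both of this form. -/
theorem state_comp_mul (hf : IsMap W V φ f) (hk : IsMap U V χ k) {r : Setoid J} {q : Setoid L}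
    {r' : Setoid K} (h : ∀ s, r' ≤ s ↔ r ≤ s.comap φ ∧ q ≤ s.comap χ) :
    (W.state r ≫ f) * (U.state q ≫ k) = V.state r' := by
  have h' := (h r').1 le_rfl
  refine V.eq_state (mul_mem (hf.comp_mem_links h'.1 (W.state_mem r))
    (hk.comp_mem_links h'.2 (U.state_mem q))) ((h _).2 ⟨fun i j hij => ?_, fun i j hij => ?_⟩)
  · exact V.le_rel_mul _ _ (hf.rel_comp (W.le_rel_state r hij))
  · rw [mul_comm]
    exact V.le_rel_mul _ _ (hk.rel_comp (U.le_rel_state q hij))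

end IsMap

/-! ### The empty family, a single wire and disjoint unions -/

section

variable (A) in
/-- No wires. -/
@[simps, reducible] def nil : Wires A Empty where
  obj := 𝟙_ C
  wire := Empty.elim
  isMonHom j := j.elim
  counit := 𝟙 _
  unit_counit := Category.comp_id _

variable (A) in
/-- A single wire. -/
@[simps, reducible] def single : Wires A Unit where
  obj := A.X
  wire _ := 𝟙 A.X
  counit := ε[A.X]
  -- The extra law enters the construction of the functor only here.
  unit_counit := A.extra

/-- The disjoint union of families of wires. -/
@[simps, reducible] def tensor (W : Wires A J) (V : Wires A K) : Wires A (J ⊕ K) where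
  obj := W.obj ⊗ V.obj
  wire := Sum.elim (fun j => W.wire j ≫ inl W.obj V.obj) (fun k => V.wire k ≫ inr W.obj V.obj)
  isMonHom := by rintro (j | k) <;> dsimp <;> infer_instance
  counit := (W.counit ⊗ₘ V.counit) ≫ (λ_ _).hom
  unit_counit := by
    rw [MonObj.tensorObj.one_def, Category.assoc, tensorHom_comp_tensorHom_assoc, W.unit_counit,
      V.unit_counit]
    simp

end

end Wires

namespace Wires

variable {A : ESCFM C} {J K L : Type}

/-! ### Reindexing of wires -/

theorem comap_symm_comap {J K : Type*} (e : J ≃ K) (r : Setoid J) :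
    (r.comap e.symm).comap e = r := by
  ext i j
  rw [Setoid.comap_rel, Setoid.comap_rel, e.symm_apply_apply, e.symm_apply_apply]

section

variable {J' K' : Type} (W : Wires A J) (V : Wires A K) (U : Wires A L) (W' : Wires A J')
  (V' : Wires A K')

namespace IsMap

variable {W V U W' V'} {f : W.obj ⟶ V.obj} {g : W'.obj ⟶ V'.obj}

theorem inl : IsMap W (W.tensor V) Sum.inl (_root_.inl W.obj V.obj) where
  isMonHom := inferInstance
  wire_comp _ := rfl

theorem inr : IsMap V (W.tensor V) Sum.inr (_root_.inr W.obj V.obj) where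
  isMonHom := inferInstance
  wire_comp _ := rfl

theorem id : IsMap W W _root_.id (𝟙 W.obj) where
  isMonHom := inferInstance
  wire_comp _ := Category.comp_id _

theorem of_eq {φ ψ : J → K} (hf : IsMap W V φ f) (h : φ = ψ) : IsMap W V ψ f := h ▸ hf

theorem tensor {φ : J → K} {ψ : J' → K'} (hf : IsMap W V φ f) (hg : IsMap W' V' ψ g) :
    IsMap (W.tensor W') (V.tensor V') (Sum.map φ ψ) (f ⊗ₘ g) where
  isMonHom := by have := hf.isMonHom; have := hg.isMonHom; dsimp; infer_instance
  wire_comp := by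
    have := hf.isMonHom
    have := hg.isMonHom
    rintro (j | j)
    · simp [inl_tensorHom, ← hf.wire_comp]
    · simp [inr_tensorHom, ← hg.wire_comp]

theorem whiskerLeft {ψ : J' → K'} (hg : IsMap W' V' ψ g) :
    IsMap (W.tensor W') (W.tensor V') (Sum.map _root_.id ψ) (W.obj ◁ g) := by
  rw [← id_tensorHom]
  exact id.tensor hg

theorem whiskerRight {φ : J → K} (hf : IsMap W V φ f) :
    IsMap (W.tensor U) (V.tensor U) (Sum.map φ _root_.id) (f ▷ U.obj) := by
  rw [← tensorHom_id]
  exact hf.tensor id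

theorem associator : IsMap ((W.tensor V).tensor U) (W.tensor (V.tensor U))
    (Equiv.sumAssoc J K L) (α_ W.obj V.obj U.obj).hom where
  isMonHom := inferInstance
  wire_comp := by
    rintro ((j | k) | l)
    · simp [inl_inl_associator]
    · simp [inr_inl_associator]
    · simp [inr_associator]

theorem inv {e : W.obj ≅ V.obj} {φ : J ≃ K} (h : IsMap W V φ e.hom) :
    IsMap V W φ.symm e.inv where
  isMonHom := by have := h.isMonHom; infer_instance
  wire_comp k := by
    rw [Iso.comp_inv_eq, h.wire_comp, φ.apply_symm_apply]

theorem braiding : IsMap (W.tensor V) (V.tensor W) (Equiv.sumComm J K)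
    (β_ W.obj V.obj).hom where
  isMonHom := inferInstance
  wire_comp := by
    rintro (j | k)
    · simp [inl_braiding]
    · simp [inr_braiding]

theorem leftUnitor : IsMap ((nil A).tensor W) W (Equiv.emptySum Empty J) (λ_ W.obj).hom where
  isMonHom := inferInstance
  wire_comp := by
    rintro (j | j)
    · exact j.elim
    · simp [inr_leftUnitor]

theorem rightUnitor : IsMap (W.tensor (nil A)) W (Equiv.sumEmpty J Empty) (ρ_ W.obj).hom where
  isMonHom := inferInstance
  wire_comp := by
    rintro (j | j)
    · simp [inl_rightUnitor]
    · exact j.elim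

theorem tensorμ : IsMap ((W.tensor W').tensor (V.tensor V')) ((W.tensor V).tensor (W'.tensor V'))
    (Equiv.sumSumSumComm J J' K K') (MonoidalCategory.tensorμ W.obj W'.obj V.obj V'.obj) := by
  -- The composite follows the definition of `tensorμ` through associators and one braiding.
  have h := (associator (W := W) (V := W') (U := V.tensor V')).comp
    (((((associator (W := W') (V := V) (U := V')).inv.comp
      (braiding.whiskerRight)).comp associator).whiskerLeft).comp associator.inv)
  have h' := h.of_eq (ψ := Equiv.sumSumSumComm J J' K K') (by
    funext x
    rcases x with (x | x) | (x | x) <;> rfl)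
  simpa [MonoidalCategory.tensorμ] using h'

variable [Finite J] [Finite K]

theorem state_comap {e : J ≃ K} (hf : IsMap W V e f) (r : Setoid K) :
    W.state (r.comap e) ≫ f = V.state r :=
  hf.state_comp fun s => ⟨fun h i j hij => h hij, fun h i j hij => by
    have := @h (e.symm i) (e.symm j) (by simpa [Setoid.comap_rel] using hij)
    simpa [Setoid.comap_rel] using this⟩

end IsMap

/-! ### Discarding wires -/

/-- Discarding the wires of `V` from a state restricts the corresponding partition. -/
def Discardable (V : Wires A K) [Finite K] : Prop :=
  ∀ {J : Type} [Finite J] (W : Wires A J) (r : Setoid (J ⊕ K)),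
    (W.tensor V).state r ≫ discardRight W.obj V.counit = W.state (r.comap Sum.inl)

theorem discardable_nil : (nil A).Discardable := fun W r => by
  have : discardRight W.obj (nil A).counit = (ρ_ W.obj).hom := by simp [discardRight]
  rw [this]
  refine IsMap.rightUnitor.state_comp fun s => ⟨fun h => ?_, fun h i j hij => h hij⟩
  rintro (i | i) (j | j) hij
  · exact h hij
  all_goals first | exact i.elim | exact j.elim

/-- If the last wire is related to some `j`, the state is that of the remaining wires times one link
to `j`, and discarding one leg of a cup leaves the unit. If it is isolated, it carries a unit, which
the counit cancels by the extra law. -/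
theorem discardable_single : (single A).Discardable := fun W r => by
  by_cases h : ∃ j, r (Sum.inl j) (Sum.inr ())
  · obtain ⟨j, hj⟩ := h
    have hr : (W.tensor (single A)).state r = (W.state (r.comap Sum.inl) ≫ inl _ _) *
        (W.tensor (single A)).link (Sum.inl j) (Sum.inr ()) := by
      refine ((W.tensor (single A)).eq_state (mul_mem (IsMap.inl.comp_mem_links le_rfl
        (W.state_mem _)) (link_mem hj)) ?_).symm
      have h1 : ∀ i i', r (Sum.inl i) (Sum.inl i') → (W.tensor (single A)).rel
          ((W.state (r.comap Sum.inl) ≫ inl _ _) *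
          (W.tensor (single A)).link (Sum.inl j) (Sum.inr ())) (Sum.inl i) (Sum.inl i') :=
        fun i i' hi => le_rel_mul _ _ _ (IsMap.inl.rel_comp (W.le_rel_state _ hi))
      have h2 : (W.tensor (single A)).rel ((W.state (r.comap Sum.inl) ≫ inl _ _) *
          (W.tensor (single A)).link (Sum.inl j) (Sum.inr ())) (Sum.inl j) (Sum.inr ()) := by
        rw [mul_comm]
        exact le_rel_mul _ _ _ (rel_link _ _ _)
      rintro (i | i) (k | k) hik
      · exact h1 i k hik
      · exact Setoid.trans' _ (h1 _ _ (r.trans hik (r.symm hj))) h2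
      · exact Setoid.symm' _ (Setoid.trans' _ (h1 _ _ (r.trans (r.symm hik) (r.symm hj))) h2)
      · exact Setoid.refl' _ _
    have hl : (W.tensor (single A)).link (Sum.inl j) (Sum.inr ()) ≫
        discardRight W.obj (single A).counit = 1 := by
      change (η[A.X] ≫ ((W.wire j ≫ inl _ _) * (𝟙 A.X ≫ inr _ _))) ≫ _ = _
      rw [conv_inl_inr, discardRight, MonoidalCategory.tensorHom_def', state_one]
      simp [← whisker_exchange_assoc]
    rw [hr, state_mul_discardRight, hl, mul_one]
  · have hr : W.state (r.comap Sum.inl) ≫ inl _ _ = (W.tensor (single A)).state r := by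
      refine IsMap.inl.state_comp fun s => ⟨fun h i j hij => h hij, fun hs => ?_⟩
      rintro (i | i) (j | j) hij
      · exact hs hij
      · exact (h ⟨i, hij⟩).elim
      · exact (h ⟨j, r.symm hij⟩).elim
      · exact s.refl _
    rw [← hr, Category.assoc, inl_discardRight (single A).unit_counit, Category.comp_id]

variable {V V'} in
theorem Discardable.tensor [Finite K] [Finite K'] (hV : V.Discardable) (hV' : V'.Discardable) :
    (V.tensor V').Discardable := fun W r => by
  -- The two families are discarded one after the other, so the partition is restricted twice.
  have : discardRight W.obj (V.tensor V').counit = (α_ _ _ _).inv ≫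
      discardRight (W.obj ⊗ V.obj) V'.counit ≫ discardRight W.obj V.counit := by
    simp [discardRight, MonoidalCategory.tensorHom_def', unitors_equal]
  have h := IsMap.associator.inv.state_comap (W := W.tensor (V.tensor V'))
    (V := (W.tensor V).tensor V') (r.comap (Equiv.sumAssoc _ _ _))
  have hr : (r.comap (Equiv.sumAssoc _ _ _)).comap (Equiv.sumAssoc _ _ _).symm = r := by
    exact comap_symm_comap (Equiv.sumAssoc _ _ _).symm r
  rw [hr] at h
  rw [this, reassoc_of% h, reassoc_of% (hV' (W.tensor V)), hV]
  rfl

/-! ### Corelations as morphisms between families of wires -/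

variable [Finite J] [Finite K] [Finite L] [Finite J'] [Finite K']

/-- The morphism given by a corelation. -/
noncomputable def map (α : Corelation J K) : W.obj ⟶ V.obj :=
  unbend W.counit ((W.tensor V).state α)

theorem map_comp_isMap {φ : K → L} {f : V.obj ⟶ U.obj} (hf : IsMap V U φ f)
    {α : Corelation J K} {κ : Corelation J L}
    (h : ∀ s : Setoid (J ⊕ L), κ ≤ s ↔ α ≤ s.comap (Sum.map _root_.id φ)) :
    W.map V α ≫ f = W.map U κ := by
  rw [map, unbend_comp, hf.whiskerLeft.state_comp h, map]

theorem map_comp (hV : V.Discardable) (α : Corelation J K) (β : Corelation K L) :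
    W.map V α ≫ V.map U β = W.map U (α.comp β) := by
  have hα : IsMap (W.tensor V) (W.tensor (V.tensor U)) (Corelation.inXY J K L)
    (W.obj ◁ inl V.obj U.obj) := IsMap.inl.whiskerLeft
  have hβ : IsMap (V.tensor U) (W.tensor (V.tensor U)) (Corelation.inYZ J K L)
    (inr W.obj (V.tensor U).obj) := IsMap.inr
  -- Gluing is defined as the finest partition above both images, which is the universal property
  -- that `state_comp_mul` asks for.
  have hg : ((W.tensor V).state α ≫ W.obj ◁ inl V.obj U.obj) *
      ((V.tensor U).state β ≫ inr W.obj (V.tensor U).obj) =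
        (W.tensor (V.tensor U)).state (α.glue β) :=
    hα.state_comp_mul hβ fun s =>
      ⟨fun h => ⟨fun i j hij => h (fun t ht => ht.1 hij), fun i j hij => h (fun t ht => ht.2 hij)⟩,
        fun h => sInf_le h⟩
  have hd : (W.tensor (V.tensor U)).state (α.glue β) ≫ W.obj ◁ (V.counit ▷ U.obj ≫ (λ_ _).hom) =
      (W.tensor U).state (α.comp β) := by
    -- `Discardable` removes wires from the right end, so the middle wires are first moved there.
    let θ : J ⊕ K ⊕ L ≃ (J ⊕ L) ⊕ K :=
      ((Equiv.refl J).sumCongr (Equiv.sumComm K L)).trans (Equiv.sumAssoc J L K).symm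
    have hθ : IsMap (W.tensor (V.tensor U)) ((W.tensor U).tensor V) θ
        (W.obj ◁ (β_ V.obj U.obj).hom ≫ (α_ _ _ _).inv) :=
      IsMap.braiding.whiskerLeft.comp IsMap.associator.inv
    have e : W.obj ◁ (V.counit ▷ U.obj ≫ (λ_ _).hom) =
        (W.obj ◁ (β_ V.obj U.obj).hom ≫ (α_ _ _ _).inv) ≫
          discardRight (W.obj ⊗ U.obj) V.counit := by
      rw [discardRight, rightUnitor_tensor_hom, Category.assoc,
        associator_naturality_right_assoc, Iso.inv_hom_id_assoc,
        ← MonoidalCategory.whiskerLeft_comp, ← MonoidalCategory.whiskerLeft_comp,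
        ← BraidedCategory.braiding_naturality_left_assoc, braiding_rightUnitor]
    have h := hθ.state_comap ((α.glue β).comap θ.symm)
    have hr : ((α.glue β).comap θ.symm).comap θ = α.glue β := by
      exact comap_symm_comap θ _
    rw [hr] at h
    rw [e, ← Category.assoc, h, hV (W.tensor U)]
    congr 1
    ext i j
    rcases i with i | i <;> rcases j with j | j <;> rfl
  calc W.map V α ≫ V.map U β
      = (unbend W.counit ((W.tensor V).state α ≫ W.obj ◁ inl V.obj U.obj) ≫
          act ((V.tensor U).state β)) ≫ V.counit ▷ U.obj ≫ (λ_ _).hom := by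
        rw [← unbend_comp]
        simp only [map, unbend, Category.assoc]
    _ = W.map U (α.comp β) := by
        rw [← unbend_mul_inr, hg, unbend_comp, hd, map]

theorem map_tensor (α : Corelation J K) (β : Corelation J' K') :
    (W.tensor W').map (V.tensor V') (α.tensor β) = W.map V α ⊗ₘ W'.map V' β := by
  have hs := (IsMap.tensorμ (W := W) (V := V) (W' := W') (V' := V')).state_comap
    ((α.tensor β).comap (Equiv.sumSumSumComm J J' K K').symm)
  have hm := (IsMap.tensorμ (W := W) (V := V) (W' := W') (V' := V')).isMonHom
  have hr : ((α.tensor β).comap (Equiv.sumSumSumComm J J' K K').symm).comap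
      (Equiv.sumSumSumComm J J' K K') = α.tensor β := by
    exact comap_symm_comap _ _
  -- Before the exchange of the two middle factors the disjoint union is the join of the two
  -- included partitions.
  have hp : ((W.tensor V).state α ≫ inl _ _) * ((W'.tensor V').state β ≫ inr _ _) =
      ((W.tensor V).tensor (W'.tensor V')).state
        ((α.tensor β).comap (Equiv.sumSumSumComm J J' K K').symm) := by
    refine IsMap.inl.state_comp_mul IsMap.inr fun s => ⟨fun h => ⟨fun i j hij => h ?_,
      fun i j hij => h ?_⟩, fun h i j hij => ?_⟩
    · change Sum.LiftRel _ _ _ _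
      rw [Equiv.apply_symm_apply, Equiv.apply_symm_apply]
      exact Sum.LiftRel.inl hij
    · change Sum.LiftRel _ _ _ _
      rw [Equiv.apply_symm_apply, Equiv.apply_symm_apply]
      exact Sum.LiftRel.inr hij
    · change Sum.LiftRel _ _ _ _ at hij
      rw [Equiv.apply_symm_apply, Equiv.apply_symm_apply] at hij
      obtain hij | hij := hij
      · exact h.1 hij
      · exact h.2 hij
  rw [hr] at hs
  simp only [map, unbend]
  rw [← tensorHom_comp_tensorHom, ← tensorHom_comp_tensorHom, ← act_tensor, hp, ← hs,
    ← tensorμ_discardLeft, ← inl_tensorμ, Category.assoc, reassoc_of% (act_comp _ _)]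

/-! ### Identities and bijections as corelations -/

/-- The identity corelation is sent to the identity. -/
def Faithful (W : Wires A J) : Prop := W.map W (Corelation.id J) = 𝟙 W.obj

theorem faithful_nil : (nil A).Faithful := by
  have : ((nil A).tensor (nil A)).state (Corelation.id Empty) = 1 :=
    state_eq_one _ fun i => by rcases i with i | i <;> exact i.elim
  rw [Faithful, map, this, unbend, act_one]
  simp [inl, unitors_equal]

theorem state_single_single :
    ((single A).tensor (single A)).state (Corelation.id Unit) = η[A.X] ≫ Δ[A.X] := by
  have h : ((single A).tensor (single A)).link (Sum.inl ()) (Sum.inr ()) = η[A.X] ≫ Δ[A.X] := by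
    change η[A.X] ≫ ((𝟙 A.X ≫ inl _ _) * (𝟙 A.X ≫ inr _ _)) = _
    rw [conv_inl_inr]
    simp
  rw [← h]
  refine (eq_state _ (link_mem rfl) ?_).symm
  have h := ((single A).tensor (single A)).rel_link (Sum.inl ()) (Sum.inr ())
  rintro (i | i) (j | j) -
  · exact Setoid.refl' _ _
  · exact h
  · exact Setoid.symm' _ h
  · exact Setoid.refl' _ _

/-- The snake equation: the Frobenius law turns the bent cup into a multiplication by the unit
followed by a comultiplication and a counit. -/
theorem unbend_unit_comul : unbend ε[A.X] (η[A.X] ≫ Δ[A.X]) = 𝟙 A.X := by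
  rw [unbend_eq, MonoidalCategory.whiskerLeft_comp, Category.assoc, comp_whiskerRight,
    Category.assoc, reassoc_of% A.frobenius_right]
  simp

theorem faithful_single : (single A).Faithful := by
  rw [Faithful, map, state_single_single]
  exact unbend_unit_comul

variable {V V'} in
theorem Faithful.tensor (hV : V.Faithful) (hV' : V'.Faithful) : (V.tensor V').Faithful := by
  have : (Corelation.id K).tensor (Corelation.id K') = Corelation.id (K ⊕ K') := by
    rw [Corelation.id_eq, Corelation.id_eq, Corelation.ofEquiv_tensor, Equiv.sumCongr_refl]
    rfl
  rw [Faithful, ← this, map_tensor, hV, hV', id_tensorHom_id]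

variable {W V} in
-- Precompose `f` with the identity, written as the image of the identity corelation; pushing that
-- corelation forward along `e` gives the corelation of `e`. All structure isomorphisms are
-- identified in this way.
theorem IsMap.eq_map {e : J ≃ K} {f : W.obj ⟶ V.obj} (hf : IsMap W V e f) (hW : W.Faithful) :
    f = W.map V (Corelation.ofEquiv e) := by
  rw [← Category.id_comp f, ← hW]
  refine map_comp_isMap _ _ _ hf fun s => ⟨fun h i j hij => h ?_, fun h => ?_⟩
  · have hij : Sum.elim _root_.id _root_.id i = Sum.elim _root_.id _root_.id j := hij
    change Sum.elim e _root_.id _ = Sum.elim e _root_.id _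
    rcases i with i | i <;> rcases j with j | j <;> exact congrArg e hij
  · have key : ∀ i, s i (Sum.inr (Sum.elim e _root_.id i)) := by
      rintro (i | k)
      · exact @h (Sum.inl i) (Sum.inr i) rfl
      · exact s.refl _
    intro i j hij
    have hij : Sum.elim e _root_.id i = Sum.elim e _root_.id j := hij
    exact s.trans (key i) (hij ▸ s.symm (key j))

/-! ### The generating corelations -/

theorem map_mul : ((single A).tensor (single A)).map (single A) ⊤ = μ[A.X] := by
  -- The multiplication is a homomorphism that sends both wires to the same wire, so it pushes the
  -- identity corelation forward to a single block.
  have h : IsMap ((single A).tensor (single A)) (single A) (fun _ => ()) μ[A.X] := by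
    refine ⟨inferInstance, ?_⟩
    rintro (i | i)
    · simp [inl]
    · simp [inr]
  rw [← Category.id_comp μ[A.X]]
  erw [← (faithful_single (A := A)).tensor faithful_single]
  refine (map_comp_isMap _ _ _ h fun s => ⟨fun h i j hij => h trivial, fun h => ?_⟩).symm
  have key : ∀ i, s i (Sum.inr ()) := by
    rintro (i | k)
    · exact @h (Sum.inl i) (Sum.inr i) rfl
    · exact s.refl _
  exact fun i j _ => s.trans (key i) (s.symm (key j))

theorem map_unit : (nil A).map (single A) ⊤ = η[A.X] := by
  have h : IsMap (nil A) (single A) Empty.elim η[A.X] := ⟨inferInstance, fun i => i.elim⟩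
  rw [← Category.id_comp η[A.X]]
  erw [← faithful_nil (A := A)]
  refine (map_comp_isMap _ _ _ h fun s => ⟨fun h i j hij => h trivial, fun h => ?_⟩).symm
  rintro (i | i) (j | j) -
  · exact i.elim
  · exact i.elim
  · exact j.elim
  · exact s.refl _

theorem map_counit : (single A).map (nil A) ⊤ = ε[A.X] := by
  have : ((single A).tensor (nil A)).state ⊤ = 1 := state_eq_one _ fun i j _ => by
    rcases i with i | i
    · rcases j with j | j
      · rfl
      · exact j.elim
    · exact i.elim
  rw [map, this, unbend, act_one]
  simp [inl, unitors_equal]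

/-- The comultiplication is not available as a homomorphism of monoids, so pushing forward does not
apply. Instead the block of three wires is written as two links that share a wire, which is the cup
with one leg comultiplied; unbending it gives the comultiplication after a snake. -/
theorem map_comul : (single A).map ((single A).tensor (single A)) ⊤ = Δ[A.X] := by
  let W := (single A).tensor ((single A).tensor (single A))
  let x : Unit ⊕ Unit ⊕ Unit := Sum.inl ()
  let a : Unit ⊕ Unit ⊕ Unit := Sum.inr (Sum.inl ())
  let b : Unit ⊕ Unit ⊕ Unit := Sum.inr (Sum.inr ())
  have h1 : W.link x a * W.link x b = W.state ⊤ := by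
    refine W.eq_state (mul_mem (link_mem trivial) (link_mem trivial)) ?_
    have ha : W.rel (W.link x a * W.link x b) x a := W.le_rel_mul _ _ (W.rel_link x a)
    have hb : W.rel (W.link x a * W.link x b) x b := by
      rw [mul_comm]
      exact W.le_rel_mul _ _ (W.rel_link x b)
    have key : ∀ i, W.rel (W.link x a * W.link x b) x i := by
      rintro (i | i | i)
      · exact Setoid.refl' _ _
      · exact ha
      · exact hb
    exact fun i j _ => Setoid.trans' _ (Setoid.symm' _ (key i)) (key j)
  have h2 : W.link x a * W.link x b = η[A.X] ≫ (W.wire x * (W.wire a * W.wire b)) := by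
    conv_lhs => rw [link.eq_1 W x b]
    rw [← unit_comp_mul, ← mul_assoc, mul_comm _ (W.wire x), wire_mul_link, mul_assoc]
  have h3 : W.wire a * W.wire b = Δ[A.X] ≫ inr A.X (A.X ⊗ A.X) := by
    have := conv_inl_inr (𝟙 A.X) (𝟙 A.X)
    rw [id_tensorHom_id, Category.comp_id] at this
    rw [← this, conv_comp]
    rfl
  have h4 : W.wire x * (Δ[A.X] ≫ inr A.X (A.X ⊗ A.X)) = Δ[A.X] ≫ A.X ◁ Δ[A.X] := by
    rw [← id_tensorHom]
    exact conv_inl_inr _ _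
  rw [map, ← h1, h2, h3, h4, ← Category.assoc]
  erw [← unbend_comp]
  rw [unbend_unit_comul, Category.id_comp]

end

end Wires

end

section

open scoped MonObj ComonObj

variable {C : Type u} [Category.{v} C] [MonoidalCategory C] [SymmetricCategory C]

/-! ### The functor from corelations determined by an extraspecial commutative Frobenius monoid -/

/-- Well-behaved families of wires whose wires are labelled by the elements of a finite set. -/
structure LabelledWires (A : ESCFM C) (X : FinCorel.{w}) where
  /-- The type of wires. -/
  J : Type
  [finite : Finite J]
  /-- The family of wires. -/
  wires : Wires A J
  discardable : wires.Discardable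
  faithful : wires.Faithful
  /-- The labels of the wires. -/
  label : J ≃ X.carrier

attribute [instance] LabelledWires.finite

namespace LabelledWires

variable {A : ESCFM C} {X Y Z X' Y' : FinCorel.{w}}

/-- The empty family of wires. -/
def nil (A : ESCFM C) : LabelledWires A (𝟙_ FinCorel.{w}) where
  J := Empty
  wires := Wires.nil A
  discardable := Wires.discardable_nil
  faithful := Wires.faithful_nil
  label := Equiv.equivOfIsEmpty Empty PEmpty

/-- The disjoint union of families of wires. -/
def tensor (P : LabelledWires A X) (Q : LabelledWires A Y) :
    LabelledWires A (X ⊗ Y) where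
  J := P.J ⊕ Q.J
  wires := P.wires.tensor Q.wires
  discardable := Wires.Discardable.tensor P.discardable Q.discardable
  faithful := Wires.Faithful.tensor P.faithful Q.faithful
  label := P.label.sumCongr Q.label

/-- A single wire. -/
def single (A : ESCFM C) (X : FinCorel.{w}) [Unique X.carrier] : LabelledWires A X where
  J := Unit
  wires := Wires.single A
  discardable := Wires.discardable_single
  faithful := Wires.faithful_single
  label := Equiv.ofUnique Unit X.carrier

/-- Relabelling the wires of a family. -/
def relabel (P : LabelledWires A X) (e : X.carrier ≃ Y.carrier) : LabelledWires A Y where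
  J := P.J
  wires := P.wires
  discardable := P.discardable
  faithful := P.faithful
  label := P.label.trans e

theorem nonempty (A : ESCFM C) (X : FinCorel.{w}) : Nonempty (LabelledWires A X) := by
  obtain ⟨n, ⟨e⟩⟩ := Finite.exists_equiv_fin X.carrier
  induction n generalizing X with
  | zero => exact ⟨(nil A).relabel ((Equiv.equivOfIsEmpty PEmpty (Fin 0)).trans e.symm)⟩
  | succ n ih =>
    -- Wires are indexed in the lowest universe and labels in an arbitrary one; the labelling
    -- bijection bridges the two.
    obtain ⟨P⟩ := ih ⟨ULift (Fin n)⟩ Equiv.ulift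
    exact ⟨(P.tensor (single A ⟨ULift (Fin 1)⟩)).relabel
      ((Equiv.ulift.sumCongr Equiv.ulift).trans (finSumFinEquiv.trans e.symm))⟩

section

variable (P : LabelledWires A X) (Q : LabelledWires A Y) (R : LabelledWires A Z)
  (P' : LabelledWires A X') (Q' : LabelledWires A Y')

/-- The morphism given by a corelation. -/
noncomputable def map (f : X ⟶ Y) : P.wires.obj ⟶ Q.wires.obj :=
  P.wires.map Q.wires ((Corelation.ofEquiv P.label).comp
    (Corelation.comp f (Corelation.ofEquiv Q.label.symm)))

theorem colors_label {J K X Y : Type*} (e : J ≃ X) (f : K ≃ Y) (α : Corelation X Y)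
    (u : J → Prop) (v : K → Prop) :
    ((Corelation.ofEquiv e).comp (α.comp (Corelation.ofEquiv f.symm))).Colors u v ↔
      α.Colors (u ∘ e.symm) (v ∘ f.symm) := by
  rw [Corelation.colors_ofEquiv_comp, Corelation.colors_comp_ofEquiv]

theorem ofEquiv_label {J K X Y : Type*} (e : J ≃ X) (f : K ≃ Y) (g : X ≃ Y) (h : J ≃ K)
    (hg : ∀ j, f (h j) = g (e j)) :
    (Corelation.ofEquiv e).comp ((Corelation.ofEquiv g).comp (Corelation.ofEquiv f.symm)) =
      Corelation.ofEquiv h := by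
  rw [Corelation.ofEquiv_comp, Corelation.ofEquiv_comp]
  congr 1
  ext j
  simp [← hg]

theorem map_of_isMap {h : P.J ≃ Q.J} {f : P.wires.obj ⟶ Q.wires.obj}
    (hf : Wires.IsMap P.wires Q.wires h f) (g : X.carrier ≃ Y.carrier)
    (hg : ∀ j, Q.label (h j) = g (P.label j)) : P.map Q (Corelation.ofEquiv g) = f := by
  rw [map, hf.eq_map P.faithful]
  congr 1
  exact ofEquiv_label _ _ _ _ hg

theorem map_id : P.map P (𝟙 X) = 𝟙 _ :=
  map_of_isMap P P (h := Equiv.refl _) Wires.IsMap.id (Equiv.refl _) fun _ => rfl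

theorem map_comp (f : X ⟶ Y) (g : Y ⟶ Z) : P.map R (f ≫ g) = P.map Q f ≫ Q.map R g := by
  rw [map, map, map, Wires.map_comp _ _ _ Q.discardable]
  congr 1
  refine Corelation.ext_colors fun u v => ?_
  refine (colors_label _ _ _ _ _).trans ?_
  refine (Corelation.colors_comp _ _ _ _).trans ?_
  rw [Corelation.colors_comp]
  simp only [colors_label]
  constructor
  · rintro ⟨w, h⟩
    exact ⟨w ∘ Q.label, by simpa [Function.comp_assoc] using h⟩
  · rintro ⟨w, h⟩
    exact ⟨_, h⟩

theorem map_tensor (f : X ⟶ Y) (g : X' ⟶ Y') :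
    (P.tensor P').map (Q.tensor Q') (f ⊗ₘ g) = P.map Q f ⊗ₘ P'.map Q' g := by
  rw [map, map, map, ← Wires.map_tensor]
  congr 1
  refine Corelation.ext_colors fun u v => ?_
  refine (colors_label _ _ _ _ _).trans ?_
  refine (Corelation.colors_tensor _ _ _ _).trans ?_
  refine Iff.trans ?_ (Corelation.colors_tensor _ _ _ _).symm
  rw [colors_label, colors_label]
  rfl

theorem map_whiskerRight (f : X ⟶ Y) :
    (P.tensor R).map (Q.tensor R) (f ▷ Z) = P.map Q f ▷ R.wires.obj := by
  rw [← tensorHom_id, map_tensor, map_id, tensorHom_id]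

theorem map_whiskerLeft (f : X ⟶ Y) :
    (R.tensor P).map (R.tensor Q) (Z ◁ f) = R.wires.obj ◁ P.map Q f := by
  rw [← id_tensorHom, map_tensor, map_id, id_tensorHom]

theorem map_associator : ((P.tensor Q).tensor R).map (P.tensor (Q.tensor R)) (α_ X Y Z).hom =
    (α_ _ _ _).hom :=
  map_of_isMap ((P.tensor Q).tensor R) (P.tensor (Q.tensor R)) Wires.IsMap.associator
    (Equiv.sumAssoc _ _ _) (by rintro ((j | j) | j) <;> rfl)

theorem map_leftUnitor : ((nil A).tensor P).map P (λ_ X).hom = (λ_ _).hom :=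
  map_of_isMap ((nil A).tensor P) P Wires.IsMap.leftUnitor (Equiv.emptySum PEmpty _)
    (by rintro (j | j); exacts [j.elim, rfl])

theorem map_rightUnitor : (P.tensor (nil A)).map P (ρ_ X).hom = (ρ_ _).hom :=
  map_of_isMap (P.tensor (nil A)) P Wires.IsMap.rightUnitor (Equiv.sumEmpty _ PEmpty)
    (by rintro (j | j); exacts [rfl, j.elim])

theorem map_braiding : (P.tensor Q).map (Q.tensor P) (β_ X Y).hom = (β_ _ _).hom :=
  map_of_isMap (P.tensor Q) (Q.tensor P) Wires.IsMap.braiding (Equiv.sumComm _ _)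
    (by rintro (j | j) <;> rfl)

/-- Two families of wires with the same labels are isomorphic. -/
noncomputable def iso (P' : LabelledWires A X) : P.wires.obj ≅ P'.wires.obj where
  hom := P.map P' (𝟙 X)
  inv := P'.map P (𝟙 X)
  hom_inv_id := by rw [← map_comp, Category.comp_id, map_id]
  inv_hom_id := by rw [← map_comp, Category.comp_id, map_id]

end

/-- A choice of a family of wires for each finite set. -/
noncomputable def choice (A : ESCFM C) (X : FinCorel.{w}) : LabelledWires A X :=
  (nonempty A X).some

end LabelledWires

namespace ESCFM

open LabelledWires

variable (A : ESCFM C)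

/-- The functor from finite sets and corelations that sends a set to a tensor power of an
extraspecial commutative Frobenius monoid. -/
noncomputable def corelFunctor : FinCorel.{w} ⥤ C where
  obj X := (choice A X).wires.obj
  map f := (choice A _).map (choice A _) f
  map_id _ := map_id _
  map_comp _ _ := map_comp _ _ _ _ _

/-- The functor `corelFunctor` is strong monoidal. -/
noncomputable def corelFunctorCore : (corelFunctor.{w} A).CoreMonoidal where
  -- Both comparison isomorphisms are the identity corelation read between two families with the
  -- same labels, so each coherence law reduces through `map_comp` to an equation between
  -- corelations.
  εIso := (nil A).iso (choice A _)
  μIso X Y := ((choice A X).tensor (choice A Y)).iso (choice A (X ⊗ Y))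
  μIso_hom_natural_left f X' := by
    refine (congrArg (· ≫ _) (map_whiskerRight _ _ _ f).symm).trans ?_
    refine (map_comp _ _ _ _ _).symm.trans (Eq.trans ?_ (map_comp _ _ _ _ _))
    rw [Category.comp_id, Category.id_comp]
  μIso_hom_natural_right X' f := by
    refine (congrArg (· ≫ _) (map_whiskerLeft _ _ _ f).symm).trans ?_
    refine (map_comp _ _ _ _ _).symm.trans (Eq.trans ?_ (map_comp _ _ _ _ _))
    rw [Category.comp_id, Category.id_comp]
  associativity X Y Z := by
    refine (congrArg₂ (· ≫ ·) (map_whiskerRight _ _ _ _).symm (map_comp _ _ _ _ _).symm).trans ?_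
    refine (map_comp _ _ _ _ _).symm.trans ?_
    refine Eq.trans ?_ (congrArg₂ (· ≫ ·) (map_associator _ _ _)
      ((map_comp ((choice A X).tensor ((choice A Y).tensor (choice A Z)))
        ((choice A X).tensor (choice A (Y ⊗ Z))) (choice A (X ⊗ Y ⊗ Z)) (X ◁ 𝟙 (Y ⊗ Z)) (𝟙 _)).trans
        (congrArg (· ≫ _) (map_whiskerLeft _ _ _ _))))
    refine Eq.trans ?_ (map_comp _ _ _ _ _)
    simp
  left_unitality X := by
    refine Eq.trans ?_ (congrArg₂ (· ≫ ·) (map_whiskerRight (nil A) (choice A (𝟙_ _)) (choice A X) (𝟙 _))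
      (map_comp ((choice A (𝟙_ _)).tensor (choice A X)) (choice A (𝟙_ _ ⊗ X)) (choice A X) (𝟙 _)
        (λ_ X).hom))
    refine (map_leftUnitor _).symm.trans (Eq.trans ?_ (map_comp _ _ _ _ _))
    simp
  right_unitality X := by
    refine Eq.trans ?_ (congrArg₂ (· ≫ ·) (map_whiskerLeft (nil A) (choice A (𝟙_ _)) (choice A X) (𝟙 _))
      (map_comp ((choice A X).tensor (choice A (𝟙_ _))) (choice A (X ⊗ 𝟙_ _)) (choice A X) (𝟙 _)
        (ρ_ X).hom))
    refine (map_rightUnitor _).symm.trans (Eq.trans ?_ (map_comp _ _ _ _ _))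
    simp

noncomputable instance : (corelFunctor.{w} A).Braided where
  toMonoidal := (corelFunctorCore A).toMonoidal
  braided X Y := by
    refine (map_comp _ _ _ _ _).symm.trans ?_
    refine Eq.trans ?_ (congrArg (· ≫ _) (map_braiding _ _))
    refine Eq.trans ?_ (map_comp _ _ _ _ _)
    simp

end ESCFM

end

/-! ### The symmetric monoidal functor given by a morphism of props -/

namespace PROP

variable {P Q : PROP.{w}} (φ : P ⟶ Q)

theorem map_eqHom {n m : ℕ} (h : n = m) : Morphism.map φ (P.eqHom h) = Q.eqHom h := by
  subst h
  exact Morphism.map_id φ n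

/-- The functor given by a morphism of props. -/
def functor : P.Obj ⥤ Q.Obj where
  obj n := ⟨n.val⟩
  map f := Morphism.map φ f
  map_id n := Morphism.map_id φ n.val
  map_comp f g := Morphism.map_comp φ f g

/-- The functor given by a morphism of props is strict monoidal. -/
def functorCore : (functor φ).CoreMonoidal where
  εIso := Iso.refl _
  μIso _ _ := Iso.refl _
  μIso_hom_natural_left f n := by
    refine (Category.comp_id _).trans (Eq.trans ?_ (Category.id_comp _).symm)
    refine Eq.trans ?_ (Morphism.map_tensor φ _ _).symm
    exact congrArg _ (Morphism.map_id φ _).symm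
  μIso_hom_natural_right n f := by
    refine (Category.comp_id _).trans (Eq.trans ?_ (Category.id_comp _).symm)
    refine Eq.trans ?_ (Morphism.map_tensor φ _ _).symm
    exact congrArg (Q.tensor · _) (Morphism.map_id φ _).symm
  associativity n m p := by
    refine (congrArg (· ≫ _) (Q.tensor_id _ _)).trans ((Category.id_comp _).trans ?_)
    refine (Category.id_comp _).trans ((map_eqHom φ _).trans ?_)
    refine Eq.symm ((congrArg (CategoryStruct.comp _) ?_).trans (Category.comp_id _))
    exact (congrArg₂ CategoryStruct.comp (Q.tensor_id _ _) rfl).trans (Category.id_comp _)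
  left_unitality n := by
    refine Eq.trans ?_ (congrArg (· ≫ _) (Q.tensor_id _ _)).symm
    refine Eq.trans ?_ (Category.id_comp _).symm
    refine Eq.trans ?_ (Category.id_comp _).symm
    exact (map_eqHom φ _).symm
  right_unitality n := by
    refine Eq.trans ?_ (congrArg (· ≫ _) (Q.tensor_id _ _)).symm
    refine Eq.trans ?_ (Category.id_comp _).symm
    refine Eq.trans ?_ (Category.id_comp _).symm
    exact (map_eqHom φ (Nat.add_zero n.val)).symm

instance : (functor φ).Braided where
  toMonoidal := (functorCore φ).toMonoidal
  braided n m := by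
    refine (Category.id_comp _).trans (Eq.trans ?_ (Category.comp_id _).symm)
    exact Morphism.map_braid φ _ _

end PROP

/-! ### The prop of corelations is a skeleton -/

namespace Corelation

/-- Choosing for each colouring of one side a compatible colouring of the other is injective in both
directions, because the composites relate only equal colourings. Hence `2 ^ n = 2 ^ m`. -/
theorem eq_of_comp_eq_id {n m : ℕ} {α : Corelation (Fin n) (Fin m)}
    {β : Corelation (Fin m) (Fin n)} (h : α.comp β = id (Fin n)) (h' : β.comp α = id (Fin m)) :
    n = m := by
  classical
  have h1 : ∀ u v, (∃ w, α.Colors u w ∧ β.Colors w v) ↔ u = v := fun u v => by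
    rw [← colors_comp, h, colors_id]
  have h2 : ∀ u v, (∃ w, β.Colors u w ∧ α.Colors w v) ↔ u = v := fun u v => by
    rw [← colors_comp, h', colors_id]
  choose f hf hf' using fun u => (h1 u u).2 rfl
  have hinj : Function.Injective f := fun u v huv =>
    (h1 u v).1 ⟨f u, hf u, huv ▸ hf' v⟩
  choose g hg hg' using fun u => (h2 u u).2 rfl
  have ginj : Function.Injective g := fun u v huv =>
    (h2 u v).1 ⟨g u, hg u, huv ▸ hg' v⟩
  have e := le_antisymm (Fintype.card_le_of_injective f hinj) (Fintype.card_le_of_injective g ginj)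
  simpa using e

theorem ofEquiv_congr {X Y : Type*} {e f : X ≃ Y} (h : ∀ x, e x = f x) : ofEquiv e = ofEquiv f :=
  congrArg ofEquiv (Equiv.ext h)

end Corelation

/-- The inclusion of the prop of corelations into the category of finite sets and corelations. -/
def corelInclusion : corelPROP.Obj ⥤ FinCorel.{w} where
  obj n := ⟨ULift (Fin n.val)⟩
  map {n m} α := (Corelation.ofEquiv Equiv.ulift).comp
    (Corelation.comp α (Corelation.ofEquiv (Equiv.ulift (α := Fin m.val)).symm))
  map_id n := by
    refine (congrArg (Corelation.comp _) (Corelation.id_comp _)).trans ?_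
    refine (Corelation.ofEquiv_comp _ _).trans ?_
    rw [Equiv.self_trans_symm]
    rfl
  map_comp {n m p} f g := by
    refine Corelation.ext_colors fun u v => ?_
    refine (LabelledWires.colors_label _ _ _ _ _).trans ?_
    refine (Corelation.colors_comp _ _ _ _).trans ?_
    refine Iff.trans ?_ (Corelation.colors_comp _ _ _ _).symm
    exact ⟨fun ⟨w, h⟩ => ⟨w ∘ Equiv.ulift, (LabelledWires.colors_label _ _ _ _ _).2 h.1,
      (LabelledWires.colors_label _ _ _ _ _).2 h.2⟩, fun ⟨w, h⟩ => ⟨w ∘ Equiv.ulift.symm,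
      (LabelledWires.colors_label _ _ _ _ _).1 h.1, (LabelledWires.colors_label _ _ _ _ _).1 h.2⟩⟩

theorem colors_corelInclusion {n m : corelPROP.Obj} (α : n ⟶ m) (u : ULift (Fin n.val) → Prop)
    (v : ULift (Fin m.val) → Prop) : Corelation.Colors (corelInclusion.map α) u v ↔
      Corelation.Colors α (u ∘ Equiv.ulift.symm) (v ∘ Equiv.ulift.symm) :=
  LabelledWires.colors_label _ _ _ _ _

theorem corelInclusion_ofEquiv {n m : corelPROP.Obj} (e : Fin n.val ≃ Fin m.val) :
    corelInclusion.map (X := n) (Y := m) (Corelation.ofEquiv e) =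
      Corelation.ofEquiv ((Equiv.ulift.trans e).trans Equiv.ulift.symm) := by
  refine (congrArg (Corelation.comp _) (Corelation.ofEquiv_comp _ _)).trans ?_
  exact Corelation.ofEquiv_comp _ _

theorem corelInclusion_eqHom {n m : corelPROP.Obj} (h : n.val = m.val) :
    corelInclusion.map (X := n) (Y := m) (corelPROP.eqHom h) =
      Corelation.ofEquiv ((Equiv.ulift.trans (finCongr h)).trans Equiv.ulift.symm) :=
  (congrArg _ (corelData_eqHom h)).trans (corelInclusion_ofEquiv _)

/-- The inclusion is strong monoidal. -/
def corelInclusionCore : corelInclusion.{w}.CoreMonoidal where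
  εIso := FinCorel.isoOfEquiv (Equiv.equivOfIsEmpty PEmpty (ULift (Fin 0)))
  μIso n m := FinCorel.isoOfEquiv ((Equiv.ulift.sumCongr Equiv.ulift).trans
    (finSumFinEquiv.trans (Equiv.ulift (α := Fin (n.val + m.val))).symm))
  μIso_hom_natural_left {n m} f p := by
    refine Corelation.ext_colors fun u v => ?_
    -- Writing the colouring as one pulled back along the comparison bijection lets the inverse
    -- bijection on the other side cancel.
    obtain ⟨u, rfl⟩ := (((Equiv.ulift.{w}.sumCongr Equiv.ulift.{w}).trans (finSumFinEquiv.trans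
      (Equiv.ulift.{w} (α := Fin (n.val + p.val))).symm)).arrowCongr
        (Equiv.refl Prop)).symm.surjective u
    refine (Corelation.colors_comp_ofEquiv _ _ _ _).trans ?_
    refine Iff.trans ?_ (Corelation.colors_ofEquiv_comp _ _ _ _).symm
    refine Iff.trans ?_ (iff_of_eq (congrArg (Corelation.Colors _ · _) (a₁ := u) ?_))
    rotate_left
    · funext x
      exact congrArg u (Equiv.apply_symm_apply _ x).symm
    refine (Corelation.colors_tensor _ _ _ _).trans ?_
    refine Iff.trans ?_ (colors_corelInclusion _ _ _).symm
    refine Iff.trans ?_ (Corelation.colors_finTensor _ _ _ _).symm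
    refine and_congr (colors_corelInclusion f _ _)
      ((Corelation.colors_id _ _).trans (Iff.trans ?_ (Corelation.colors_id _ _).symm))
    exact ⟨fun h => funext fun x => congrFun h ⟨x⟩, fun h => funext fun x => congrFun h x.down⟩
  μIso_hom_natural_right {n m} p f := by
    refine Corelation.ext_colors fun u v => ?_
    obtain ⟨u, rfl⟩ := (((Equiv.ulift.{w}.sumCongr Equiv.ulift.{w}).trans (finSumFinEquiv.trans
      (Equiv.ulift.{w} (α := Fin (p.val + n.val))).symm)).arrowCongr
        (Equiv.refl Prop)).symm.surjective u
    refine (Corelation.colors_comp_ofEquiv _ _ _ _).trans ?_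
    refine Iff.trans ?_ (Corelation.colors_ofEquiv_comp _ _ _ _).symm
    refine Iff.trans ?_ (iff_of_eq (congrArg (Corelation.Colors _ · _) (a₁ := u) ?_))
    rotate_left
    · funext x
      exact congrArg u (Equiv.apply_symm_apply _ x).symm
    refine (Corelation.colors_tensor _ _ _ _).trans ?_
    refine Iff.trans ?_ (colors_corelInclusion _ _ _).symm
    refine Iff.trans ?_ (Corelation.colors_finTensor _ _ _ _).symm
    refine and_congr ((Corelation.colors_id _ _).trans
      (Iff.trans ?_ (Corelation.colors_id _ _).symm)) (colors_corelInclusion f _ _)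
    exact ⟨fun h => funext fun x => congrFun h ⟨x⟩, fun h => funext fun x => congrFun h x.down⟩
  associativity n m p := by
    refine (congrArg₂ CategoryStruct.comp (Corelation.ofEquiv_tensor _ (Equiv.refl _))
      ((congrArg (CategoryStruct.comp _) (corelInclusion_eqHom _)).trans
        (Corelation.ofEquiv_comp _ _))).trans ?_
    refine (Corelation.ofEquiv_comp _ _).trans ?_
    refine Eq.symm ((congrArg (CategoryStruct.comp _) ((congrArg₂ CategoryStruct.comp
      (Corelation.ofEquiv_tensor (Equiv.refl _) _) rfl).trans
        (Corelation.ofEquiv_comp _ _))).trans ((Corelation.ofEquiv_comp _ _).trans ?_))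
    refine Corelation.ofEquiv_congr fun x => ULift.ext _ _ (Fin.ext ?_)
    rcases x with (x | x) | x
    · rfl
    · rfl
    · exact (Nat.add_assoc _ _ _).symm
  left_unitality n := by
    refine Eq.trans ?_ (congrArg₂ CategoryStruct.comp (Corelation.ofEquiv_tensor _ (Equiv.refl _))
      ((congrArg (CategoryStruct.comp _) (corelInclusion_eqHom _)).trans
        (Corelation.ofEquiv_comp _ _))).symm
    refine Eq.trans ?_ (Corelation.ofEquiv_comp _ _).symm
    refine Corelation.ofEquiv_congr fun x => ULift.ext _ _ (Fin.ext ?_)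
    rcases x with x | x
    · exact x.elim
    · exact (Nat.zero_add _).symm
  right_unitality n := by
    refine Eq.trans ?_ (congrArg₂ CategoryStruct.comp (Corelation.ofEquiv_tensor (Equiv.refl _) _)
      ((congrArg (CategoryStruct.comp _) (corelInclusion_eqHom (n := n ⊗ 𝟙_ _) (m := n)
        (Nat.add_zero n.val))).trans (Corelation.ofEquiv_comp _ _))).symm
    refine Eq.trans ?_ (Corelation.ofEquiv_comp _ _).symm
    refine Corelation.ofEquiv_congr fun x => ULift.ext _ _ (Fin.ext ?_)
    rcases x with x | x
    · rfl
    · exact x.elim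

instance : corelInclusion.{w}.Braided where
  toMonoidal := corelInclusionCore.toMonoidal
  braided n m := by
    refine (congrArg (CategoryStruct.comp _) (corelInclusion_ofEquiv _)).trans ?_
    refine (Corelation.ofEquiv_comp _ _).trans
      (Eq.trans ?_ (Corelation.ofEquiv_comp _ _).symm)
    refine Corelation.ofEquiv_congr fun x => ULift.ext _ _ ?_
    rcases x with x | x
    · exact congrArg (fun z => finSumFinEquiv (Sum.swap z))
        (finSumFinEquiv.symm_apply_apply (Sum.inl x.down))
    · exact congrArg (fun z => finSumFinEquiv (Sum.swap z))
        (finSumFinEquiv.symm_apply_apply (Sum.inr x.down))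

instance : corelInclusion.{w}.IsEquivalence where
  faithful := ⟨fun {n m} α β h => Corelation.ext_colors fun u v =>
    (colors_corelInclusion α (u ∘ Equiv.ulift) (v ∘ Equiv.ulift)).symm.trans
      ((iff_of_eq (congrArg (Corelation.Colors · _ _) h)).trans
        (colors_corelInclusion β (u ∘ Equiv.ulift) (v ∘ Equiv.ulift)))⟩
  full := ⟨fun {n m} α => by
    refine ⟨(Corelation.ofEquiv Equiv.ulift.symm).comp
      (Corelation.comp α (Corelation.ofEquiv Equiv.ulift)), Corelation.ext_colors fun u v => ?_⟩
    refine (colors_corelInclusion _ _ _).trans ?_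
    refine (LabelledWires.colors_label Equiv.ulift.symm Equiv.ulift.symm α _ _).trans ?_
    rfl⟩
  essSurj := ⟨fun X => by
    obtain ⟨n, ⟨e⟩⟩ := Finite.exists_equiv_fin X.carrier
    exact ⟨⟨n⟩, ⟨FinCorel.isoOfEquiv (Equiv.ulift.trans e.symm)⟩⟩⟩

theorem isSkeletonOf_corelInclusion :
    IsSkeletonOf FinCorel.{w} corelPROP.Obj corelInclusion where
  skel := by
    rintro ⟨n⟩ ⟨m⟩ ⟨e⟩
    exact congrArg PROP.Obj.mk (Corelation.eq_of_comp_eq_id e.hom_inv_id e.inv_hom_id)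

/-! ### Interpretation of terms -/

/-- The interpretation of terms in a prop. -/
def Term.interp {S : Signature.{w}} {P : PROPData.{w}} (g : ∀ {n m}, S n m → P.Hom n m) :
    ∀ {n m}, Term S n m → P.Hom n m
  | _, _, .id n => P.id n
  | _, _, .braid n m => P.braid n m
  | _, _, .gen σ => g σ
  | _, _, .comp s t => P.comp (s.interp g) (t.interp g)
  | _, _, .tensor s t => P.tensor (s.interp g) (t.interp g)

theorem Term.interp_eqHom {S : Signature.{w}} {P : PROPData.{w}} (g : ∀ {n m}, S n m → P.Hom n m)
    {n m : ℕ} (h : n = m) : Term.interp g ((Term.data S).eqHom h) = P.eqHom h := by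
  subst h; rfl

theorem SMTheory.Provable.interp_eq {T : SMTheory.{w}} {P : PROP.{w}}
    (g : ∀ {n m}, T.sig n m → P.Hom n m)
    (hg : ∀ {n m} {s t : Term T.sig n m}, T.eqn s t → s.interp @g = t.interp @g)
    {n m : ℕ} {s t : Term T.sig n m} (h : T.Provable s t) : s.interp @g = t.interp @g := by
  induction h with
  | eqn h => exact hg h
  | refl s => rfl
  | symm _ h => exact h.symm
  | trans _ _ h h' => exact h.trans h'
  | comp_congr _ _ h h' => exact congrArg₂ P.comp h h'
  | tensor_congr _ _ h h' => exact congrArg₂ P.tensor h h'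
  | id_comp f => exact P.id_comp _
  | comp_id f => exact P.comp_id _
  | assoc f g h => exact P.assoc _ _ _
  | tensor_id n m => exact P.tensor_id _ _
  | tensor_comp f g f' g' => exact P.tensor_comp _ _ _ _
  | tensor_assoc f g h =>
    simp only [Term.interp, Term.interp_eqHom]
    exact P.tensor_assoc _ _ _
  | unit_tensor f =>
    simp only [Term.interp, Term.interp_eqHom]
    exact P.unit_tensor _
  | tensor_unit f =>
    simp only [Term.interp, Term.interp_eqHom]
    exact P.tensor_unit _
  | braid_naturality f g => exact P.braid_naturality _ _
  | braid_braid n m => exact P.braid_braid _ _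
  | hexagon n m p =>
    simp only [Term.interp, Term.interp_eqHom]
    exact P.hexagon _ _ _

/-- The morphism out of a presented prop given by a model. -/
def SMTheory.lift {T : SMTheory.{w}} {P : PROP.{w}} (g : ∀ {n m}, T.sig n m → P.Hom n m)
    (hg : ∀ {n m} {s t : Term T.sig n m}, T.eqn s t → s.interp @g = t.interp @g) :
    T.prop ⟶ P where
  map := Quotient.lift (Term.interp @g) fun _ _ h => h.interp_eq @g @hg
  map_id _ := rfl
  map_comp := by rintro _ _ _ ⟨f⟩ ⟨g⟩; rfl
  map_tensor := by rintro _ _ _ _ ⟨f⟩ ⟨g⟩; rfl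
  map_braid _ _ := rfl

/-! ### The morphism to the prop of corelations -/

namespace Corelation

theorem colors_top {X Y : Type*} (u : X → Prop) (v : Y → Prop) :
    (⊤ : Corelation X Y).Colors u v ↔ ∃ q, (∀ x, u x ↔ q) ∧ ∀ y, v y ↔ q := by
  constructor
  · intro h
    by_cases hq : ∃ a, Sum.elim u v a
    · obtain ⟨a, ha⟩ := hq
      exact ⟨True, fun x => iff_true_intro ((h a (Sum.inl x) trivial).1 ha),
        fun y => iff_true_intro ((h a (Sum.inr y) trivial).1 ha)⟩
    · exact ⟨False, fun x => iff_false_intro fun hx => hq ⟨Sum.inl x, hx⟩,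
        fun y => iff_false_intro fun hy => hq ⟨Sum.inr y, hy⟩⟩
  · rintro ⟨q, hu, hv⟩ (a | a) (b | b) - <;> simp [hu, hv]

end Corelation

namespace ESCFMGen

open Corelation

/-- The interpretation of terms as corelations: each generator is sent to the corelation with
exactly one block. -/
abbrev eval {n m : ℕ} (t : Term ESCFMGen n m) : Corelation (Fin n) (Fin m) :=
  Term.interp (P := corelData) (fun {_ _} _ => (⊤ : Corelation _ _)) t

theorem colors_eval_comp {n m p : ℕ} (s : Term ESCFMGen n m) (t : Term ESCFMGen m p)
    (u : Fin n → Prop) (v : Fin p → Prop) :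
    (eval (s.comp t)).Colors u v ↔ ∃ w, (eval s).Colors u w ∧ (eval t).Colors w v :=
  Corelation.colors_comp _ _ _ _

theorem colors_eval_tensor {n m p q : ℕ} (s : Term ESCFMGen n m) (t : Term ESCFMGen p q)
    (u : Fin (n + p) → Prop) (v : Fin (m + q) → Prop) :
    (eval (s.tensor t)).Colors u v ↔
      (eval s).Colors (fun i => u (Fin.castAdd p i)) (fun i => v (Fin.castAdd q i)) ∧
        (eval t).Colors (fun i => u (Fin.natAdd n i)) (fun i => v (Fin.natAdd m i)) :=
  colors_finTensor _ _ _ _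

theorem colors_eval_id (n : ℕ) (u v : Fin n → Prop) :
    (eval (Term.id n)).Colors u v ↔ ∀ i, u i ↔ v i :=
  (Corelation.colors_id _ _).trans (funext_iff.trans (forall_congr' fun _ => eq_iff_iff))

theorem colors_eval_gen {n m : ℕ} (σ : ESCFMGen n m) (u : Fin n → Prop) (v : Fin m → Prop) :
    (eval (Term.gen σ)).Colors u v ↔ ∃ q, (∀ x, u x ↔ q) ∧ ∀ y, v y ↔ q :=
  colors_top _ _

theorem colors_eval_braid (u v : Fin 2 → Prop) :
    (eval (Term.braid 1 1)).Colors u v ↔ (u 0 ↔ v 1) ∧ (u 1 ↔ v 0) := by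
  refine (colors_ofEquiv _ _ _).trans (funext_iff.trans (Fin.forall_fin_two.trans ?_))
  rw [eq_iff_iff, eq_iff_iff]
  rfl

/-- An internal wire takes one of two colours, so quantifying over it is a finite disjunction. -/
theorem exists_prop_iff (P : Prop → Prop) : (∃ q, P q) ↔ P True ∨ P False :=
  ⟨fun ⟨q, h⟩ => (Classical.em q).imp (fun hq => eq_true hq ▸ h) fun hq => eq_false hq ▸ h,
    fun h => h.elim (fun h => ⟨_, h⟩) fun h => ⟨_, h⟩⟩

theorem cons_two {n : ℕ} (a : Prop) (w : Fin (n + 2) → Prop) :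
    Fin.cons (α := fun _ => Prop) a w 2 = w 1 := rfl

/-- Corelations are compared through their colourings: a generator forces its boundary to be
monochromatic, composition quantifies over internal colours, and each equation becomes a tautology.
-/
theorem eval_eq_of_eqn {n m : ℕ} {s t : Term ESCFMGen n m} (h : Eqn s t) : eval s = eval t := by
  refine ext_colors fun u v => ?_
  cases h <;>
  -- The arities are explicit because the equations are typed with numerals such as `3` where the
  -- lemma has `2 + 1`.
  simp only [colors_eval_comp, @colors_eval_tensor 2 1 1 1, @colors_eval_tensor 1 1 2 1,
    @colors_eval_tensor 0 1 1 1, @colors_eval_tensor 1 2 1 1, @colors_eval_tensor 1 1 1 2,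
    @colors_eval_tensor 1 0 1 1, colors_eval_id, colors_eval_gen,
    colors_eval_braid, Fin.exists_fin_succ_pi, Fin.exists_fin_zero_pi, Fin.forall_fin_succ,
    IsEmpty.forall_iff]
  all_goals simp [exists_prop_iff, Fin.reduceCastAdd, Fin.reduceNatAdd, cons_two]
  all_goals grind

theorem eval_eqHom {n m : ℕ} (h : n = m) :
    eval ((Term.data ESCFMGen).eqHom h) = ofEquiv (finCongr h) :=
  (Term.interp_eqHom _ h).trans (corelData_eqHom h)

/-! ### Every corelation is the interpretation of a term -/

theorem exists_eval_local (t : Term ESCFMGen 2 2) {n i : ℕ} (hi : i + 1 < n) :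
    ∃ t' : Term ESCFMGen n n, ∀ u v, (eval t').Colors u v ↔
      (∀ k : Fin n, k.val ≠ i → k.val ≠ i + 1 → (u k ↔ v k)) ∧
        (eval t).Colors ![u ⟨i, by omega⟩, u ⟨i + 1, hi⟩] ![v ⟨i, by omega⟩, v ⟨i + 1, hi⟩] := by
  obtain ⟨c, rfl⟩ : ∃ c, n = i + 2 + c := ⟨n - (i + 2), by omega⟩
  refine ⟨((Term.id i).tensor t).tensor (Term.id c), fun u v => ?_⟩
  simp only [colors_eval_tensor, colors_eval_id]
  have e : ∀ w : Fin (i + 2 + c) → Prop, (fun k => w (Fin.castAdd c (Fin.natAdd i k))) =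
      ![w ⟨i, by omega⟩, w ⟨i + 1, hi⟩] := fun w => by
    funext k
    fin_cases k <;> rfl
  rw [e, e]
  constructor
  · rintro ⟨⟨h1, h2⟩, h3⟩
    refine ⟨fun k => ?_, h2⟩
    induction k using Fin.addCases with
    | left k =>
      induction k using Fin.addCases with
      | left k => exact fun _ _ => h1 k
      | right k => intro h h'; fin_cases k <;> simp at h h'
    | right k => exact fun _ _ => h3 k
  · rintro ⟨h1, h2⟩
    exact ⟨⟨fun k => h1 _ (by simp; omega) (by simp; omega), h2⟩,
      fun k => h1 _ (by simp; omega) (by simp; omega)⟩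

theorem exists_eval_swap {n i : ℕ} (hi : i + 1 < n) :
    ∃ t : Term ESCFMGen n n, eval t = ofEquiv (Equiv.swap ⟨i, by omega⟩ ⟨i + 1, hi⟩) := by
  obtain ⟨t, ht⟩ := exists_eval_local (Term.braid 1 1) hi
  refine ⟨t, ext_colors fun u v => ?_⟩
  rw [ht, colors_eval_braid, colors_ofEquiv, funext_iff]
  constructor
  · rintro ⟨h1, h2, h3⟩ k
    by_cases hk : k = ⟨i, by omega⟩
    · subst hk
      simpa using h2
    by_cases hk' : k = ⟨i + 1, hi⟩
    · subst hk'
      simpa using h3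
    rw [Function.comp_apply, Equiv.swap_apply_of_ne_of_ne hk hk']
    exact propext (h1 k (fun h => hk (Fin.ext h)) fun h => hk' (Fin.ext h))
  · intro h
    refine ⟨fun k hk hk' => ?_, ?_, ?_⟩
    · rw [h, Function.comp_apply, Equiv.swap_apply_of_ne_of_ne (fun e => hk (congrArg Fin.val e))
        fun e => hk' (congrArg Fin.val e)]
    · simp [h]
    · simp [h]

theorem exists_eval_merge_of_lt {n i j : ℕ} (hij : i < j) (hj : j < n) :
    ∃ t : Term ESCFMGen n n, ∀ u v, (eval t).Colors u v ↔
      u = v ∧ (u ⟨i, by omega⟩ ↔ u ⟨j, hj⟩) := by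
  induction j, hij using Nat.le_induction with
  | base =>
    -- Multiplying and then comultiplying two adjacent wires puts all four ends into one block.
    obtain ⟨t, ht⟩ := exists_eval_local (μ.comp δ) hj
    refine ⟨t, fun u v => ?_⟩
    rw [ht, colors_eval_comp]
    simp only [colors_eval_gen, Fin.forall_fin_two]
    constructor
    · rintro ⟨h1, w, ⟨q, ⟨h2, h3⟩, h4⟩, ⟨q', h5, h6, h7⟩⟩
      have h8 := (h4 0).symm.trans (h5 0)
      refine ⟨funext fun k => propext ?_, h2.trans h3.symm⟩
      by_cases hk : k = ⟨i, by omega⟩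
      · subst hk
        exact h2.trans (h8.trans h6.symm)
      by_cases hk' : k = ⟨i + 1, hj⟩
      · subst hk'
        exact h3.trans (h8.trans h7.symm)
      exact h1 k (fun h => hk (Fin.ext h)) fun h => hk' (Fin.ext h)
    · rintro ⟨rfl, h⟩
      exact ⟨fun _ _ _ => Iff.rfl, fun _ => u ⟨i, by omega⟩, ⟨_, ⟨Iff.rfl, h.symm⟩, fun _ => Iff.rfl⟩,
        _, fun _ => Iff.rfl, Iff.rfl, h.symm⟩
  | succ j hij ih =>
    obtain ⟨t, ht⟩ := ih (by omega)
    -- Conjugation by the transposition of `j` and `j + 1` moves the merge of `i` with `j` to one of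
    -- `i` with `j + 1`.
    obtain ⟨s, hs⟩ := exists_eval_swap hj
    refine ⟨s.comp (t.comp s), fun u v => ?_⟩
    change (Corelation.comp (eval s) (Corelation.comp (eval t) (eval s))).Colors u v ↔ _
    rw [hs, colors_ofEquiv_comp, colors_comp_ofEquiv, ht, Equiv.symm_swap]
    refine and_congr ((Equiv.surjective _).injective_comp_right.eq_iff) ?_
    rw [Function.comp_apply, Function.comp_apply, Equiv.swap_apply_left,
      Equiv.swap_apply_of_ne_of_ne]
    · simp; omega
    · simp; omega

theorem exists_eval_merge {n : ℕ} (a b : Fin n) :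
    ∃ t : Term ESCFMGen n n, ∀ u v, (eval t).Colors u v ↔ u = v ∧ (u a ↔ u b) := by
  rcases lt_trichotomy a b with h | rfl | h
  · exact exists_eval_merge_of_lt h b.2
  · exact ⟨Term.id n, fun u v => (Corelation.colors_id _ _).trans (and_iff_left Iff.rfl).symm⟩
  · obtain ⟨t, ht⟩ := exists_eval_merge_of_lt h a.2
    exact ⟨t, fun u v => (ht u v).trans (and_congr_right' Iff.comm)⟩

theorem exists_eval_merge_finset {n : ℕ} (s : Finset (Fin n × Fin n)) :
    ∃ t : Term ESCFMGen n n, ∀ u v, (eval t).Colors u v ↔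
      u = v ∧ ∀ p ∈ s, (u p.1 ↔ u p.2) := by
  classical
  induction s using Finset.induction_on with
  | empty => exact ⟨Term.id n, fun u v => (Corelation.colors_id _ _).trans (by simp)⟩
  | insert p s _ ih =>
    obtain ⟨t, ht⟩ := ih
    obtain ⟨t', ht'⟩ := exists_eval_merge p.1 p.2
    refine ⟨t'.comp t, fun u v => ?_⟩
    simp only [colors_eval_comp, ht, ht', Finset.forall_mem_insert]
    constructor
    · rintro ⟨_, ⟨rfl, h⟩, rfl, h'⟩
      exact ⟨rfl, h, h'⟩
    · rintro ⟨rfl, h, h'⟩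
      exact ⟨_, ⟨rfl, h⟩, rfl, h'⟩

theorem exists_eval_discard (n : ℕ) :
    ∃ t : Term ESCFMGen n 0, ∀ u v, (eval t).Colors u v := by
  induction n with
  | zero => exact ⟨Term.id 0, fun u v => (colors_eval_id 0 u v).2 fun i => i.elim0⟩
  | succ n ih =>
    obtain ⟨t, ht⟩ := ih
    refine ⟨t.tensor ε, fun u v => (colors_eval_tensor t ε u v).2 ⟨ht _ _, ?_⟩⟩
    exact (colors_eval_gen _ _ _).2 ⟨u (Fin.natAdd n 0), fun x => by rw [Subsingleton.elim x 0],
      fun y => y.elim0⟩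

theorem exists_eval_create (n : ℕ) :
    ∃ t : Term ESCFMGen 0 n, ∀ u v, (eval t).Colors u v := by
  induction n with
  | zero => exact ⟨Term.id 0, fun u v => (colors_eval_id 0 u v).2 fun i => i.elim0⟩
  | succ n ih =>
    obtain ⟨t, ht⟩ := ih
    refine ⟨t.tensor η, fun u v => (colors_eval_tensor t η u v).2 ⟨ht _ _, ?_⟩⟩
    exact (colors_eval_gen _ _ _).2 ⟨v (Fin.natAdd n 0), fun y => y.elim0,
      fun x => by rw [Subsingleton.elim x 0]⟩

theorem eval_surjective {n m : ℕ} (α : Corelation (Fin n) (Fin m)) :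
    ∃ t : Term ESCFMGen n m, eval t = α := by
  classical
  obtain ⟨c, hc⟩ := exists_eval_create m
  obtain ⟨d, hd⟩ := exists_eval_discard n
  obtain ⟨t, ht⟩ := exists_eval_merge_finset (Finset.univ.filter fun p : Fin (n + m) × Fin (n + m) =>
    α (finSumFinEquiv.symm p.1) (finSumFinEquiv.symm p.2))
  -- Create the outputs beside the inputs, merge all related pairs among the `n + m` wires, discard
  -- the inputs. The source `n + 0` is `n` by computation, whereas the target `0 + m` needs an
  -- explicit identification.
  refine ⟨Term.comp (n := n + 0) ((Term.id n).tensor c) (t.comp ((d.tensor (Term.id m)).comp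
    ((Term.data ESCFMGen).eqHom (Nat.zero_add m)))), ext_colors fun u v => ?_⟩
  have e : ∀ w v, (eval ((d.tensor (Term.id m)).comp
      ((Term.data ESCFMGen).eqHom (Nat.zero_add m)))).Colors w v ↔
      ∀ i, w (Fin.natAdd n i) ↔ v i := fun w v => by
    change (Corelation.comp _ (eval _)).Colors w v ↔ _
    rw [eval_eqHom]
    refine (colors_comp_ofEquiv (finCongr (Nat.zero_add m)) (eval (d.tensor (Term.id m)))
      w v).trans ?_
    refine (colors_eval_tensor _ _ _ _).trans ((and_iff_right (hd _ _)).trans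
      ((colors_eval_id _ _ _).trans (forall_congr' fun i => ?_)))
    rw [Function.comp_apply]
    have : finCongr (Nat.zero_add m) (Fin.natAdd 0 i) = i := by ext; simp
    rw [this]
  have e' : ∀ u w, (eval ((Term.id n).tensor c)).Colors u w ↔
      ∀ i, u i ↔ w (Fin.castAdd m i) := fun u w => by
    refine (colors_eval_tensor _ _ _ _).trans ((and_iff_left (hc _ _)).trans
      (colors_eval_id _ _ _))
  refine (colors_eval_comp _ _ _ _).trans ?_
  simp only [colors_eval_comp, ht, e, e', Finset.mem_filter, Finset.mem_univ, true_and]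
  have key : ∀ w : Fin (n + m) → Prop, (∀ i, u i ↔ w (Fin.castAdd m i)) →
      (∀ i, w (Fin.natAdd n i) ↔ v i) → ∀ x, Sum.elim u v x ↔ w (finSumFinEquiv x) := by
    rintro w h h' (x | x)
    · exact h x
    · exact (h' x).symm
  constructor
  · rintro ⟨w, h, _, ⟨rfl, h'⟩, h''⟩ a b hab
    rw [key w h h'', key w h h'']
    exact h' (finSumFinEquiv a, finSumFinEquiv b) (by simpa using hab)
  · intro h
    refine ⟨Fin.append u v, by simp, _, ⟨rfl, fun p hp => ?_⟩, by simp⟩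
    have := h _ _ hp
    rwa [key (Fin.append u v) (by simp) (by simp), key (Fin.append u v) (by simp) (by simp),
      Equiv.apply_symm_apply, Equiv.apply_symm_apply] at this

end ESCFMGen

/-- The morphism of props that interprets terms as corelations. -/
def evalESCFM : ThESCFM ⟶ corelPROP :=
  SMTheory.lift (T := theoryESCFM) (P := corelPROP) (fun {_ _} _ => (⊤ : Corelation _ _))
    ESCFMGen.eval_eq_of_eqn

theorem evalESCFM_surjective {n m : ℕ} (α : corelPROP.Hom n m) :
    ∃ f : ThESCFM.Hom n m, PROP.Morphism.map evalESCFM f = α := by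
  obtain ⟨t, ht⟩ := ESCFMGen.eval_surjective α
  exact ⟨Quotient.mk _ t, ht⟩

section

open scoped MonObj ComonObj

variable {C : Type u} [Category.{v} C] [MonoidalCategory C] [SymmetricCategory C]

/-! ### Images of extraspecial commutative Frobenius monoids under symmetric monoidal functors -/

section

open Functor

variable {D : Type*} [Category* D] [MonoidalCategory D] [SymmetricCategory D]

/-- The inner structure maps of `F` cancel in inverse pairs, which gathers the whole composite under
`F`, where the Frobenius law can be applied. -/
theorem map_frobenius_left (F : D ⥤ C) [F.Monoidal] {X : D} (d : X ⟶ X ⊗ X) (m : X ⊗ X ⟶ X) :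
    (F.map d ≫ OplaxMonoidal.δ F X X) ▷ F.obj X ≫ (α_ _ _ _).hom ≫ F.obj X ◁ (LaxMonoidal.μ F X X ≫ F.map m) =
      LaxMonoidal.μ F X X ≫ F.map (d ▷ X ≫ (α_ _ _ _).hom ≫ X ◁ m) ≫ OplaxMonoidal.δ F X X := by
  rw [Functor.map_comp, Functor.map_comp, Monoidal.map_associator, Monoidal.map_whiskerLeft,
    Monoidal.map_whiskerRight]
  simp only [comp_whiskerRight, MonoidalCategory.whiskerLeft_comp, Category.assoc,
    Monoidal.μ_δ_assoc, Monoidal.μ_δ, Category.comp_id]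

theorem map_frobenius_right (F : D ⥤ C) [F.Monoidal] {X : D} (d : X ⟶ X ⊗ X) (m : X ⊗ X ⟶ X) :
    F.obj X ◁ (F.map d ≫ OplaxMonoidal.δ F X X) ≫ (α_ _ _ _).inv ≫ (LaxMonoidal.μ F X X ≫ F.map m) ▷ F.obj X =
      LaxMonoidal.μ F X X ≫ F.map (X ◁ d ≫ (α_ _ _ _).inv ≫ m ▷ X) ≫ OplaxMonoidal.δ F X X := by
  rw [Functor.map_comp, Functor.map_comp, Monoidal.map_associator_inv, Monoidal.map_whiskerLeft,
    Monoidal.map_whiskerRight]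
  simp only [comp_whiskerRight, MonoidalCategory.whiskerLeft_comp, Category.assoc,
    Monoidal.μ_δ_assoc, Monoidal.μ_δ, Category.comp_id]

/-- The image of an extraspecial commutative Frobenius monoid under a symmetric monoidal
functor. -/
def ESCFM.mapFunctor (F : D ⥤ C) [F.Braided] (A : ESCFM D) : ESCFM C where
  X := F.obj A.X
  mon := Functor.monObjObj (F := F) A.X
  comon := Functor.obj.instComonObj A.X F
  comm := by
    let := Functor.monObjObj (F := F) A.X
    exact Functor.isCommMonObj_obj
  cocomm := by
    let := Functor.obj.instComonObj A.X F
    refine ⟨?_⟩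
    change (F.map Δ[A.X] ≫ OplaxMonoidal.δ F A.X A.X) ≫ (β_ _ _).hom = F.map Δ[A.X] ≫ OplaxMonoidal.δ F A.X A.X
    conv_rhs => rw [← IsCommComonObj.comul_comm A.X, Functor.map_comp, Functor.map_braiding]
    simp
  frobenius_left := by
    refine (map_frobenius_left F _ _).trans ?_
    rw [A.frobenius_left, Functor.map_comp, ← Category.assoc, ← Category.assoc]
    rw [Category.assoc]
    rfl
  frobenius_right := by
    refine (map_frobenius_right F _ _).trans ?_
    rw [A.frobenius_right, Functor.map_comp, ← Category.assoc, ← Category.assoc]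
    rw [Category.assoc]
    rfl
  special := by
    change (F.map Δ[A.X] ≫ OplaxMonoidal.δ F A.X A.X) ≫ (LaxMonoidal.μ F A.X A.X ≫ F.map μ[A.X]) = _
    simp [← Functor.map_comp, A.special]
  extra := by
    change (LaxMonoidal.ε F ≫ F.map η[A.X]) ≫ (F.map ε[A.X] ≫ OplaxMonoidal.η F) = _
    simp [← Functor.map_comp_assoc, A.extra]

theorem app_tensor_δ {F G : D ⥤ C} [F.Monoidal] [G.Monoidal] (θ : F ⟶ G) [NatTrans.IsMonoidal θ]
    (X Y : D) : θ.app (X ⊗ Y) ≫ OplaxMonoidal.δ G X Y = OplaxMonoidal.δ F X Y ≫ (θ.app X ⊗ₘ θ.app Y) := by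
  rw [← cancel_epi (LaxMonoidal.μ F X Y), NatTrans.IsMonoidal.tensor_assoc]
  simp

theorem app_unit_η {F G : D ⥤ C} [F.Monoidal] [G.Monoidal] (θ : F ⟶ G) [NatTrans.IsMonoidal θ] :
    θ.app (𝟙_ D) ≫ OplaxMonoidal.η G = OplaxMonoidal.η F := by
  rw [← cancel_epi (LaxMonoidal.ε F), NatTrans.IsMonoidal.unit_assoc]
  simp

/-- The component of a monoidal natural transformation at an extraspecial commutative Frobenius
monoid. -/
def ESCFM.mapNatTrans (A : ESCFM D) {F G : D ⥤ C} [F.Braided] [G.Braided] (θ : F ⟶ G)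
    [NatTrans.IsMonoidal θ] : A.mapFunctor F ⟶ A.mapFunctor G where
  hom := θ.app A.X
  isMonHom :=
    { one_hom := by
        change (LaxMonoidal.ε F ≫ F.map η[A.X]) ≫ θ.app A.X = LaxMonoidal.ε G ≫ G.map η[A.X]
        rw [Category.assoc, θ.naturality, NatTrans.IsMonoidal.unit_assoc]
      mul_hom := by
        change (LaxMonoidal.μ F A.X A.X ≫ F.map μ[A.X]) ≫ θ.app A.X =
          (θ.app A.X ⊗ₘ θ.app A.X) ≫ LaxMonoidal.μ G A.X A.X ≫ G.map μ[A.X]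
        rw [Category.assoc, θ.naturality, NatTrans.IsMonoidal.tensor_assoc] }
  isComonHom :=
    { hom_counit := by
        change θ.app A.X ≫ G.map ε[A.X] ≫ OplaxMonoidal.η G = F.map ε[A.X] ≫ OplaxMonoidal.η F
        rw [← θ.naturality_assoc, app_unit_η]
      hom_comul := by
        change θ.app A.X ≫ G.map Δ[A.X] ≫ OplaxMonoidal.δ G A.X A.X =
          (F.map Δ[A.X] ≫ OplaxMonoidal.δ F A.X A.X) ≫ (θ.app A.X ⊗ₘ θ.app A.X)
        rw [← θ.naturality_assoc, app_tensor_δ, Category.assoc] }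

/-- Evaluation of symmetric monoidal functors at an extraspecial commutative Frobenius monoid. -/
def ESCFM.evaluation (A : ESCFM D) : SymMonFunctor D C ⥤ ESCFM C where
  obj F := A.mapFunctor F.functor
  map θ := by
    have := θ.isMonoidal
    exact A.mapNatTrans θ.hom

end

/-! ### The generic extraspecial commutative Frobenius monoid -/

/-- An extraspecial commutative Frobenius monoid from operations on an object. -/
def ESCFM.ofOperations {X : C} (m : X ⊗ X ⟶ X) (e : 𝟙_ C ⟶ X) (d : X ⟶ X ⊗ X) (c : X ⟶ 𝟙_ C)
    (mul_assoc : m ▷ X ≫ m = (α_ X X X).hom ≫ X ◁ m ≫ m)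
    (unit_mul : e ▷ X ≫ m = (λ_ X).hom)
    (mul_comm : (β_ X X).hom ≫ m = m)
    (comul_assoc : d ≫ X ◁ d = d ≫ d ▷ X ≫ (α_ X X X).hom)
    (counit_comul : d ≫ c ▷ X = (λ_ X).inv)
    (comul_comm : d ≫ (β_ X X).hom = d)
    (frobenius_left : d ▷ X ≫ (α_ X X X).hom ≫ X ◁ m = m ≫ d)
    (frobenius_right : X ◁ d ≫ (α_ X X X).inv ≫ m ▷ X = m ≫ d)
    (special : d ≫ m = 𝟙 X) (extra : e ≫ c = 𝟙 (𝟙_ C)) : ESCFM C where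
  X := X
  mon :=
    { mul := m
      one := e
      one_mul := unit_mul
      mul_one := by
        rw [← mul_comm, BraidedCategory.braiding_naturality_right_assoc, unit_mul,
          braiding_leftUnitor]
      mul_assoc := mul_assoc }
  comon :=
    { comul := d
      counit := c
      counit_comul := counit_comul
      comul_counit := by
        rw [← comul_comm, Category.assoc, ← BraidedCategory.braiding_naturality_left,
          reassoc_of% counit_comul, leftUnitor_inv_braiding]
      comul_assoc := comul_assoc }
  comm := @IsCommMonObj.mk _ _ _ _ _ (_) mul_comm
  cocomm := @IsCommComonObj.mk _ _ _ _ _ (_) comul_comm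
  frobenius_left := frobenius_left
  frobenius_right := frobenius_right
  special := special
  extra := extra

namespace ThESCFM

theorem sound {n m : ℕ} {s t : Term ESCFMGen n m} (h : ESCFMGen.Eqn s t) :
    (Quotient.mk (theoryESCFM.setoid n m) s : ThESCFM.Hom n m) =
      Quotient.mk (theoryESCFM.setoid n m) t :=
  Quotient.sound (SMTheory.Provable.eqn h)

/-- The generic extraspecial commutative Frobenius monoid. -/
def generic : ESCFM ThESCFM.Obj :=
  ESCFM.ofOperations (X := ⟨1⟩) (theoryESCFM.gen ESCFMGen.mul) (theoryESCFM.gen ESCFMGen.unit)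
    (theoryESCFM.gen ESCFMGen.comul) (theoryESCFM.gen ESCFMGen.counit)
    -- The associator at 1, 1, 1 is an identity, since both bracketings compute to 3; the equations
    -- of the theory omit it.
    ((sound ESCFMGen.Eqn.mul_assoc).trans (ThESCFM.id_comp _).symm)
    (sound ESCFMGen.Eqn.unit_mul)
    (sound ESCFMGen.Eqn.mul_comm)
    ((sound ESCFMGen.Eqn.comul_assoc).symm.trans
      (congrArg (ThESCFM.comp (theoryESCFM.gen ESCFMGen.comul)) (ThESCFM.comp_id
        (ThESCFM.tensor (theoryESCFM.gen ESCFMGen.comul) (ThESCFM.id 1))).symm))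
    (sound ESCFMGen.Eqn.counit_comul)
    (sound ESCFMGen.Eqn.comul_comm)
    ((congrArg (ThESCFM.comp _) (ThESCFM.id_comp _)).trans (sound ESCFMGen.Eqn.frobenius_left))
    ((congrArg (ThESCFM.comp _) (ThESCFM.id_comp _)).trans (sound ESCFMGen.Eqn.frobenius_right))
    (sound ESCFMGen.Eqn.special)
    (sound ESCFMGen.Eqn.extra)

end ThESCFM

/-! ### Functors out of the presented prop are determined by the image of the generic monoid -/

namespace ThESCFM

section

open Functor

variable {F G : ThESCFM.Obj ⥤ C}

theorem whiskerLeft_ε_μ (F : ThESCFM.Obj ⥤ C) [F.LaxMonoidal] (n : ℕ) :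
    F.obj ⟨n⟩ ◁ LaxMonoidal.ε F ≫ LaxMonoidal.μ F ⟨n⟩ ⟨0⟩ = (ρ_ (F.obj ⟨n⟩)).hom := by
  refine Eq.trans ?_ (LaxMonoidal.right_unitality F ⟨n⟩).symm
  refine congrArg (CategoryStruct.comp _) ?_
  refine (Category.comp_id _).symm.trans (congrArg (CategoryStruct.comp _) ?_)
  exact (F.map_id _).symm

theorem whiskerLeft_μ_μ (F : ThESCFM.Obj ⥤ C) [F.LaxMonoidal] (n m p : ℕ) :
    F.obj ⟨n⟩ ◁ LaxMonoidal.μ F ⟨m⟩ ⟨p⟩ ≫ LaxMonoidal.μ F ⟨n⟩ ⟨m + p⟩ ≫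
      F.map (ThESCFM.eqHom (Nat.add_assoc n m p).symm) =
    (α_ _ _ _).inv ≫ LaxMonoidal.μ F ⟨n⟩ ⟨m⟩ ▷ F.obj ⟨p⟩ ≫ LaxMonoidal.μ F ⟨n + m⟩ ⟨p⟩ :=
  LaxMonoidal.associativity_inv F ⟨n⟩ ⟨m⟩ ⟨p⟩

/-- With last summand 1 both bracketings agree by computation, so the associator of the prop
disappears. This is why the inductions below split off a wire on the right. -/
theorem whiskerLeft_μ_μ_one (F : ThESCFM.Obj ⥤ C) [F.LaxMonoidal] (n m : ℕ) :
    F.obj ⟨n⟩ ◁ LaxMonoidal.μ F ⟨m⟩ ⟨1⟩ ≫ LaxMonoidal.μ F ⟨n⟩ ⟨m + 1⟩ =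
    (α_ _ _ _).inv ≫ LaxMonoidal.μ F ⟨n⟩ ⟨m⟩ ▷ F.obj ⟨1⟩ ≫ LaxMonoidal.μ F ⟨n + m⟩ ⟨1⟩ := by
  refine Eq.trans ?_ (whiskerLeft_μ_μ F n m 1)
  refine congrArg (CategoryStruct.comp _) ?_
  refine (Category.comp_id _).symm.trans (congrArg (CategoryStruct.comp _) ?_)
  exact (F.map_id _).symm

variable [F.Braided] [G.Braided]

/-- Every object is an iterated tensor product of the object 1, and the structure maps of `F` are
invertible, so monoidality forces all components. -/
theorem hom_ext {θ θ' : F ⟶ G} [NatTrans.IsMonoidal θ] [NatTrans.IsMonoidal θ']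
    (h : θ.app ⟨1⟩ = θ'.app ⟨1⟩) : θ = θ' := by
  ext ⟨n⟩
  induction n with
  | zero =>
    have e := (NatTrans.IsMonoidal.unit (τ := θ)).trans (NatTrans.IsMonoidal.unit (τ := θ')).symm
    exact (cancel_epi _).1 e
  | succ n ih =>
    have e := NatTrans.IsMonoidal.tensor (τ := θ) ⟨n⟩ ⟨1⟩
    rw [ih, h, ← NatTrans.IsMonoidal.tensor (τ := θ') ⟨n⟩ ⟨1⟩] at e
    exact (cancel_epi _).1 e

/-- The component at `n` of the natural transformation extending a morphism `f`. -/
def extendApp (f : F.obj ⟨1⟩ ⟶ G.obj ⟨1⟩) : ∀ n : ℕ, F.obj ⟨n⟩ ⟶ G.obj ⟨n⟩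
  | 0 => OplaxMonoidal.η F ≫ LaxMonoidal.ε G
  | n + 1 => OplaxMonoidal.δ F ⟨n⟩ ⟨1⟩ ≫ (extendApp f n ⊗ₘ f) ≫ LaxMonoidal.μ G ⟨n⟩ ⟨1⟩

variable (f : F.obj ⟨1⟩ ⟶ G.obj ⟨1⟩)

theorem extendApp_zero : LaxMonoidal.ε F ≫ extendApp f 0 = LaxMonoidal.ε G :=
  Monoidal.ε_η_assoc F _

theorem extendApp_succ (n : ℕ) : LaxMonoidal.μ F ⟨n⟩ ⟨1⟩ ≫ extendApp f (n + 1) =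
    (extendApp f n ⊗ₘ f) ≫ LaxMonoidal.μ G ⟨n⟩ ⟨1⟩ :=
  Monoidal.μ_δ_assoc F _ _ _

theorem extendApp_tensor (n m : ℕ) : LaxMonoidal.μ F ⟨n⟩ ⟨m⟩ ≫ extendApp f (n + m) =
    (extendApp f n ⊗ₘ extendApp f m) ≫ LaxMonoidal.μ G ⟨n⟩ ⟨m⟩ := by
  induction m with
  | zero =>
    have key : F.obj ⟨n⟩ ◁ LaxMonoidal.ε F ≫ LaxMonoidal.μ F ⟨n⟩ ⟨0⟩ ≫ extendApp f n =
        F.obj ⟨n⟩ ◁ LaxMonoidal.ε F ≫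
          (extendApp f n ⊗ₘ extendApp f 0) ≫ LaxMonoidal.μ G ⟨n⟩ ⟨0⟩ := by
      rw [reassoc_of% whiskerLeft_ε_μ F n, MonoidalCategory.tensorHom_def', Category.assoc,
        ← MonoidalCategory.whiskerLeft_comp_assoc, extendApp_zero, whisker_exchange_assoc,
        whiskerLeft_ε_μ]
      exact (MonoidalCategory.rightUnitor_naturality _).symm
    -- The equation has been precomposed with an invertible structure map of `F`, which turns it
    -- into an instance of unitality; the map is now cancelled.
    exact (cancel_epi _).1 key
  | succ m ih =>
    have key : F.obj ⟨n⟩ ◁ LaxMonoidal.μ F ⟨m⟩ ⟨1⟩ ≫ LaxMonoidal.μ F ⟨n⟩ ⟨m + 1⟩ ≫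
        extendApp f (n + m + 1) = F.obj ⟨n⟩ ◁ LaxMonoidal.μ F ⟨m⟩ ⟨1⟩ ≫
          (extendApp f n ⊗ₘ extendApp f (m + 1)) ≫ LaxMonoidal.μ G ⟨n⟩ ⟨m + 1⟩ := by
      rw [reassoc_of% whiskerLeft_μ_μ_one F n m]
      refine (congrArg (fun g => _ ≫ _ ≫ g) (extendApp_succ f (n + m))).trans ?_
      rw [← id_tensorHom, tensorHom_comp_tensorHom_assoc, extendApp_succ, Category.id_comp,
        ← tensorHom_id, tensorHom_comp_tensorHom_assoc, ih, Category.id_comp,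
        ← Category.comp_id (extendApp f n), ← tensorHom_comp_tensorHom_assoc, id_tensorHom]
      rw [whiskerLeft_μ_μ_one G n m, associator_inv_naturality_assoc, Category.comp_id]
      refine congrArg (CategoryStruct.comp _) ?_
      rw [← tensorHom_id, tensorHom_comp_tensorHom_assoc, Category.comp_id]
    exact (cancel_epi _).1 key

/-- The recursion starts at the unit object, so at 1 it yields `f` tensored with the comparison of
units; left unitality of both functors removes the latter. -/
theorem extendApp_one : extendApp f 1 = f := by
  have hF : LaxMonoidal.ε F ▷ F.obj ⟨1⟩ ≫ LaxMonoidal.μ F ⟨0⟩ ⟨1⟩ = (λ_ (F.obj ⟨1⟩)).hom := by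
    refine Eq.trans ?_ (LaxMonoidal.left_unitality F ⟨1⟩).symm
    refine congrArg (CategoryStruct.comp _) ?_
    refine (Category.comp_id _).symm.trans (congrArg (CategoryStruct.comp _) ?_)
    exact (F.map_id _).symm
  have hG : LaxMonoidal.ε G ▷ G.obj ⟨1⟩ ≫ LaxMonoidal.μ G ⟨0⟩ ⟨1⟩ = (λ_ (G.obj ⟨1⟩)).hom := by
    refine Eq.trans ?_ (LaxMonoidal.left_unitality G ⟨1⟩).symm
    refine congrArg (CategoryStruct.comp _) ?_
    refine (Category.comp_id _).symm.trans (congrArg (CategoryStruct.comp _) ?_)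
    exact (G.map_id _).symm
  have key : LaxMonoidal.ε F ▷ F.obj ⟨1⟩ ≫ LaxMonoidal.μ F ⟨0⟩ ⟨1⟩ ≫ extendApp f (0 + 1) =
      LaxMonoidal.ε F ▷ F.obj ⟨1⟩ ≫ LaxMonoidal.μ F ⟨0⟩ ⟨1⟩ ≫ f := by
    rw [extendApp_succ, reassoc_of% hF, MonoidalCategory.tensorHom_def, Category.assoc,
      ← MonoidalCategory.comp_whiskerRight_assoc, extendApp_zero, ← whisker_exchange_assoc, hG]
    exact MonoidalCategory.leftUnitor_naturality _
  exact (cancel_epi _).1 ((cancel_epi _).1 key)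

/-- The morphism given by a term. -/
abbrev ofTerm {n m : ℕ} (t : Term ESCFMGen n m) : (⟨n⟩ : ThESCFM.Obj) ⟶ ⟨m⟩ :=
  (Quotient.mk (theoryESCFM.setoid n m) t : ThESCFM.Hom n m)

/-- Naturality squares are closed under composition and tensor product and hold for braidings since
both functors are braided, so by induction on terms only the generators matter; for these the square
is the corresponding hypothesis. -/
theorem extendApp_naturality
    (hmul : (LaxMonoidal.μ F ⟨1⟩ ⟨1⟩ ≫ F.map (ofTerm ESCFMGen.μ)) ≫ f =
      (f ⊗ₘ f) ≫ LaxMonoidal.μ G ⟨1⟩ ⟨1⟩ ≫ G.map (ofTerm ESCFMGen.μ))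
    (hone : (LaxMonoidal.ε F ≫ F.map (ofTerm ESCFMGen.η)) ≫ f =
      LaxMonoidal.ε G ≫ G.map (ofTerm ESCFMGen.η))
    (hcomul : f ≫ G.map (ofTerm ESCFMGen.δ) ≫ OplaxMonoidal.δ G ⟨1⟩ ⟨1⟩ =
      (F.map (ofTerm ESCFMGen.δ) ≫ OplaxMonoidal.δ F ⟨1⟩ ⟨1⟩) ≫ (f ⊗ₘ f))
    (hcounit : f ≫ G.map (ofTerm ESCFMGen.ε) ≫ OplaxMonoidal.η G =
      F.map (ofTerm ESCFMGen.ε) ≫ OplaxMonoidal.η F) {n m : ℕ} (t : Term ESCFMGen n m) :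
    F.map (ofTerm t) ≫ extendApp f m = extendApp f n ≫ G.map (ofTerm t) := by
  induction t with
  | id n =>
    refine (congrArg (· ≫ _) (F.map_id _)).trans (Eq.trans ?_
      (congrArg (CategoryStruct.comp _) (G.map_id _)).symm)
    exact (Category.id_comp _).trans (Category.comp_id _).symm
  | braid n m =>
    rw [← cancel_epi (LaxMonoidal.μ F ⟨n⟩ ⟨m⟩)]
    have hF : LaxMonoidal.μ F ⟨n⟩ ⟨m⟩ ≫ F.map (ofTerm (Term.braid n m)) =
      (β_ _ _).hom ≫ LaxMonoidal.μ F ⟨m⟩ ⟨n⟩ :=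
        LaxBraided.braided (F := F) (⟨n⟩ : ThESCFM.Obj) ⟨m⟩
    have hG : LaxMonoidal.μ G ⟨n⟩ ⟨m⟩ ≫ G.map (ofTerm (Term.braid n m)) =
      (β_ _ _).hom ≫ LaxMonoidal.μ G ⟨m⟩ ⟨n⟩ :=
        LaxBraided.braided (F := G) (⟨n⟩ : ThESCFM.Obj) ⟨m⟩
    rw [reassoc_of% hF, extendApp_tensor, reassoc_of% extendApp_tensor f n m, hG,
      BraidedCategory.braiding_naturality_assoc]
  | gen σ =>
    cases σ with
    | mul =>
      have h' := extendApp_tensor f 1 1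
      rw [extendApp_one] at h' ⊢
      refine (cancel_epi (LaxMonoidal.μ F ⟨1⟩ ⟨1⟩)).1 ?_
      refine (Category.assoc _ _ _).symm.trans (hmul.trans ?_)
      refine (Category.assoc _ _ _).symm.trans ?_
      exact (congrArg (· ≫ _) h'.symm).trans (Category.assoc _ _ _)
    | unit =>
      rw [extendApp_one]
      refine (cancel_epi (LaxMonoidal.ε F)).1 ?_
      refine (Category.assoc _ _ _).symm.trans (hone.trans ?_)
      exact (congrArg (· ≫ _) (extendApp_zero f).symm).trans (Category.assoc _ _ _)
    | comul =>
      have h' : extendApp f 2 ≫ OplaxMonoidal.δ G ⟨1⟩ ⟨1⟩ =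
          OplaxMonoidal.δ F ⟨1⟩ ⟨1⟩ ≫ (f ⊗ₘ f) := by
        refine (cancel_epi (LaxMonoidal.μ F ⟨1⟩ ⟨1⟩)).1 ?_
        rw [Monoidal.μ_δ_assoc]
        refine (Category.assoc _ _ _).symm.trans ((congrArg (· ≫ _)
          (extendApp_tensor f 1 1)).trans ?_)
        rw [Category.assoc, extendApp_one]
        exact (congrArg (CategoryStruct.comp _) (Monoidal.μ_δ G _ _)).trans (Category.comp_id _)
      rw [extendApp_one]
      refine (cancel_mono (OplaxMonoidal.δ G ⟨1⟩ ⟨1⟩)).1 ?_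
      refine (Category.assoc _ _ _).trans ((congrArg (CategoryStruct.comp _) h').trans ?_)
      exact (Category.assoc _ _ _).symm.trans (hcomul.symm.trans (Category.assoc _ _ _).symm)
    | counit =>
      rw [extendApp_one]
      refine (cancel_mono (OplaxMonoidal.η G)).1 ?_
      refine Eq.trans ?_ (hcounit.symm.trans (Category.assoc _ _ _).symm)
      refine (Category.assoc _ _ _).trans (congrArg (CategoryStruct.comp _) ?_)
      exact (Category.assoc _ _ _).trans ((congrArg (CategoryStruct.comp _)
        (Monoidal.ε_η G)).trans (Category.comp_id _))
  | comp s t hs ht =>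
    have hF : F.map (ofTerm (s.comp t)) = F.map (ofTerm s) ≫ F.map (ofTerm t) :=
      F.map_comp (ofTerm s) (ofTerm t)
    have hG : G.map (ofTerm (s.comp t)) = G.map (ofTerm s) ≫ G.map (ofTerm t) :=
      G.map_comp (ofTerm s) (ofTerm t)
    rw [hF, hG, Category.assoc, ht, reassoc_of% hs]
  | @tensor n m p q s t hs ht =>
    rw [← cancel_epi (LaxMonoidal.μ F ⟨n⟩ ⟨p⟩)]
    have hF : LaxMonoidal.μ F ⟨n⟩ ⟨p⟩ ≫ F.map (ofTerm (s.tensor t)) =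
        (F.map (ofTerm s) ⊗ₘ F.map (ofTerm t)) ≫ LaxMonoidal.μ F ⟨m⟩ ⟨q⟩ :=
      (LaxMonoidal.μ_natural F (ofTerm s) (ofTerm t)).symm
    have hG : LaxMonoidal.μ G ⟨n⟩ ⟨p⟩ ≫ G.map (ofTerm (s.tensor t)) =
        (G.map (ofTerm s) ⊗ₘ G.map (ofTerm t)) ≫ LaxMonoidal.μ G ⟨m⟩ ⟨q⟩ :=
      (LaxMonoidal.μ_natural G (ofTerm s) (ofTerm t)).symm
    rw [reassoc_of% hF, extendApp_tensor, reassoc_of% extendApp_tensor f n p, hG,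
      tensorHom_comp_tensorHom_assoc, tensorHom_comp_tensorHom_assoc, hs, ht]

/-- The natural transformation extending a morphism between the images of the generic monoid. -/
def extend (f : generic.mapFunctor F ⟶ generic.mapFunctor G) : F ⟶ G where
  app n := extendApp f.hom n.val
  naturality := by
    rintro ⟨n⟩ ⟨m⟩ ⟨t⟩
    exact extendApp_naturality f.hom f.isMonHom.mul_hom f.isMonHom.one_hom
      f.isComonHom.hom_comul f.isComonHom.hom_counit t

theorem isMonoidal_extend (f : generic.mapFunctor F ⟶ generic.mapFunctor G) :
    NatTrans.IsMonoidal (extend f) where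
  unit := extendApp_zero f.hom
  tensor n m := extendApp_tensor f.hom n.val m.val

instance : (generic.evaluation (C := C)).Faithful where
  map_injective {F G} θ θ' h := by
    have := θ.isMonoidal
    have := θ'.isMonoidal
    exact SymMonFunctor.Hom.ext (hom_ext (congrArg ESCFM.Hom.hom h))

instance : (generic.evaluation (C := C)).Full where
  map_surjective {F G} f :=
    ⟨⟨extend (F := F.functor) (G := G.functor) f, isMonoidal_extend f⟩,
      ESCFM.Hom.ext (extendApp_one (F := F.functor) (G := G.functor) f.hom)⟩

end

end ThESCFM

/-! ### Every extraspecial commutative Frobenius monoid is the image of the generic one -/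

namespace Corelation

variable {X Y Z : Type*}

theorem ofEquiv_comp_top (e : X ≃ Y) : (ofEquiv e).comp (⊤ : Corelation Y Z) = ⊤ := by
  refine ext_colors fun u v => ?_
  rw [colors_ofEquiv_comp, colors_top, colors_top]
  simp only [Function.comp_apply, e.symm.forall_congr_left, Equiv.symm_symm, Equiv.symm_apply_apply]

theorem top_comp_ofEquiv (e : Y ≃ Z) : (⊤ : Corelation X Y).comp (ofEquiv e) = ⊤ := by
  refine ext_colors fun u v => ?_
  rw [colors_comp_ofEquiv, colors_top, colors_top]
  simp only [Function.comp_apply, e.forall_congr_left, Equiv.apply_symm_apply]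

end Corelation

namespace LabelledWires

variable {A : ESCFM C} {X Y : FinCorel.{w}}

theorem map_top (P : LabelledWires A X) (Q : LabelledWires A Y) :
    P.map Q (⊤ : Corelation X.carrier Y.carrier) = P.wires.map Q.wires ⊤ :=
  congrArg _ ((congrArg (Corelation.comp _) (Corelation.top_comp_ofEquiv _)).trans
    (Corelation.ofEquiv_comp_top _))

end LabelledWires

namespace ESCFM

open LabelledWires

variable (A : ESCFM C)

/-- The symmetric monoidal functor out of the presented prop determined by an extraspecial
commutative Frobenius monoid. -/
noncomputable abbrev modelFunctor : ThESCFM.Obj ⥤ C :=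
  PROP.functor evalESCFM ⋙ corelInclusion.{w} ⋙ corelFunctor.{w} A

/-- The set with one element. -/
abbrev point : FinCorel.{w} := corelInclusion.obj ⟨1⟩

instance : Unique point.{w}.carrier := inferInstanceAs (Unique (ULift (Fin 1)))

theorem corelInclusion_top {n m : corelPROP.Obj} :
    corelInclusion.{w}.map (X := n) (Y := m) (⊤ : Corelation (Fin n.val) (Fin m.val)) =
      (⊤ : Corelation (ULift.{w} (Fin n.val)) (ULift.{w} (Fin m.val))) :=
  (congrArg (Corelation.comp _) (Corelation.top_comp_ofEquiv _)).trans
    (Corelation.ofEquiv_comp_top _)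

/-- The structure maps of the composite functor are all images of corelations under
`LabelledWires.map`, so the operation collapses to the image of one composite; the bijections in it
leave the one-block corelation unchanged. -/
theorem modelFunctor_mul : μ[(ThESCFM.generic.mapFunctor (modelFunctor.{w} A)).X] =
    ((choice A point.{w}).tensor (choice A point)).map (choice A point)
      (⊤ : Corelation (point.carrier ⊕ point.carrier) point.carrier) := by
  refine (congrArg₂ CategoryStruct.comp ((congrArg₂ CategoryStruct.comp
    (map_comp _ _ _ _ _).symm rfl).trans (map_comp _ _ _ _ _).symm) rfl).trans ((map_comp _ _ _ _ _).symm.trans (congrArg _ ?_))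
  refine (congrArg₂ CategoryStruct.comp ((congrArg₂ CategoryStruct.comp (Category.id_comp _)
    (corelInclusion.map_id _)).trans (Category.comp_id _)) corelInclusion_top).trans
      (Corelation.ofEquiv_comp_top _)

theorem modelFunctor_one : η[(ThESCFM.generic.mapFunctor (modelFunctor.{w} A)).X] =
    (nil A).map (choice A point.{w}) (⊤ : Corelation PEmpty point.carrier) := by
  refine (congrArg₂ CategoryStruct.comp ((congrArg₂ CategoryStruct.comp
    (map_comp _ _ _ _ _).symm rfl).trans (map_comp _ _ _ _ _).symm) rfl).trans ((map_comp _ _ _ _ _).symm.trans (congrArg _ ?_))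
  refine (congrArg₂ CategoryStruct.comp ((congrArg₂ CategoryStruct.comp (Category.id_comp _)
    (corelInclusion.map_id _)).trans (Category.comp_id _)) corelInclusion_top).trans
      (Corelation.ofEquiv_comp_top _)

theorem modelFunctor_comul : Δ[(ThESCFM.generic.mapFunctor (modelFunctor.{w} A)).X] =
    (choice A point.{w}).map ((choice A point).tensor (choice A point))
      (⊤ : Corelation point.carrier (point.carrier ⊕ point.carrier)) := by
  refine (congrArg (CategoryStruct.comp _) ((congrArg (CategoryStruct.comp _)
    (map_comp _ _ _ _ _).symm).trans (map_comp _ _ _ _ _).symm)).trans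
      ((map_comp _ _ _ _ _).symm.trans (congrArg _ ?_))
  refine (congrArg₂ CategoryStruct.comp corelInclusion_top ((congrArg₂ CategoryStruct.comp
    (corelInclusion.map_id _) (Category.comp_id _)).trans (Category.id_comp _))).trans
      (Corelation.top_comp_ofEquiv _)

theorem modelFunctor_counit : ε[(ThESCFM.generic.mapFunctor (modelFunctor.{w} A)).X] =
    (choice A point.{w}).map (nil A) (⊤ : Corelation point.carrier PEmpty) := by
  refine (congrArg (CategoryStruct.comp _) ((congrArg (CategoryStruct.comp _)
    (map_comp _ _ _ _ _).symm).trans (map_comp _ _ _ _ _).symm)).trans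
      ((map_comp _ _ _ _ _).symm.trans (congrArg _ ?_))
  refine (congrArg₂ CategoryStruct.comp corelInclusion_top ((congrArg₂ CategoryStruct.comp
    (corelInclusion.map_id _) (Category.comp_id _)).trans (Category.id_comp _))).trans
      (Corelation.top_comp_ofEquiv _)

/-- The underlying isomorphism of `modelIso`. -/
noncomputable abbrev modelIsoX : (modelFunctor.{w} A).obj ⟨1⟩ ≅ A.X :=
  (choice A point.{w}).iso (single A point)

theorem modelIsoX_tensor : ((choice A point.{w}).tensor (choice A point)).map
    ((single A point).tensor (single A point)) (𝟙 point ⊗ₘ 𝟙 point) =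
      (modelIsoX.{w} A).hom ⊗ₘ (modelIsoX.{w} A).hom :=
  map_tensor _ _ _ _ _ _

/-- Both sides are the image of the one-block corelation, with the chosen family of wires on the
source and a single wire on the target; `Wires.map_mul` recognises the multiplication. -/
theorem modelIsoX_mul : μ[(ThESCFM.generic.mapFunctor (modelFunctor.{w} A)).X] ≫
    (modelIsoX.{w} A).hom = ((modelIsoX.{w} A).hom ⊗ₘ (modelIsoX.{w} A).hom) ≫ μ[A.X] := by
  have h : ((single A point.{w}).tensor (single A point)).map (single A point)
      (⊤ : Corelation (point.carrier ⊕ point.carrier) point.carrier) = μ[A.X] :=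
    (map_top _ _).trans Wires.map_mul
  refine (congrArg (· ≫ _) (modelFunctor_mul A)).trans ?_
  refine Eq.trans ?_ (congrArg₂ CategoryStruct.comp (modelIsoX_tensor A) h)
  refine (map_comp _ _ _ _ _).symm.trans (Eq.trans (congrArg _ ?_) (map_comp _ _ _ _ _))
  rw [id_tensorHom_id, Category.id_comp, Category.comp_id]

theorem modelIsoX_one : η[(ThESCFM.generic.mapFunctor (modelFunctor.{w} A)).X] ≫
    (modelIsoX.{w} A).hom = η[A.X] := by
  refine (congrArg (· ≫ _) (modelFunctor_one A)).trans ?_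
  refine (map_comp _ _ _ _ _).symm.trans ((congrArg _ (Category.comp_id _)).trans ?_)
  exact (map_top _ _).trans Wires.map_unit

theorem modelIsoX_comul : (modelIsoX.{w} A).hom ≫ Δ[A.X] =
    Δ[(ThESCFM.generic.mapFunctor (modelFunctor.{w} A)).X] ≫
      ((modelIsoX.{w} A).hom ⊗ₘ (modelIsoX.{w} A).hom) := by
  have h : (single A point.{w}).map ((single A point.{w}).tensor (single A point))
      (⊤ : Corelation point.carrier (point.carrier ⊕ point.carrier)) = Δ[A.X] :=
    (map_top _ _).trans Wires.map_comul
  refine Eq.trans ?_ (congrArg₂ CategoryStruct.comp (modelFunctor_comul A)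
    (modelIsoX_tensor A).symm).symm
  refine (congrArg (CategoryStruct.comp _) h.symm).trans ?_
  refine (map_comp _ _ _ _ _).symm.trans (Eq.trans (congrArg _ ?_) (map_comp _ _ _ _ _))
  rw [id_tensorHom_id, Category.id_comp, Category.comp_id]

theorem modelIsoX_counit : (modelIsoX.{w} A).hom ≫ ε[A.X] =
    ε[(ThESCFM.generic.mapFunctor (modelFunctor.{w} A)).X] := by
  refine (congrArg (CategoryStruct.comp _) ((map_top (single A point.{w}) (nil A)).trans
    Wires.map_counit).symm).trans ?_
  refine (map_comp _ _ (nil A) _ (⊤ : Corelation point.{w}.carrier PEmpty)).symm.trans ?_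
  exact (congrArg _ (Category.id_comp _)).trans (modelFunctor_counit A).symm

/-- An isomorphism of extraspecial commutative Frobenius monoids from an isomorphism that commutes
with the operations. -/
def isoMk {A B : ESCFM C} (e : A.X ≅ B.X) (hmul : μ[A.X] ≫ e.hom = (e.hom ⊗ₘ e.hom) ≫ μ[B.X])
    (hone : η[A.X] ≫ e.hom = η[B.X]) (hcomul : e.hom ≫ Δ[B.X] = Δ[A.X] ≫ (e.hom ⊗ₘ e.hom))
    (hcounit : e.hom ≫ ε[B.X] = ε[A.X]) : A ≅ B where
  hom := ⟨e.hom, ⟨hone, hmul⟩, ⟨hcounit, hcomul⟩⟩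
  inv := ⟨e.inv,
    ⟨by rw [← hone, Category.assoc, e.hom_inv_id, Category.comp_id],
      by rw [← cancel_mono e.hom, Category.assoc, e.inv_hom_id, Category.comp_id, Category.assoc,
        hmul, tensorHom_comp_tensorHom_assoc, e.inv_hom_id, id_tensorHom_id, Category.id_comp]⟩,
    ⟨by rw [← hcounit, e.inv_hom_id_assoc],
      by rw [← cancel_epi e.hom, e.hom_inv_id_assoc, reassoc_of% hcomul, tensorHom_comp_tensorHom,
        e.hom_inv_id, id_tensorHom_id, Category.comp_id]⟩⟩
  hom_inv_id := ESCFM.Hom.ext e.hom_inv_id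
  inv_hom_id := ESCFM.Hom.ext e.inv_hom_id

/-- The model functor sends the generic monoid to the given monoid. -/
noncomputable def modelIso : ThESCFM.generic.mapFunctor (modelFunctor.{w} A) ≅ A :=
  isoMk (modelIsoX.{w} A) (modelIsoX_mul A) (modelIsoX_one A) (modelIsoX_comul A)
    (modelIsoX_counit A)

/-- The identity functor preserves extraspecial commutative Frobenius monoids. -/
def mapFunctorId : A.mapFunctor (𝟭 C) ≅ A :=
  isoMk (Iso.refl _)
    (by
      change (𝟙 _ ≫ μ[A.X]) ≫ 𝟙 _ = (𝟙 _ ⊗ₘ 𝟙 _) ≫ μ[A.X]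
      simp)
    (by
      change (𝟙 _ ≫ η[A.X]) ≫ 𝟙 _ = η[A.X]
      simp)
    (by
      change 𝟙 _ ≫ Δ[A.X] = (Δ[A.X] ≫ 𝟙 _) ≫ (𝟙 _ ⊗ₘ 𝟙 _)
      simp)
    (by
      change 𝟙 _ ≫ ε[A.X] = ε[A.X] ≫ 𝟙 _
      simp)

end ESCFM

/-! ### The presented prop is isomorphic to the prop of corelations -/

/-- The model of the generic monoid in the presented prop is monoidally isomorphic to the
identity. -/
noncomputable def modelFunctorGenericIso :
    (⟨ESCFM.modelFunctor.{w} ThESCFM.generic⟩ : SymMonFunctor ThESCFM.Obj ThESCFM.Obj) ≅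
      ⟨𝟭 ThESCFM.Obj⟩ :=
  -- Evaluation at the generic monoid is fully faithful, so an isomorphism of the two image monoids
  -- lifts to the functors.
  ThESCFM.generic.evaluation.preimageIso
    (ESCFM.modelIso.{w} ThESCFM.generic ≪≫ ThESCFM.generic.mapFunctorId.symm)

/-- The natural isomorphism underlying an isomorphism of symmetric monoidal functors. -/
def SymMonFunctor.natIso {D C : Type*} [Category* D] [MonoidalCategory D] [SymmetricCategory D]
    [Category* C] [MonoidalCategory C] [SymmetricCategory C] {F G : SymMonFunctor D C} (e : F ≅ G) :
    F.functor ≅ G.functor where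
  hom := e.hom.hom
  inv := e.inv.hom
  hom_inv_id := congrArg SymMonFunctor.Hom.hom e.hom_inv_id
  inv_hom_id := congrArg SymMonFunctor.Hom.hom e.inv_hom_id

/-- A functor that factors through `evalESCFM` is naturally isomorphic to the identity, so
conjugating by that isomorphism recovers a morphism from its corelation. -/
theorem evalESCFM_injective {n m : ℕ} :
    Function.Injective (PROP.Morphism.map evalESCFM : ThESCFM.Hom n m → corelPROP.Hom n m) := by
  intro s t h
  have e := SymMonFunctor.natIso modelFunctorGenericIso.{0}
  have hs := e.hom.naturality (X := ⟨n⟩) (Y := ⟨m⟩) s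
  have ht := e.hom.naturality (X := ⟨n⟩) (Y := ⟨m⟩) t
  have hst : (ESCFM.modelFunctor.{0} ThESCFM.generic).map (X := ⟨n⟩) (Y := ⟨m⟩) s =
      (ESCFM.modelFunctor.{0} ThESCFM.generic).map (X := ⟨n⟩) (Y := ⟨m⟩) t :=
    congrArg (corelInclusion.{0} ⋙ ESCFM.corelFunctor ThESCFM.generic).map h
  exact (cancel_epi _).1 (hs.symm.trans ((congrArg (· ≫ _) hst).trans ht))

/-- A morphism of props that is bijective on morphisms is an isomorphism. -/
noncomputable def PROP.isoOfBijective {P Q : PROP.{w}} (φ : P ⟶ Q)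
    (h : ∀ n m, Function.Bijective (Morphism.map φ : P.Hom n m → Q.Hom n m)) : P ≅ Q :=
  let e n m := Equiv.ofBijective _ (h n m)
  have he {n m} (f : Q.Hom n m) : Morphism.map φ ((e n m).symm f) = f := (e n m).apply_symm_apply f
  { hom := φ
    inv :=
      { map := fun {n m} f => (e n m).symm f
        map_id := fun n => (h n n).1 (by rw [he, Morphism.map_id])
        map_comp := fun f g => (h _ _).1 (by rw [he, Morphism.map_comp, he, he])
        map_tensor := fun f g => (h _ _).1 (by rw [he, Morphism.map_tensor, he, he])
        map_braid := fun n m => (h _ _).1 (by rw [he, Morphism.map_braid]) }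
    hom_inv_id := PROP.Morphism.ext (by
      funext n m f
      exact (e n m).symm_apply_apply f)
    inv_hom_id := PROP.Morphism.ext (by
      funext n m f
      exact he f) }

theorem evalESCFM_bijective (n m : ℕ) :
    Function.Bijective (PROP.Morphism.map evalESCFM : ThESCFM.Hom n m → corelPROP.Hom n m) :=
  ⟨evalESCFM_injective, evalESCFM_surjective⟩

instance : (PROP.functor evalESCFM).IsEquivalence where
  faithful := ⟨fun h => evalESCFM_injective h⟩
  full := ⟨fun f => evalESCFM_surjective f⟩
  essSurj := ⟨fun n => ⟨⟨n.val⟩, ⟨Iso.refl _⟩⟩⟩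

/-- Two out of three: the composite is isomorphic to the identity, and its first two factors are
equivalences. -/
instance : (ESCFM.corelFunctor.{w} ThESCFM.generic).IsEquivalence := by
  have : (PROP.functor evalESCFM ⋙ corelInclusion.{w} ⋙
      ESCFM.corelFunctor.{w} ThESCFM.generic).IsEquivalence :=
    Functor.isEquivalence_of_iso (SymMonFunctor.natIso modelFunctorGenericIso.{w}).symm
  have := Functor.isEquivalence_of_comp_left (PROP.functor evalESCFM)
    (corelInclusion.{w} ⋙ ESCFM.corelFunctor.{w} ThESCFM.generic)
  exact Functor.isEquivalence_of_comp_left corelInclusion.{w} _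

/-! ### The prop of corelations classifies extraspecial commutative Frobenius monoids -/

/-- Precomposition with the interpretation functor. -/
def precompEval :
    SymMonFunctor corelPROP.Obj C ⥤ SymMonFunctor ThESCFM.Obj C where
  obj F := ⟨PROP.functor evalESCFM ⋙ F.functor⟩
  map θ := ⟨Functor.whiskerLeft _ θ.hom, by
    have := θ.isMonoidal
    infer_instance⟩

/-- The functor of a morphism of props is strict and the identity on objects, so restriction along
it changes the structure maps only by the image of an identity. -/
theorem isMonoidal_of_eval {F G : corelPROP.Obj ⥤ C} [F.Braided] [G.Braided] (θ : F ⟶ G)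
    [NatTrans.IsMonoidal (Functor.whiskerLeft (PROP.functor evalESCFM) θ)] :
    NatTrans.IsMonoidal θ where
  unit := by
    have h := NatTrans.IsMonoidal.unit (τ := Functor.whiskerLeft (PROP.functor evalESCFM) θ)
    have hF : Functor.LaxMonoidal.ε (PROP.functor evalESCFM ⋙ F) = Functor.LaxMonoidal.ε F :=
      (congrArg (CategoryStruct.comp _) (F.map_id _)).trans (Category.comp_id _)
    have hG : Functor.LaxMonoidal.ε (PROP.functor evalESCFM ⋙ G) = Functor.LaxMonoidal.ε G :=
      (congrArg (CategoryStruct.comp _) (G.map_id _)).trans (Category.comp_id _)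
    exact (congrArg (· ≫ _) hF).symm.trans (h.trans hG)
  tensor n m := by
    have h := NatTrans.IsMonoidal.tensor (τ := Functor.whiskerLeft (PROP.functor evalESCFM) θ)
      ⟨n.val⟩ ⟨m.val⟩
    have hF : Functor.LaxMonoidal.μ (PROP.functor evalESCFM ⋙ F) ⟨n.val⟩ ⟨m.val⟩ =
        Functor.LaxMonoidal.μ F n m :=
      (congrArg (CategoryStruct.comp _) (F.map_id _)).trans (Category.comp_id _)
    have hG : Functor.LaxMonoidal.μ (PROP.functor evalESCFM ⋙ G) ⟨n.val⟩ ⟨m.val⟩ =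
        Functor.LaxMonoidal.μ G n m :=
      (congrArg (CategoryStruct.comp _) (G.map_id _)).trans (Category.comp_id _)
    exact (congrArg (· ≫ _) hF).symm.trans (h.trans (congrArg (CategoryStruct.comp _) hG))

instance : (precompEval (C := C)).Faithful where
  map_injective h := SymMonFunctor.Hom.ext (NatTrans.ext (funext fun n =>
    congrArg (fun ψ => ψ.hom.app (⟨n.val⟩ : ThESCFM.Obj)) h))

instance : (precompEval (C := C)).Full where
  map_surjective {F G} ψ := by
    let θ : F.functor ⟶ G.functor :=
      { app := fun n => ψ.hom.app ⟨n.val⟩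
        naturality := fun n m f => by
          -- Every corelation comes from a term, so naturality on the presented prop suffices.
          obtain ⟨g, rfl⟩ := evalESCFM_surjective f
          exact ψ.hom.naturality (X := ⟨n.val⟩) (Y := ⟨m.val⟩) g }
    have : NatTrans.IsMonoidal (Functor.whiskerLeft (PROP.functor evalESCFM) θ) := ψ.isMonoidal
    exact ⟨⟨θ, isMonoidal_of_eval θ⟩, rfl⟩

/-- Evaluation at the generic monoid, as a functor on symmetric monoidal functors out of the prop
of corelations. -/
abbrev corelEvaluation : SymMonFunctor corelPROP.Obj C ⥤ ESCFM C :=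
  precompEval ⋙ ThESCFM.generic.evaluation

instance : (corelEvaluation (C := C)).IsEquivalence where
  faithful := inferInstance
  full := inferInstance
  -- Restricting this functor along `evalESCFM` gives the model functor of `A`, whose value on the
  -- generic monoid is `A` up to isomorphism.
  essSurj := ⟨fun A => ⟨⟨corelInclusion.{0} ⋙ A.corelFunctor⟩, ⟨A.modelIso⟩⟩⟩

end

/-- The prop of corelations is the strict skeleton of the symmetric monoidal category of finite sets
and corelations, it is isomorphic to the prop presented by the theory of extraspecial commutative
Frobenius monoids (so that the category of corelations is equivalent to the latter as a symmetric
monoidal category), and it is the prop for extraspecial commutative Frobenius monoids. -/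
theorem mainTheorem1 :
    (∃ F : SymMonFunctor corelPROP.Obj FinCorel.{w},
      IsSkeletonOf FinCorel.{w} corelPROP.Obj F.functor) ∧
    (∃ e : ThESCFM ≅ corelPROP,
      e.hom.map (theoryESCFM.gen ESCFMGen.mul) = (⊤ : Corelation (Fin 2) (Fin 1)) ∧
      e.hom.map (theoryESCFM.gen ESCFMGen.unit) = (⊤ : Corelation (Fin 0) (Fin 1)) ∧
      e.hom.map (theoryESCFM.gen ESCFMGen.comul) = (⊤ : Corelation (Fin 1) (Fin 2)) ∧
      e.hom.map (theoryESCFM.gen ESCFMGen.counit) = (⊤ : Corelation (Fin 1) (Fin 0))) ∧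
    (∃ F : SymMonFunctor FinCorel.{w} ThESCFM.Obj, F.functor.IsEquivalence) ∧
    (∀ (C : Type u) [Category.{v} C] [MonoidalCategory C] [SymmetricCategory C],
      ∃ E : SymMonFunctor corelPROP.Obj C ≌ ESCFM C,
        Nonempty (E.functor ⋙ ESCFM.forget C ≅
          SymMonFunctor.eval C (⟨1⟩ : corelPROP.Obj))) := by
  refine ⟨⟨⟨corelInclusion⟩, isSkeletonOf_corelInclusion⟩,
    ⟨PROP.isoOfBijective evalESCFM evalESCFM_bijective, rfl, rfl, rfl, rfl⟩,
    ⟨⟨ESCFM.corelFunctor ThESCFM.generic⟩, inferInstance⟩, ?_⟩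
  intro C _ _ _
  -- The generic monoid lives on the object 1, so the underlying object of its image is the value at
  -- 1 by definition.
  exact ⟨corelEvaluation.asEquivalence, ⟨NatIso.ofComponents (fun F => Iso.refl _) fun θ =>
    (Category.comp_id _).trans (Category.id_comp _).symm⟩⟩
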